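/- **Setting.** Fix an integer $K\ge 1$, $\tau\in(0,1]$, constants $(\mu_p)_{p\in\mathbb N}$ with $\mu_2=1$, and $c_0>0$, $C\in\mathbb R$. Let $\psi:[0,1)^2\times\mathbb Z^2\to\mathbb R$ be piecewise Lipschitz: there is a partition of $[0,1)$ into finitely many disjoint intervals $I_\alpha$ such that $\psi(\cdot,\cdot,k,l)$ is Lipschitz on $I_\alpha\times I_{\alpha'}$ for all $\alpha,\alpha',k,l$. Assume $\psi(\theta,\phi,k,l)=\psi(\theta,\phi,-k,-l)=\psi(\phi,\theta,l,k)$. For each $N$ let $(x_{ij})_{1\le i\le j\le N}=(x^{(N)}_{ij})$ be centered real random variables such that $x_{ij}$ is independent of the family $(x_{kl})_{|i-k|\vee|j-l|>K}$, such that $\mathbb E|x_{ij}|^p\le (N/N^{\tau})^{p/2-1}\mu_p^p$ for all integers $p\ge2$, and such that for $i\le j$, $k\le l$ $$\bigl|\mathbb E[x_{ij}x_{kl}]-\psi(i/N,j/N,k-i,l-j)\bigr|\le C/N$$ whenever $(i/N,j/N)$ lies in $[0,1)^2$ and not in the $K/N$-neighbourhood of a discontinuity of $\psi(\cdot,\cdot,k-i,l-j)$.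 Put $\xi_{ijkl}=\mathbb E[x_{ij}x_{kl}]$ if $i\le j$, $k\le l$; $\xi_{ijkl}=\xi_{jilk}$ if $i>j$, $k>l$; $\xi_{ijkl}=0$ otherwise. Assume that $\xi$ is positive definite with lower bound $c_0$, i.e. for every $N$ the covariance matrix of $(x_{ij})_{i\le j}$ is $\ge c_0$. For $z\in\mathbb C^+$ and $M\in\mathbb C^{N\times N}$ let $\Xi(M)_{ik}=\frac1N\sum_{j,l}\xi_{ijkl}M_{jl}$ and $F(M)=F_z(M)=(-z-\Xi(M))^{-1}$ (when the inverse exists). Let $M=M(N,z)$ denote the solution of $M(-z-\Xi(M))=I$ with $\frac1{2i}(M-M^*)>0$. Write $\|A\|_\infty=\max_{i,j}|A_{ij}|$. Let $\mathcal K$ be the algebra of sequences $(a(k))_{k\in\mathbb Z}$ for which convolution $a*\cdot$ maps $\ell^2(\mathbb Z)$ into itself, with $\|a\|=\|\check a\|_\infty$, $\check a(\zeta)=\sum_k a(k)e^{2\pi ik\zeta}$. Let $\mathcal T=L^\infty([0,1),\mathcal K)$ (measurable coordinates, functions identified a.e.) and $\mathcal T_+=\{f\in\mathcal T:\operatorname{ess\,inf}\operatorname{Im}\check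 f>0\}$, where $\check f(\theta,\cdot)$ is the transform of $f(\theta)$. For $f\in\mathcal T$ put $\Psi(f)(\theta,k)=\sum_l\int_0^1\psi(\theta,\phi,k,l)f(\phi,l)\,d\phi$ and $\operatorname{tr}f=\int_0^1f(\theta,0)\,d\theta$. Let $m=m(z)\in\mathcal T_+$ denote the solution of $m=(-z-\Psi(m))^{-1}$, where $z$ stands for $z\delta_{k0}$ and the inverse is taken in $\mathcal K$ for a.e. $\theta$. **Theorem (stability in the bulk).** Let $\mathcal D\subset\mathbb C^+$ be a domain (open and connected) and $\omega>0$ such that $\operatorname{Im}\operatorname{tr}m(z)\ge\omega$ for all $z\in\mathcal D$. Then there are $\varepsilon_{\mathcal D}>0$, $c_{\mathcal D}>0$ and $N_{\mathcal D}$, depending only on $K,\tau,(\mu_p),c_0,\psi,C,\mathcal D,\omega$, such that for every such array, every $N\ge N_{\mathcal D}$, every $z\in\mathcal D$ and all $M',R\in\mathbb C^{N\times N}$ with $-z-\Xi(M')$ invertible and $M'=F(M')+R$: $$\|M'-M\|_\infty\vee\|R\|_\infty\le\varepsilon_{\mathcal D}\quad\Longrightarrow\quad\|M'-M\|_\infty\le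 c_{\mathcal D}\bigl(\|R\|_\infty+N^{-1}\bigr).$$ -/

import Mathlib

open MeasureTheory ProbabilityTheory

namespace CorrelatedMatrix

noncomputable section

/-! ## The limiting profile -/

/-- Lebesgue measure on `[0,1)`. -/
def unitMeasure : Measure ℝ := volume.restrict (Set.Ico (0 : ℝ) 1)

/-- The square `[0,1)²`. -/
def unitSquare : Set (ℝ × ℝ) := Set.Ico (0 : ℝ) 1 ×ˢ Set.Ico (0 : ℝ) 1

/-- `ψ : [0,1)² × ℤ² → ℝ` is piecewise Lipschitz (for some partition of `[0,1)` into finitely many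
disjoint intervals, each `ψ(·,·,k,l)` is Lipschitz on every product of two of the intervals) and
`ψ(θ,φ,k,l) = ψ(θ,φ,-k,-l) = ψ(φ,θ,l,k)`.  Only the values with `θ, φ ∈ [0,1)` matter. -/
structure IsProfile (ψ : ℝ → ℝ → ℤ → ℤ → ℝ) : Prop where
  piecewise_lipschitz : ∃ (n : ℕ) (I : Fin n → Set ℝ),
    (∀ α, (I α).OrdConnected) ∧ Pairwise (fun α β => Disjoint (I α) (I β)) ∧
    (⋃ α, I α) = Set.Ico (0 : ℝ) 1 ∧
    ∀ (α β : Fin n) (k l : ℤ), ∃ L : NNReal,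
      LipschitzOnWith L (fun p : ℝ × ℝ => ψ p.1 p.2 k l) (I α ×ˢ I β)
  symm_neg : ∀ θ ∈ Set.Ico (0 : ℝ) 1, ∀ φ ∈ Set.Ico (0 : ℝ) 1, ∀ k l : ℤ,
    ψ θ φ k l = ψ θ φ (-k) (-l)
  symm_swap : ∀ θ ∈ Set.Ico (0 : ℝ) 1, ∀ φ ∈ Set.Ico (0 : ℝ) 1, ∀ k l : ℤ,
    ψ θ φ k l = ψ φ θ l k

/-! ## The random matrix model -/

/-- The macroscopic position of an index: the element `i` of `Fin N` stands for the `(i+1)`-st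
index of `{1, …, N}`, so its position is `(i+1)/N`. -/
def pos {N : ℕ} (i : Fin N) : ℝ := ((i : ℝ) + 1) / N

/-- Distance `|i - k| ∨ |j - l|` of two pairs of indices. -/
def pairDist {N : ℕ} (i j k l : Fin N) : ℤ :=
  max |(i : ℤ) - (k : ℤ)| |(j : ℤ) - (l : ℤ)|

/-- `(i/N, j/N)` is a point of `[0,1)²` which is not in the (closed) `K/N`-neighbourhood of a
discontinuity of `ψ(·,·,a,b)`. -/
def IsRegularSite (K : ℕ) (ψ : ℝ → ℝ → ℤ → ℤ → ℝ) {N : ℕ} (i j : Fin N) (a b : ℤ) : Prop :=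
  (pos i, pos j) ∈ unitSquare ∧
  ∀ p ∈ unitSquare,
    ¬ ContinuousWithinAt (fun q : ℝ × ℝ => ψ q.1 q.2 a b) unitSquare p →
      (K : ℝ) / N < dist (pos i, pos j) p

/-- The arrays `(x_{ij})_{1 ≤ i ≤ j ≤ N}`, `N ∈ ℕ`, of centered real random variables: range of
dependence `K`, sparsity parameter `q = N^τ`, moment constants `μ_p`, and covariances that
discretize `ψ` with error at most `C/N`.  Only the entries `x N i j` with `i ≤ j` are used. -/
structure IsModel (K : ℕ) (τ : ℝ) (μ : ℕ → ℝ) (ψ : ℝ → ℝ → ℤ → ℤ → ℝ) (C : ℝ)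
    {Ω : ℕ → Type*} [∀ N, MeasurableSpace (Ω N)] (P : ∀ N, Measure (Ω N))
    (x : ∀ N, Fin N → Fin N → Ω N → ℝ) : Prop where
  measurable : ∀ N (i j : Fin N), i ≤ j → Measurable (x N i j)
  centered : ∀ N (i j : Fin N), i ≤ j → ∫ w, x N i j w ∂(P N) = 0
  /-- `x_{ij}` is independent of the family `(x_{kl})` with `|i-k| ∨ |j-l| > K`. -/
  dependence : ∀ N (i j : Fin N), i ≤ j →
    IndepFun (x N i j)
      (fun w (s : {s : Fin N × Fin N // s.1 ≤ s.2 ∧ (K : ℤ) < pairDist i j s.1 s.2}) =>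
        x N s.1.1 s.1.2 w) (P N)
  moments : ∀ N (i j : Fin N), i ≤ j → ∀ p : ℕ, 2 ≤ p →
    Integrable (fun w => |x N i j w| ^ p) (P N) ∧
    ∫ w, |x N i j w| ^ p ∂(P N)
      ≤ ((N : ℝ) / (N : ℝ) ^ τ) ^ ((p : ℝ) / 2 - 1) * μ p ^ p
  discretization : ∀ N (i j k l : Fin N), i ≤ j → k ≤ l →
    IsRegularSite K ψ i j ((k : ℤ) - (i : ℤ)) ((l : ℤ) - (j : ℤ)) →
    |(∫ w, x N i j w * x N k l w ∂(P N))
        - ψ (pos i) (pos j) ((k : ℤ) - (i : ℤ)) ((l : ℤ) - (j : ℤ))| ≤ C / N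

/-- The covariance matrix of the family `(x_{ij})_{i ≤ j}`. -/
def covMat {N : ℕ} {Ω : Type*} [MeasurableSpace Ω] (P : Measure Ω) (x : Fin N → Fin N → Ω → ℝ) :
    Matrix {s : Fin N × Fin N // s.1 ≤ s.2} {s : Fin N × Fin N // s.1 ≤ s.2} ℝ :=
  Matrix.of fun s t => covariance (x s.1.1 s.1.2) (x t.1.1 t.1.2) P

/-- `ξ` is positive definite with lower bound `c₀`: every covariance matrix is `≥ c₀`. -/
def IsPosDefTensor (c₀ : ℝ) {Ω : ℕ → Type*} [∀ N, MeasurableSpace (Ω N)]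
    (P : ∀ N, Measure (Ω N)) (x : ∀ N, Fin N → Fin N → Ω N → ℝ) : Prop :=
  ∀ N, (covMat (P N) (x N) - c₀ • (1 : Matrix _ _ ℝ)).PosSemidef

/-! ## The finite-dimensional equation -/

/-- The tensor `ξ_{ijkl}`: it is `E[x_{ij} x_{kl}]` for `i ≤ j`, `k ≤ l`, it is `ξ_{jilk}` for
`i > j`, `k > l`, and `0` otherwise. -/
def tensor {N : ℕ} {Ω : Type*} [MeasurableSpace Ω] (P : Measure Ω) (x : Fin N → Fin N → Ω → ℝ)
    (i j k l : Fin N) : ℝ :=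
  if i ≤ j ∧ k ≤ l then ∫ w, x i j w * x k l w ∂P
  else if j < i ∧ l < k then ∫ w, x j i w * x l k w ∂P
  else 0

/-- `Ξ(M)_{ik} = N⁻¹ ∑_{j,l} ξ_{ijkl} M_{jl}`. -/
def Xi {N : ℕ} (ξ : Fin N → Fin N → Fin N → Fin N → ℝ) (M : Matrix (Fin N) (Fin N) ℂ) :
    Matrix (Fin N) (Fin N) ℂ :=
  Matrix.of fun i k => (1 / (N : ℂ)) * ∑ j, ∑ l, (ξ i j k l : ℂ) * M j l

/-- The matrix `-z - Ξ(M)`. -/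
def resolventDenom {N : ℕ} (ξ : Fin N → Fin N → Fin N → Fin N → ℝ) (z : ℂ)
    (M : Matrix (Fin N) (Fin N) ℂ) : Matrix (Fin N) (Fin N) ℂ :=
  -(z • (1 : Matrix (Fin N) (Fin N) ℂ)) - Xi ξ M

/-- `F(M) = (-z - Ξ(M))⁻¹`. -/
def F {N : ℕ} (ξ : Fin N → Fin N → Fin N → Fin N → ℝ) (z : ℂ)
    (M : Matrix (Fin N) (Fin N) ℂ) : Matrix (Fin N) (Fin N) ℂ :=
  (resolventDenom ξ z M)⁻¹

open scoped ComplexOrder in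
/-- `M` is the solution of `M (-z - Ξ(M)) = I` with `(M - M*)/(2i) > 0`. -/
def IsMatrixSolution {N : ℕ} (ξ : Fin N → Fin N → Fin N → Fin N → ℝ) (z : ℂ)
    (M : Matrix (Fin N) (Fin N) ℂ) : Prop :=
  ((1 / (2 * Complex.I)) • (M - M.conjTranspose)).PosDef ∧ M * resolventDenom ξ z M = 1

/-- `M' = F(M') + R`, where `-z - Ξ(M')` is invertible, so that `F(M')` is defined. -/
def IsPerturbedSolution {N : ℕ} (ξ : Fin N → Fin N → Fin N → Fin N → ℝ) (z : ℂ)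
    (M' R : Matrix (Fin N) (Fin N) ℂ) : Prop :=
  IsUnit (resolventDenom ξ z M') ∧ M' = F ξ z M' + R

/-- `‖A‖_∞ = max_{i,j} |A_{ij}|`. -/
def maxNorm {N : ℕ} (A : Matrix (Fin N) (Fin N) ℂ) : ℝ :=
  ⨆ s : Fin N × Fin N, ‖A s.1 s.2‖

/-! ## The limiting equation -/

/-- Convolution of bi-infinite sequences. -/
def conv (a b : ℤ → ℂ) : ℤ → ℂ := fun n => ∑' k, a k * b (n - k)

/-- The unit of convolution. -/
def delta : ℤ → ℂ := Pi.single 0 1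

/-- `a ∈ 𝒦`: convolution with `a` maps `ℓ²(ℤ)` to `ℓ²(ℤ)`. -/
def IsConvolver (a : ℤ → ℂ) : Prop :=
  ∀ g : ℤ → ℂ, Memℓp g 2 →
    (∀ n, Summable fun k => a k * g (n - k)) ∧ Memℓp (conv a g) 2

/-- `b` is the inverse of `a` in the (commutative) algebra `𝒦`. -/
def IsInverseK (a b : ℤ → ℂ) : Prop :=
  IsConvolver a ∧ IsConvolver b ∧ conv a b = delta

open Classical in
/-- The inverse Fourier transform `ζ ↦ ∑_k a(k) e^{2πikζ}`, as an element of `L²(ℝ/ℤ)`; elements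
of `𝒦` are square summable, and other sequences get the value `0`. -/
def symbol (a : ℤ → ℂ) : Lp ℂ 2 (AddCircle.haarAddCircle : Measure UnitAddCircle) :=
  if h : Memℓp a 2 then
    (fourierBasis (T := (1 : ℝ))).repr.symm (⟨a, h⟩ : lp (fun _ : ℤ => ℂ) 2) else 0

/-- `f ∈ 𝒯 = L^∞([0,1), 𝒦)`, where the norm of `𝒦` is the sup norm of the inverse Fourier
transform and measurability is that of the coordinates (so that `𝒯` is `L^∞([0,1)²)` on the
Fourier side). -/
structure MemT (f : ℝ → ℤ → ℂ) : Prop where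
  measurable : ∀ k, AEStronglyMeasurable (fun θ => f θ k) unitMeasure
  convolver : ∀ᵐ θ ∂unitMeasure, IsConvolver (f θ)
  bounded : ∃ B : ℝ, ∀ᵐ θ ∂unitMeasure,
    ∀ᵐ ζ ∂(AddCircle.haarAddCircle : Measure UnitAddCircle), ‖symbol (f θ) ζ‖ ≤ B

/-- `f ∈ 𝒯₊`: the imaginary part of the inverse Fourier transform of `f` is bounded below by a
positive constant. -/
def MemTPlus (f : ℝ → ℤ → ℂ) : Prop :=
  MemT f ∧ ∃ c : ℝ, 0 < c ∧ ∀ᵐ θ ∂unitMeasure,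
    ∀ᵐ ζ ∂(AddCircle.haarAddCircle : Measure UnitAddCircle), c ≤ (symbol (f θ) ζ).im

/-- `Ψ(f)(θ,k) = ∑_l ∫ ψ(θ,φ,k,l) f(φ,l) dφ`. -/
def Psi (ψ : ℝ → ℝ → ℤ → ℤ → ℝ) (f : ℝ → ℤ → ℂ) (θ : ℝ) (k : ℤ) : ℂ :=
  ∑' l : ℤ, ∫ φ, (ψ θ φ k l : ℂ) * f φ l ∂unitMeasure

/-- `tr f = ∫₀¹ f(θ,0) dθ`. -/
def trT (f : ℝ → ℤ → ℂ) : ℂ := ∫ θ, f θ 0 ∂unitMeasure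

/-- `m` is the solution of `m = (-z - Ψ(m))⁻¹` in `𝒯₊`. -/
def IsLimitSolution (ψ : ℝ → ℝ → ℤ → ℤ → ℝ) (z : ℂ) (m : ℝ → ℤ → ℂ) : Prop :=
  MemTPlus m ∧ ∀ᵐ θ ∂unitMeasure,
    IsInverseK (fun k => -(z * delta k) - Psi ψ m θ k) (m θ)

end

end CorrelatedMatrix

/-! Probability enters only through the covariance tensor: it is bounded, of range `K`, symmetric up
to diagonal effects, bounded below by `c₀`, and it discretizes `ψ` (`IsModel.isCovTensor`,
`IsModel.hasProfile`). Everything else is deterministic. Subtracting the equations of `M` and `M'`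
gives the linearized operator `X ↦ X - M Ξ(X) M` plus quadratic errors, so two things are needed
uniformly in `N` and `z`: bounded invertibility of this operator, given a lower bound on the
normalized trace `⟨Im M⟩`, and that lower bound itself.

Linear stability. Factor `M = Q diag(u) Qᴴ` with `|u i| = 1` and `Im (u i)` bounded below
(`exists_balanced_factorization`). In the coordinates given by `Q` the linearized operator is `1 - V
F`, where `V` multiplies the entry `(i, j)` by `u i * u j` and `F` is a congruence of the
symmetrized `Ξ`. The imaginary part of the equation says that `F (Im u) ≤ Im u` up to small errors.
As `F` is symmetric and two-positive, a Perron–Frobenius argument (`IsTwoPositive.hsNorm_apply_le`)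
bounds its norm by almost `1`. The unitary `V` rotates every entry by a definite angle, so spectrum
of `F` near `1` is harmless. Spectrum near `-1` is excluded because `ξ ≥ c₀`: removing the flat part
`c₀ ⟨·⟩`, which is a nonnegative form, leaves a map of norm at most `1 - δ`. `norm_le_of_rotation`
combines these facts. `Ξ` differs from its symmetrization by `O(1/N)`, and it maps both the
normalized Hilbert–Schmidt norm and the maximum norm boundedly into the operator norm. Hence
stability passes from the Hilbert–Schmidt norm to the operator norm (`exists_linear_stability`) and
to the maximum norm (`exists_max_stability`).

Lower bound on `⟨Im M⟩`. The limiting solution `m` is turned into a block diagonal matrix,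
`blockAvg`, which solves the matrix equation with a residual that is small in Hilbert–Schmidt norm
(`hsNorm_residual_sq_le`). One application of the map `F` makes the error small in operator norm
(`exists_isApproxSolution`). Linear stability and an inverse function theorem then give an exact
solution nearby, and uniqueness identifies it with `M` (`exists_trace_lower_bound`).

Uniformity in `z`. No quantitative bound on `m` is assumed. The lower bound `c₀` passes to the limit
as a coercivity estimate for `Ψ(m)` (`PsiBand_coercive`), which bounds the `ℓ²` norm of `m(θ)` by `1
/ (c₀ ω)`, and the limiting equation then bounds `z` as well. -/

namespace CorrelatedMatrix

/-! ### Symmetric operators on a Hilbert space and invertibility of `1 - V F`. -/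

section Hilbert
variable {E : Type*} [NormedAddCommGroup E] [InnerProductSpace ℂ E]

/-- A symmetric operator all of whose powers grow at most like `r ^ n` on `y` satisfies
`‖S y‖ ≤ r ‖y‖`. -/
theorem norm_apply_le_of_isSymmetric_of_pow (S : E →ₗ[ℂ] E) (hS : S.IsSymmetric) {r C : ℝ}
    (hr : 0 ≤ r) (y : E) (h : ∀ n : ℕ, ‖(S ^ n) y‖ ≤ C * r ^ n) : ‖S y‖ ≤ r * ‖y‖ := by
  by_contra! hlt
  have hy : 0 < ‖y‖ := by
    rw [norm_pos_iff]
    rintro rfl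
    simp at hlt
  set a : ℕ → ℝ := fun n => ‖(S ^ n) y‖ with ha
  have hsucc : ∀ n, (S ^ (n + 1)) y = S ((S ^ n) y) := fun n => by
    rw [pow_succ', Module.End.mul_apply]
  -- Symmetry makes `n ↦ ‖S ^ n y‖` log-convex, so the first ratio `ρ` bounds all later ratios from
  -- below.
  have hlog : ∀ n, a (n + 1) ^ 2 ≤ a n * a (n + 2) := by
    intro n
    have h1 : inner ℂ ((S ^ (n + 1)) y) ((S ^ (n + 1)) y)
        = inner ℂ ((S ^ n) y) ((S ^ (n + 2)) y) := by
      rw [hsucc (n + 1), ← hS, hsucc n]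
    have h2 := norm_inner_le_norm (𝕜 := ℂ) ((S ^ n) y) ((S ^ (n + 2)) y)
    rw [← h1, inner_self_eq_norm_sq_to_K] at h2
    simpa [ha] using h2
  set ρ := ‖S y‖ / ‖y‖ with hρ
  have hρr : r < ρ := by rwa [hρ, lt_div_iff₀ hy]
  have hρ0 : 0 < ρ := hr.trans_lt hρr
  have key : ∀ n, 0 < a n ∧ ρ * a n ≤ a (n + 1) := by
    intro n
    induction n with
    | zero =>
      refine ⟨by simpa [ha] using hy, ?_⟩
      simp [ha, hρ, div_mul_cancel₀ _ hy.ne']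
    | succ k ih =>
      have hpos : 0 < a (k + 1) := (mul_pos hρ0 ih.1).trans_le ih.2
      refine ⟨hpos, ?_⟩
      have h1 := hlog k
      have h2 : ρ * a k * a (k + 1) ≤ a k * a (k + 2) := by
        calc ρ * a k * a (k + 1) ≤ a (k + 1) * a (k + 1) := by gcongr; exact ih.2
          _ ≤ _ := by rw [← sq]; exact h1
      have h3 : a k * (ρ * a (k + 1)) ≤ a k * a (k + 1 + 1) := by linarith
      exact le_of_mul_le_mul_left h3 ih.1
  have hgrow : ∀ n, ρ ^ n * ‖y‖ ≤ a n := by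
    intro n
    induction n with
    | zero => simp [ha]
    | succ k ih =>
      calc ρ ^ (k + 1) * ‖y‖ = ρ * (ρ ^ k * ‖y‖) := by ring
        _ ≤ ρ * a k := by gcongr
        _ ≤ _ := (key k).2
  rcases hr.eq_or_lt with rfl | hr0
  · have h1 := h 1
    simp at h1
    simp [h1] at hlt
  · have hb : ∀ n : ℕ, (ρ / r) ^ n ≤ C / ‖y‖ := by
      intro n
      rw [div_pow, div_le_div_iff₀ (by positivity) hy]
      exact (hgrow n).trans (h n)
    obtain ⟨n, hn⟩ := pow_unbounded_of_one_lt (C / ‖y‖) ((one_lt_div hr0).2 hρr)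
    exact absurd (hb n) (not_le.2 hn)

/-- The norm of a symmetric operator is at most its numerical radius. -/
theorem norm_apply_le_of_abs_inner_le (S : E →ₗ[ℂ] E) (hS : S.IsSymmetric) {ρ : ℝ}
    (hρ : 0 ≤ ρ) (h : ∀ y, |(inner ℂ y (S y)).re| ≤ ρ * ‖y‖ ^ 2) (y : E) :
    ‖S y‖ ≤ ρ * ‖y‖ := by
  have polar : ∀ u v : E, (inner ℂ v (S u)).re ≤ ρ / 2 * (‖u‖ ^ 2 + ‖v‖ ^ 2) := by
    intro u v
    have h1 := (abs_le.1 (h (u + v))).2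
    have h2 := (abs_le.1 (h (u - v))).1
    have h3 : (inner ℂ u (S v)).re = (inner ℂ v (S u)).re := by
      rw [← hS, ← inner_conj_symm, Complex.conj_re]
    have h4 := parallelogram_law_with_norm ℂ u v
    simp only [map_add, map_sub, inner_add_left, inner_add_right, inner_sub_left,
      inner_sub_right, Complex.add_re, Complex.sub_re] at h1 h2
    nlinarith
  rcases (norm_nonneg (S y)).eq_or_lt with h0 | h0
  · rw [← h0]; positivity
  have hy : 0 < ‖y‖ := by
    rw [norm_pos_iff]
    rintro rfl
    simp at h0
  -- The multiple of `S y` with the norm of `y` makes the polarized bound sharp.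
  have h1 := polar y ((‖y‖ / ‖S y‖ : ℂ) • S y)
  rw [inner_smul_left, inner_self_eq_norm_sq_to_K, norm_smul] at h1
  have h2 : ((starRingEnd ℂ) (‖y‖ / ‖S y‖ : ℂ) * ((‖S y‖ : ℂ)) ^ 2).re = ‖y‖ * ‖S y‖ := by
    have : (starRingEnd ℂ) (‖y‖ / ‖S y‖ : ℂ) * ((‖S y‖ : ℂ)) ^ 2
        = ((‖y‖ * ‖S y‖ : ℝ) : ℂ) := by
      rw [map_div₀, Complex.conj_ofReal, Complex.conj_ofReal]
      have : (‖S y‖ : ℂ) ≠ 0 := by exact_mod_cast h0.ne'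
      push_cast
      field_simp
    rw [this, Complex.ofReal_re]
  have h3 : ‖(‖y‖ / ‖S y‖ : ℂ)‖ * ‖S y‖ = ‖y‖ := by
    rw [norm_div, Complex.norm_real, Complex.norm_real, norm_norm, norm_norm,
      div_mul_cancel₀ _ h0.ne']
  rw [h3] at h1
  have h4 : ‖y‖ * ‖S y‖ ≤ ρ / 2 * (‖y‖ ^ 2 + ‖y‖ ^ 2) := by
    rw [← h2]; exact h1
  have h5 : ‖y‖ * ‖S y‖ ≤ ‖y‖ * (ρ * ‖y‖) := by nlinarith
  exact le_of_mul_le_mul_left h5 hy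

/-- Bounded invertibility of `1 - V F`, where `V` is an isometry (with inverse `V'`) rotating every
vector by a definite angle and `F` is symmetric, almost contractive, and bounded away from `-1`. -/
theorem norm_le_of_rotation (F F' V V' : E →ₗ[ℂ] E) (hF : F.IsSymmetric)
    {ε δ σ : ℝ} (hε : 0 ≤ ε) (hδ : 0 < δ) (hδ1 : δ ≤ 1) (hσ : 0 < σ)
    (hσ1 : σ ≤ 1) (hεδ : 2 * ε ≤ δ * σ ^ 2)
    (hFn : ∀ y, ‖F y‖ ≤ (1 + ε) * ‖y‖) (hFn' : ∀ y, ‖F' y‖ ≤ (1 - δ) * ‖y‖)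
    (hFF : ∀ y, (inner ℂ y (F' y)).re ≤ (inner ℂ y (F y)).re)
    (hV : ∀ y, V' (V y) = y) (hVn : ∀ y, ‖V y‖ = ‖y‖) (hVn' : ∀ y, ‖V' y‖ = ‖y‖)
    (hrot : ∀ y, (inner ℂ y (V' y)).re ≤ (1 - 2 * σ ^ 2) * ‖y‖ ^ 2) (y : E) :
    δ * σ ^ 2 * ‖y‖ ≤ 4 * ‖y - V (F y)‖ := by
  have hσ2 : σ ^ 2 ≤ 1 := by nlinarith
  have re_le : ∀ u v : E, (inner ℂ u v).re ≤ ‖u‖ * ‖v‖ := fun u v =>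
    (Complex.re_le_norm _).trans (norm_inner_le_norm u v)
  have neg_re_le : ∀ u v : E, -(inner ℂ u v).re ≤ ‖u‖ * ‖v‖ := fun u v =>
    (neg_le_abs _).trans ((Complex.abs_re_le_norm _).trans (norm_inner_le_norm u v))
  have up : ∀ y, (inner ℂ y (F y)).re ≤ (1 + ε) * ‖y‖ ^ 2 := fun y =>
    (re_le _ _).trans (by nlinarith [hFn y, norm_nonneg y])
  have low : ∀ y, -((1 - δ) * ‖y‖ ^ 2) ≤ (inner ℂ y (F y)).re := fun y => by
    have h1 := neg_re_le y (F' y)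
    have h2 := hFF y
    nlinarith [hFn' y, norm_nonneg y]
  -- The numerical range of `F` lies in `[-(1 - δ), 1 + ε]`, with midpoint `c`. After the shift the
  -- numerical radius is half the length of the interval, and squaring gives `chord`, that is, `(F -
  -- (1 + ε)) (F + (1 - δ)) ≤ 0`.
  set c : ℝ := (ε + δ) / 2 with hc
  set S : E →ₗ[ℂ] E := F - (c : ℂ) • LinearMap.id with hSdef
  have hS : S.IsSymmetric := by
    intro u v
    simp only [hSdef, LinearMap.sub_apply, LinearMap.smul_apply, LinearMap.id_apply,
      inner_sub_left, inner_sub_right, inner_smul_left, inner_smul_right, Complex.conj_ofReal]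
    rw [hF u v]
  have hSy : ∀ y, S y = F y - (c : ℂ) • y := fun y => rfl
  have hself : ∀ y : E, (inner ℂ y y : ℂ) = ((‖y‖ ^ 2 : ℝ) : ℂ) := fun y => by
    rw [inner_self_eq_norm_sq_to_K]; push_cast; rfl
  have hSn : ‖S y‖ ≤ ((1 + ε) + (1 - δ)) / 2 * ‖y‖ := by
    refine norm_apply_le_of_abs_inner_le S hS (by linarith) (fun y => ?_) y
    have h1 := up y
    have h2 := low y
    rw [hSy, inner_sub_right, inner_smul_right, hself, ← Complex.ofReal_mul, Complex.sub_re,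
      Complex.ofReal_re, abs_le]
    constructor <;> nlinarith
  have chord : ‖F y‖ ^ 2 ≤ (ε + δ) * (inner ℂ y (F y)).re + (1 + ε) * (1 - δ) * ‖y‖ ^ 2 := by
    have h1 : ‖S y‖ ^ 2 ≤ (((1 + ε) + (1 - δ)) / 2 * ‖y‖) ^ 2 := by gcongr
    have h2 : ‖S y‖ ^ 2 = ‖F y‖ ^ 2 - 2 * (c * (inner ℂ y (F y)).re) + c ^ 2 * ‖y‖ ^ 2 := by
      rw [hSy, @norm_sub_sq ℂ, inner_smul_right, norm_smul, Complex.norm_real, mul_pow,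
        Real.norm_eq_abs, sq_abs, ← hF]
      have h3 : (inner ℂ (F y) y).re = (inner ℂ y (F y)).re := by rw [hF]
      simp only [RCLike.re_to_complex, Complex.re_ofReal_mul]
    rw [h2] at h1
    have h4 : (((1 + ε) + (1 - δ)) / 2 * ‖y‖) ^ 2 = (1 + ε) * (1 - δ) * ‖y‖ ^ 2 + c ^ 2 * ‖y‖ ^ 2 := by
      rw [hc]; ring
    rw [h4, hc] at h1
    nlinarith
  -- If `e` vanished, `F y` would equal `V' y`: it would have the norm of `y`, but an inner product
  -- with `y` capped by the rotation, against `chord`. The rest keeps track of `e` in this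
  -- contradiction.
  set e := y - V (F y) with he
  have hV'e : V' e = V' y - F y := by rw [he, map_sub, hV]
  have h1 : (inner ℂ y (F y)).re ≤ (1 - 2 * σ ^ 2) * ‖y‖ ^ 2 + ‖y‖ * ‖e‖ := by
    have h2 : F y = V' y - V' e := by rw [hV'e]; abel
    rw [h2, inner_sub_right, Complex.sub_re]
    have h3 := neg_re_le y (V' e)
    rw [hVn'] at h3
    linarith [hrot y]
  have h2 : ‖y‖ ≤ ‖F y‖ + ‖e‖ := by
    calc ‖y‖ = ‖V (F y) + e‖ := by rw [he]; congr 1; abel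
      _ ≤ _ := (norm_add_le _ _).trans (by rw [hVn])
  rcases (norm_nonneg y).eq_or_lt with h0 | h0
  · rw [← h0]; simp
  by_cases h3 : ‖y‖ ≤ ‖e‖
  · have : δ * σ ^ 2 ≤ 1 := by nlinarith [sq_nonneg σ]
    nlinarith
  push Not at h3
  have h4 : (‖y‖ - ‖e‖) ^ 2 ≤ ‖F y‖ ^ 2 := by
    apply pow_le_pow_left₀ <;> linarith
  have hε1 : ε ≤ 1 := by nlinarith [sq_nonneg σ]
  have h5 : (ε + δ) * (inner ℂ y (F y)).re
      ≤ (ε + δ) * ((1 - 2 * σ ^ 2) * ‖y‖ ^ 2) + 2 * (‖y‖ * ‖e‖) := by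
    have h6 : (ε + δ) * (inner ℂ y (F y)).re
      ≤ (ε + δ) * ((1 - 2 * σ ^ 2) * ‖y‖ ^ 2 + ‖y‖ * ‖e‖) := by gcongr
    have h7 : (ε + δ) * (‖y‖ * ‖e‖) ≤ 2 * (‖y‖ * ‖e‖) := by gcongr; linarith
    linarith
  have h6 : (ε + δ) * ((1 - 2 * σ ^ 2) * ‖y‖ ^ 2) + (1 + ε) * (1 - δ) * ‖y‖ ^ 2
      ≤ (1 - δ * σ ^ 2) * ‖y‖ ^ 2 := by
    rw [← mul_assoc, ← add_mul]
    gcongr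
    nlinarith [mul_nonneg hε (sq_nonneg σ), mul_nonneg hε hδ.le]
  have h7 : ‖y‖ * (δ * σ ^ 2 * ‖y‖) ≤ ‖y‖ * (4 * ‖e‖) := by
    nlinarith [sq_nonneg ‖e‖]
  exact le_of_mul_le_mul_left h7 h0

end Hilbert


/-! ### Euclidean, operator and Hilbert–Schmidt norms; sesquilinear forms. -/

section MatrixForms
set_option linter.unusedSectionVars false
open Matrix
open scoped Matrix.Norms.L2Operator
variable {n : Type*} [Fintype n] [DecidableEq n]

/-- The Euclidean norm of a vector. -/
noncomputable def vecNorm (x : n → ℂ) : ℝ := ‖(WithLp.toLp 2 x : EuclideanSpace ℂ n)‖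

/-- The sesquilinear form `x* A y`. -/
def qf (A : Matrix n n ℂ) (x y : n → ℂ) : ℂ := star x ⬝ᵥ (A *ᵥ y)

theorem vecNorm_nonneg (x : n → ℂ) : 0 ≤ vecNorm x := norm_nonneg _

theorem vecNorm_sq (x : n → ℂ) : vecNorm x ^ 2 = ∑ i, ‖x i‖ ^ 2 :=
  EuclideanSpace.norm_sq_eq _

theorem vecNorm_eq_zero {x : n → ℂ} : vecNorm x = 0 ↔ x = 0 := by
  simp [vecNorm]

theorem vecNorm_mulVec_le (A : Matrix n n ℂ) (x : n → ℂ) :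
    vecNorm (A *ᵥ x) ≤ ‖A‖ * vecNorm x :=
  Matrix.l2_opNorm_mulVec A (WithLp.toLp 2 x)

theorem opNorm_le_of_vecNorm {A : Matrix n n ℂ} {C : ℝ} (hC : 0 ≤ C)
    (h : ∀ x, vecNorm (A *ᵥ x) ≤ C * vecNorm x) : ‖A‖ ≤ C := by
  rw [Matrix.cstar_norm_def]
  exact ContinuousLinearMap.opNorm_le_bound _ hC fun x => h (WithLp.ofLp x)

theorem norm_star_dotProduct_le (x y : n → ℂ) : ‖star x ⬝ᵥ y‖ ≤ vecNorm x * vecNorm y := by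
  have := norm_inner_le_norm (𝕜 := ℂ) (WithLp.toLp 2 x : EuclideanSpace ℂ n) (WithLp.toLp 2 y)
  rw [EuclideanSpace.inner_toLp_toLp, dotProduct_comm] at this
  exact this

theorem star_dotProduct_self (x : n → ℂ) : star x ⬝ᵥ x = ((vecNorm x ^ 2 : ℝ) : ℂ) := by
  rw [vecNorm_sq, dotProduct]
  push_cast
  refine Finset.sum_congr rfl fun i _ => ?_
  rw [Pi.star_apply, RCLike.star_def, RCLike.conj_mul]
  rfl

theorem norm_qf_le (A : Matrix n n ℂ) (x y : n → ℂ) :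
    ‖qf A x y‖ ≤ ‖A‖ * (vecNorm x * vecNorm y) := by
  refine (norm_star_dotProduct_le x _).trans ?_
  have := mul_le_mul_of_nonneg_left (vecNorm_mulVec_le A y) (vecNorm_nonneg x)
  linarith

theorem qf_add (A B : Matrix n n ℂ) (x y : n → ℂ) : qf (A + B) x y = qf A x y + qf B x y := by
  simp [qf, add_mulVec, dotProduct_add]

theorem qf_sub (A B : Matrix n n ℂ) (x y : n → ℂ) : qf (A - B) x y = qf A x y - qf B x y := by
  simp [qf, sub_mulVec, dotProduct_sub]

theorem qf_neg (A : Matrix n n ℂ) (x y : n → ℂ) : qf (-A) x y = -qf A x y := by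
  simp [qf, neg_mulVec]

theorem qf_smul (c : ℂ) (A : Matrix n n ℂ) (x y : n → ℂ) : qf (c • A) x y = c * qf A x y := by
  simp [qf, smul_mulVec, dotProduct_smul]

theorem qf_one (x : n → ℂ) : qf 1 x x = ((vecNorm x ^ 2 : ℝ) : ℂ) := by
  rw [qf, one_mulVec, star_dotProduct_self]

theorem qf_conj_mul (K A L : Matrix n n ℂ) (x y : n → ℂ) :
    qf (Kᴴ * A * L) x y = qf A (K *ᵥ x) (L *ᵥ y) := by
  rw [qf, qf, star_mulVec, ← dotProduct_mulVec, ← mulVec_mulVec, ← mulVec_mulVec]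

theorem qf_conjTranspose (A : Matrix n n ℂ) (x y : n → ℂ) :
    qf Aᴴ x y = star (qf A y x) := by
  rw [qf, qf, star_dotProduct, star_mulVec, conjTranspose_conjTranspose, ← dotProduct_mulVec]

theorem qf_single (A : Matrix n n ℂ) (i j : n) :
    qf A (Pi.single i 1) (Pi.single j 1) = A i j := by
  rw [qf, mulVec_single_one]
  simp

theorem vecNorm_single (i : n) : vecNorm (Pi.single i (1 : ℂ)) = 1 := by
  simp [vecNorm]

theorem norm_entry_le_opNorm (A : Matrix n n ℂ) (i j : n) : ‖A i j‖ ≤ ‖A‖ := by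
  have := norm_qf_le A (Pi.single i 1) (Pi.single j 1)
  rwa [qf_single, vecNorm_single, vecNorm_single, mul_one, mul_one] at this

theorem qf_diagonal (d : n → ℂ) (x : n → ℂ) :
    qf (diagonal d) x x = ∑ i, d i * ((‖x i‖ ^ 2 : ℝ) : ℂ) := by
  rw [qf, dotProduct]
  refine Finset.sum_congr rfl fun i _ => ?_
  rw [mulVec_diagonal, Pi.star_apply, RCLike.star_def, mul_left_comm, RCLike.conj_mul]
  norm_cast

/-- The matrix as a vector of `ℓ²(n × n)`. -/
noncomputable def hsVec : Matrix n n ℂ ≃ₗ[ℂ] EuclideanSpace ℂ (n × n) where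
  toFun A := WithLp.toLp 2 fun s => A s.1 s.2
  invFun v := Matrix.of fun i j => v (i, j)
  map_add' _ _ := rfl
  map_smul' _ _ := rfl
  left_inv _ := rfl
  right_inv _ := rfl

/-- The Hilbert–Schmidt norm. -/
noncomputable def hsNorm (A : Matrix n n ℂ) : ℝ := ‖hsVec A‖

theorem hsNorm_nonneg (A : Matrix n n ℂ) : 0 ≤ hsNorm A := norm_nonneg _

theorem hsNorm_sq (A : Matrix n n ℂ) : hsNorm A ^ 2 = ∑ i, ∑ j, ‖A i j‖ ^ 2 := by
  rw [hsNorm, EuclideanSpace.norm_sq_eq, Fintype.sum_prod_type]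
  rfl

theorem inner_hsVec (A B : Matrix n n ℂ) : inner ℂ (hsVec A) (hsVec B) = (Aᴴ * B).trace := by
  rw [hsVec]
  change inner ℂ (WithLp.toLp 2 _ : EuclideanSpace ℂ (n × n)) (WithLp.toLp 2 _) = _
  rw [EuclideanSpace.inner_toLp_toLp, dotProduct, Fintype.sum_prod_type, Finset.sum_comm, trace]
  refine Finset.sum_congr rfl fun i _ => ?_
  rw [diag_apply, mul_apply]
  refine Finset.sum_congr rfl fun j _ => ?_
  simp [mul_comm]

theorem hsNorm_sq_col (A : Matrix n n ℂ) :
    hsNorm A ^ 2 = ∑ j, vecNorm (A *ᵥ Pi.single j 1) ^ 2 := by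
  rw [hsNorm_sq, Finset.sum_comm]
  refine Finset.sum_congr rfl fun j _ => ?_
  rw [vecNorm_sq, mulVec_single_one]
  rfl

theorem hsNorm_mul_le_left (A B : Matrix n n ℂ) : hsNorm (A * B) ≤ ‖A‖ * hsNorm B := by
  refine abs_le_of_sq_le_sq' ?_ (mul_nonneg (norm_nonneg _) (hsNorm_nonneg _)) |>.2
  rw [mul_pow, hsNorm_sq_col, hsNorm_sq_col, Finset.mul_sum]
  refine Finset.sum_le_sum fun j _ => ?_
  rw [← mulVec_mulVec, ← mul_pow]
  exact pow_le_pow_left₀ (vecNorm_nonneg _) (vecNorm_mulVec_le _ _) 2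

theorem hsNorm_conjTranspose (A : Matrix n n ℂ) : hsNorm Aᴴ = hsNorm A := by
  rw [← sq_eq_sq₀ (hsNorm_nonneg _) (hsNorm_nonneg _), hsNorm_sq, hsNorm_sq, Finset.sum_comm]
  simp

theorem hsNorm_mul_le_right (A B : Matrix n n ℂ) : hsNorm (A * B) ≤ hsNorm A * ‖B‖ := by
  rw [← hsNorm_conjTranspose, conjTranspose_mul, mul_comm, ← hsNorm_conjTranspose A,
    ← Matrix.l2_opNorm_conjTranspose B]
  exact hsNorm_mul_le_left _ _

theorem hsNorm_one_sq : hsNorm (1 : Matrix n n ℂ) ^ 2 = Fintype.card n := by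
  simp only [hsNorm_sq_col, one_mulVec, vecNorm_single]
  simp

theorem hsNorm_sq_le_opNorm (A : Matrix n n ℂ) : hsNorm A ^ 2 ≤ Fintype.card n * ‖A‖ ^ 2 := by
  rw [← hsNorm_one_sq, ← mul_pow]
  refine pow_le_pow_left₀ (hsNorm_nonneg _) ?_ 2
  simpa [mul_comm] using hsNorm_mul_le_right (1 : Matrix n n ℂ) A

theorem norm_trace_mul_le (A B : Matrix n n ℂ) : ‖(Aᴴ * B).trace‖ ≤ hsNorm A * hsNorm B := by
  rw [← inner_hsVec]
  exact norm_inner_le_norm _ _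

theorem norm_trace_le (A : Matrix n n ℂ) : ‖A.trace‖ ≤ Fintype.card n * ‖A‖ := by
  refine (norm_sum_le _ _).trans ?_
  refine (Finset.sum_le_card_nsmul _ _ ‖A‖ fun i _ => norm_entry_le_opNorm A i i).trans ?_
  simp

end MatrixForms

/-! ### Imaginary parts, two-positive maps and growth of their powers. -/

section Positivity
set_option linter.unusedSectionVars false
open Matrix
open scoped Matrix.Norms.L2Operator
variable {n : Type*} [Fintype n] [DecidableEq n]

/-- The imaginary part `(A - A*)/(2i)`. -/
noncomputable def imPart (A : Matrix n n ℂ) : Matrix n n ℂ :=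
  (1 / (2 * Complex.I)) • (A - Aᴴ)

theorem qf_imPart (A : Matrix n n ℂ) (x : n → ℂ) :
    qf (imPart A) x x = (((qf A x x).im : ℝ) : ℂ) := by
  rw [imPart, qf_smul, qf_sub, qf_conjTranspose, Complex.im_eq_sub_conj, RCLike.star_def]
  ring

theorem imPart_isHermitian (A : Matrix n n ℂ) : (imPart A).IsHermitian := by
  rw [Matrix.IsHermitian, imPart, conjTranspose_smul, conjTranspose_sub,
    conjTranspose_conjTranspose]
  have : star (1 / (2 * Complex.I)) = -(1 / (2 * Complex.I)) := by
    simp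
  rw [this, neg_smul, ← smul_neg, neg_sub]

theorem imPart_conj (K A : Matrix n n ℂ) : imPart (K * A * Kᴴ) = K * imPart A * Kᴴ := by
  rw [imPart, imPart, Matrix.mul_smul, Matrix.smul_mul, mul_sub, sub_mul]
  simp [conjTranspose_mul, mul_assoc]

theorem imPart_diagonal (u : n → ℂ) :
    imPart (diagonal u) = diagonal fun i => (((u i).im : ℝ) : ℂ) := by
  rw [imPart, diagonal_conjTranspose, diagonal_sub, ← diagonal_smul]
  congr 1
  funext i
  rw [Complex.im_eq_sub_conj]
  simp only [Pi.smul_apply, Pi.star_apply, RCLike.star_def, smul_eq_mul]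
  ring

theorem norm_imPart_le (A : Matrix n n ℂ) : ‖imPart A‖ ≤ ‖A‖ := by
  rw [imPart, norm_smul]
  have h1 : ‖A - Aᴴ‖ ≤ ‖A‖ + ‖A‖ := by
    simpa [Matrix.l2_opNorm_conjTranspose] using norm_sub_le A Aᴴ
  have h2 : ‖(1 / (2 * Complex.I) : ℂ)‖ = 1 / 2 := by simp
  rw [h2]
  linarith

theorem trace_imPart (A : Matrix n n ℂ) : (imPart A).trace = ((A.trace.im : ℝ) : ℂ) := by
  rw [imPart, trace_smul, trace_sub, trace_conjTranspose, Complex.im_eq_sub_conj,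
    RCLike.star_def, smul_eq_mul]
  ring

/-- `[[A, Δ], [Δ*, B]]` is positive in the sense of quadratic forms. -/
def Dominated (Δ A B : Matrix n n ℂ) : Prop :=
  ∀ x y, 2 * ‖qf Δ x y‖ ≤ (qf A x x).re + (qf B y y).re

/-- A linear map on matrices which preserves the positivity of `2 × 2` block matrices. -/
def IsTwoPositive (Φ : Matrix n n ℂ →ₗ[ℂ] Matrix n n ℂ) : Prop :=
  ∀ Δ A B, Dominated Δ A B → Dominated (Φ Δ) (Φ A) (Φ B)

/-- A linear map on matrices which is symmetric for the Hilbert–Schmidt inner product. -/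
def IsHSSymmetric (Φ : Matrix n n ℂ →ₗ[ℂ] Matrix n n ℂ) : Prop :=
  ∀ X Y, ((Φ X)ᴴ * Y).trace = (Xᴴ * Φ Y).trace

/-- `Y ↦ K Y K*`. -/
def congrMap (K : Matrix n n ℂ) : Matrix n n ℂ →ₗ[ℂ] Matrix n n ℂ where
  toFun Y := K * Y * Kᴴ
  map_add' Y Z := by rw [mul_add, add_mul]
  map_smul' c Y := by simp

theorem congrMap_apply (K Y : Matrix n n ℂ) : congrMap K Y = K * Y * Kᴴ := rfl

/-- A congruence acts on the `2 × 2` block matrix as congruence by `diag(K, K)`. Sums of such maps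
(Kraus forms) are the source of all two-positivity below. -/
theorem IsTwoPositive.congrMap (K : Matrix n n ℂ) : IsTwoPositive (congrMap K) := by
  intro Δ A B h x y
  have key : ∀ A u v, qf (CorrelatedMatrix.congrMap K A) u v = qf A (Kᴴ *ᵥ u) (Kᴴ *ᵥ v) :=
    fun A u v => by
      rw [congrMap_apply, ← qf_conj_mul, conjTranspose_conjTranspose]
  rw [key, key, key]
  exact h _ _

theorem IsTwoPositive.add {Φ Ψ : Matrix n n ℂ →ₗ[ℂ] Matrix n n ℂ} (h : IsTwoPositive Φ)
    (h' : IsTwoPositive Ψ) : IsTwoPositive (Φ + Ψ) := by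
  intro Δ A B hd x y
  have h1 := h Δ A B hd x y
  have h2 := h' Δ A B hd x y
  simp only [LinearMap.add_apply, qf_add, Complex.add_re]
  linarith [norm_add_le (qf (Φ Δ) x y) (qf (Ψ Δ) x y)]

theorem IsTwoPositive.sum {ι : Type*} (s : Finset ι) {Φ : ι → Matrix n n ℂ →ₗ[ℂ] Matrix n n ℂ}
    (h : ∀ a, IsTwoPositive (Φ a)) : IsTwoPositive (∑ a ∈ s, Φ a) := by
  classical
  induction s using Finset.induction_on with
  | empty => intro Δ A B _ x y; simp [qf]
  | insert a s ha ih => rw [Finset.sum_insert ha]; exact (h a).add ih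

theorem IsTwoPositive.smul {Φ : Matrix n n ℂ →ₗ[ℂ] Matrix n n ℂ} (h : IsTwoPositive Φ)
    {c : ℝ} (hc : 0 ≤ c) : IsTwoPositive ((c : ℂ) • Φ) := by
  intro Δ A B hd x y
  have h1 := h Δ A B hd x y
  simp only [LinearMap.smul_apply, qf_smul, Complex.re_ofReal_mul, norm_mul, Complex.norm_real,
    Real.norm_eq_abs, abs_of_nonneg hc]
  nlinarith

theorem IsTwoPositive.comp {Φ Ψ : Matrix n n ℂ →ₗ[ℂ] Matrix n n ℂ} (h : IsTwoPositive Φ)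
    (h' : IsTwoPositive Ψ) : IsTwoPositive (Φ ∘ₗ Ψ) :=
  fun Δ A B hd => h _ _ _ (h' Δ A B hd)

/-- By cyclicity of the trace, the Hilbert–Schmidt adjoint of congruence by `Q` is congruence by
`Qᴴ`. -/
theorem trace_conjTranspose_mul_congrMap (Q X Z : Matrix n n ℂ) :
    (Xᴴ * congrMap Qᴴ Z).trace = ((congrMap Q X)ᴴ * Z).trace := by
  simp only [congrMap_apply, conjTranspose_mul, conjTranspose_conjTranspose]
  rw [mul_assoc Q, mul_assoc, trace_mul_comm Q]
  simp only [mul_assoc]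

theorem IsHSSymmetric.congr {Φ : Matrix n n ℂ →ₗ[ℂ] Matrix n n ℂ} (h : IsHSSymmetric Φ)
    (Q : Matrix n n ℂ) : IsHSSymmetric (congrMap Qᴴ ∘ₗ Φ ∘ₗ congrMap Q) := by
  intro X Y
  have h1 := trace_conjTranspose_mul_congrMap Qᴴ (Φ (congrMap Q X)) Y
  rw [conjTranspose_conjTranspose] at h1
  rw [LinearMap.comp_apply, LinearMap.comp_apply, LinearMap.comp_apply, LinearMap.comp_apply,
    ← h1, h, trace_conjTranspose_mul_congrMap]

/-- Powers of a two-positive map `Φ` with `Φ(s) ≤ r s`, for a positive diagonal `s`. -/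
theorem IsTwoPositive.hsNorm_pow_le {Φ : Matrix n n ℂ →ₗ[ℂ] Matrix n n ℂ} (h : IsTwoPositive Φ)
    {s : n → ℝ} {σ r : ℝ} (hr : 0 ≤ r) (hσ : 0 < σ) (hs : ∀ i, σ ≤ s i)
    (hΦ : ∀ x, (qf (Φ (diagonal fun i => (s i : ℂ))) x x).re
      ≤ r * (qf (diagonal fun i => (s i : ℂ)) x x).re) (Y : Matrix n n ℂ) :
    ∃ C, ∀ k : ℕ, hsNorm ((Φ ^ k) Y) ≤ C * r ^ k := by
  set S : Matrix n n ℂ := diagonal fun i => (s i : ℂ) with hS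
  have hSx : ∀ x, σ * vecNorm x ^ 2 ≤ (qf S x x).re := by
    intro x
    rw [hS, qf_diagonal, vecNorm_sq, Finset.mul_sum, Complex.re_sum]
    refine Finset.sum_le_sum fun i _ => ?_
    rw [← Complex.ofReal_mul, Complex.ofReal_re]
    exact mul_le_mul_of_nonneg_right (hs i) (by positivity)
  set κ := ‖Y‖ / σ with hκ
  have hκ0 : 0 ≤ κ := by positivity
  -- The diagonal blocks control the off-diagonal one, and two-positivity carries this through `Φ`;
  -- each application costs a factor `r` because `Φ S ≤ r S`.
  have dom : ∀ k : ℕ, Dominated ((Φ ^ k) Y) (((κ * r ^ k : ℝ) : ℂ) • S)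
      (((κ * r ^ k : ℝ) : ℂ) • S) := by
    intro k
    induction k with
    | zero =>
      intro x y
      have h1 := norm_qf_le Y x y
      have h2 : vecNorm x * vecNorm y ≤ (vecNorm x ^ 2 + vecNorm y ^ 2) / 2 := by
        nlinarith [sq_nonneg (vecNorm x - vecNorm y)]
      simp only [pow_zero, Module.End.one_apply, mul_one, qf_smul, Complex.re_ofReal_mul]
      have h3 : ∀ x, ‖Y‖ * vecNorm x ^ 2 ≤ κ * (qf S x x).re := by
        intro x
        calc ‖Y‖ * vecNorm x ^ 2 = κ * (σ * vecNorm x ^ 2) := by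
              rw [hκ]; field_simp
          _ ≤ _ := mul_le_mul_of_nonneg_left (hSx x) hκ0
      have h4 := mul_le_mul_of_nonneg_left h2 (norm_nonneg Y)
      linarith [h3 x, h3 y]
    | succ k ih =>
      intro x y
      have h1 := h _ _ _ ih x y
      rw [pow_succ', Module.End.mul_apply]
      refine h1.trans ?_
      have h2 : ∀ x, (qf (Φ (((κ * r ^ k : ℝ) : ℂ) • S)) x x).re
          ≤ (qf (((κ * r ^ (k + 1) : ℝ) : ℂ) • S) x x).re := by
        intro x
        rw [map_smul, qf_smul, qf_smul, Complex.re_ofReal_mul, Complex.re_ofReal_mul, pow_succ]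
        have := mul_le_mul_of_nonneg_left (hΦ x) (by positivity : 0 ≤ κ * r ^ k)
        linarith
      exact add_le_add (h2 x) (h2 y)
  -- Testing the domination on basis vectors bounds the entry `(i, j)` by `κ r ^ k (s i + s j) / 2`.
  -- The constant depends on the dimension, but only the exponential rate is used later.
  refine ⟨√(∑ i, ∑ j, ((κ * (s i + s j)) / 2) ^ 2), fun k => ?_⟩
  refine abs_le_of_sq_le_sq' ?_ (by positivity) |>.2
  rw [mul_pow, Real.sq_sqrt (by positivity), hsNorm_sq, Finset.sum_mul]
  refine Finset.sum_le_sum fun i _ => ?_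
  rw [Finset.sum_mul]
  refine Finset.sum_le_sum fun j _ => ?_
  rw [← mul_pow]
  refine pow_le_pow_left₀ (norm_nonneg _) ?_ 2
  have h1 := dom k (Pi.single i 1) (Pi.single j 1)
  rw [qf_smul, qf_smul, Complex.re_ofReal_mul, Complex.re_ofReal_mul, qf_single, qf_single,
    qf_single, hS, diagonal_apply_eq, diagonal_apply_eq, Complex.ofReal_re,
    Complex.ofReal_re] at h1
  linarith

end Positivity

/-! ### Stability in balanced coordinates. -/

section Balanced
set_option linter.unusedSectionVars false
open Matrix
open scoped Matrix.Norms.L2Operator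
variable {n : Type*} [Fintype n] [DecidableEq n]

theorem hsVec_conj_pow (Φ : Matrix n n ℂ →ₗ[ℂ] Matrix n n ℂ) (k : ℕ) (Y : Matrix n n ℂ) :
    ((hsVec.conj Φ) ^ k) (hsVec Y) = hsVec ((Φ ^ k) Y) := by
  induction k with
  | zero => rfl
  | succ k ih =>
    rw [pow_succ', pow_succ', Module.End.mul_apply, Module.End.mul_apply, ih,
      LinearEquiv.conj_apply_apply, LinearEquiv.symm_apply_apply]

theorem IsHSSymmetric.isSymmetric {Φ : Matrix n n ℂ →ₗ[ℂ] Matrix n n ℂ} (h : IsHSSymmetric Φ) :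
    (hsVec.conj Φ).IsSymmetric := by
  intro x y
  obtain ⟨X, rfl⟩ := hsVec.surjective x
  obtain ⟨Y, rfl⟩ := hsVec.surjective y
  rw [LinearEquiv.conj_apply_apply, LinearEquiv.conj_apply_apply, LinearEquiv.symm_apply_apply,
    LinearEquiv.symm_apply_apply, inner_hsVec, inner_hsVec, h]

/-- A symmetric two-positive map `Φ` with `Φ(s) ≤ r s` has Hilbert–Schmidt norm at most `r`. -/
theorem IsTwoPositive.hsNorm_apply_le {Φ : Matrix n n ℂ →ₗ[ℂ] Matrix n n ℂ}
    (h : IsTwoPositive Φ) (hsym : IsHSSymmetric Φ)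
    {s : n → ℝ} {σ r : ℝ} (hr : 0 ≤ r) (hσ : 0 < σ) (hs : ∀ i, σ ≤ s i)
    (hΦ : ∀ x, (qf (Φ (diagonal fun i => (s i : ℂ))) x x).re
      ≤ r * (qf (diagonal fun i => (s i : ℂ)) x x).re) (Y : Matrix n n ℂ) :
    hsNorm (Φ Y) ≤ r * hsNorm Y := by
  obtain ⟨C, hC⟩ := h.hsNorm_pow_le hr hσ hs hΦ Y
  have := norm_apply_le_of_isSymmetric_of_pow (hsVec.conj Φ) hsym.isSymmetric hr (hsVec Y)
    (C := C) (fun k => by rw [hsVec_conj_pow]; exact hC k)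
  rwa [LinearEquiv.conj_apply_apply, LinearEquiv.symm_apply_apply] at this

/-- `Y ↦ K Y K`. -/
def sandwichMap (K : Matrix n n ℂ) : Matrix n n ℂ →ₗ[ℂ] Matrix n n ℂ where
  toFun Y := K * Y * K
  map_add' Y Z := by rw [mul_add, add_mul]
  map_smul' c Y := by simp

theorem sandwichMap_diagonal (u : n → ℂ) (Y : Matrix n n ℂ) (i j : n) :
    sandwichMap (diagonal u) Y i j = u i * u j * Y i j := by
  change (diagonal u * Y * diagonal u) i j = _
  rw [mul_diagonal, diagonal_mul]
  ring

theorem hsNorm_sandwich_diagonal {u : n → ℂ} (hu : ∀ i, ‖u i‖ = 1) (Y : Matrix n n ℂ) :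
    hsNorm (sandwichMap (diagonal u) Y) = hsNorm Y := by
  rw [← sq_eq_sq₀ (hsNorm_nonneg _) (hsNorm_nonneg _), hsNorm_sq, hsNorm_sq]
  simp [sandwichMap_diagonal, hu]

/-- For unimodular `a, b` one has `Re (a b) = 1 - |a - b̄|² / 2`, and `a - b̄` has imaginary part at
least `2 σ`. -/
theorem re_mul_le_of_im_ge {a b : ℂ} (ha : ‖a‖ = 1) (hb : ‖b‖ = 1) {σ : ℝ} (hσ : 0 < σ)
    (ha' : σ ≤ a.im) (hb' : σ ≤ b.im) : (a * b).re ≤ 1 - 2 * σ ^ 2 := by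
  have h1 : a.re ^ 2 + a.im ^ 2 = 1 := by
    have := Complex.sq_norm a
    rw [ha, Complex.normSq_apply] at this
    nlinarith
  have h2 : b.re ^ 2 + b.im ^ 2 = 1 := by
    have := Complex.sq_norm b
    rw [hb, Complex.normSq_apply] at this
    nlinarith
  rw [Complex.mul_re]
  nlinarith [sq_nonneg (a.re - b.re), mul_self_le_mul_self (by linarith : 0 ≤ 2 * σ)
    (by linarith : 2 * σ ≤ a.im + b.im)]

/-- Reduction to `norm_le_of_rotation`. Congruence by `Q` turns `Φ` and `Φ'` into symmetric
two-positive maps `F` and `F'`, for which the positive diagonal matrix `Im u` plays the role of a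
Perron–Frobenius vector; it yields the norms `1 + ε` and `1 - δ`. The isometry `V` is entrywise
multiplication by `u i * u j`, inverted by the conjugates. -/
theorem hsNorm_le_of_balanced {Φ Φ' : Matrix n n ℂ →ₗ[ℂ] Matrix n n ℂ}
    (hsym : IsHSSymmetric Φ) (hsym' : IsHSSymmetric Φ') (hpos : IsTwoPositive Φ)
    (hpos' : IsTwoPositive Φ')
    (hle : ∀ Y, (Yᴴ * Φ' Y).trace.re ≤ (Yᴴ * Φ Y).trace.re)
    {ε δ σ : ℝ} (hε : 0 ≤ ε) (hδ : 0 < δ) (hδ1 : δ ≤ 1) (hσ : 0 < σ)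
    (hσ1 : σ ≤ 1) (hεδ : 2 * ε ≤ δ * σ ^ 2) {u : n → ℂ} (hu : ∀ i, ‖u i‖ = 1)
    (huσ : ∀ i, σ ≤ (u i).im) (Q : Matrix n n ℂ)
    (hΦ : ∀ x, (qf (Qᴴ * Φ (Q * imPart (diagonal u) * Qᴴ) * Q) x x).re
      ≤ (1 + ε) * (qf (imPart (diagonal u)) x x).re)
    (hΦ' : ∀ x, (qf (Qᴴ * Φ' (Q * imPart (diagonal u) * Qᴴ) * Q) x x).re
      ≤ (1 - δ) * (qf (imPart (diagonal u)) x x).re) (Y : Matrix n n ℂ) :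
    δ * σ ^ 2 * hsNorm Y
      ≤ 4 * hsNorm (Y - diagonal u * (Qᴴ * Φ (Q * Y * Qᴴ) * Q) * diagonal u) := by
  set F := congrMap Qᴴ ∘ₗ Φ ∘ₗ congrMap Q with hF
  set F' := congrMap Qᴴ ∘ₗ Φ' ∘ₗ congrMap Q with hF'
  have app : ∀ Z, F Z = Qᴴ * Φ (Q * Z * Qᴴ) * Q := fun Z => by
    rw [hF, LinearMap.comp_apply, LinearMap.comp_apply, congrMap_apply, congrMap_apply,
      conjTranspose_conjTranspose]
  have app' : ∀ Z, F' Z = Qᴴ * Φ' (Q * Z * Qᴴ) * Q := fun Z => by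
    rw [hF', LinearMap.comp_apply, LinearMap.comp_apply, congrMap_apply, congrMap_apply,
      conjTranspose_conjTranspose]
  have conjapp : ∀ (G : Matrix n n ℂ →ₗ[ℂ] Matrix n n ℂ) (Z : Matrix n n ℂ),
      hsVec.conj G (hsVec Z) = hsVec (G Z) := fun G Z => by
    rw [LinearEquiv.conj_apply_apply, LinearEquiv.symm_apply_apply]
  have hFpos : IsTwoPositive F := (IsTwoPositive.congrMap _).comp (hpos.comp (.congrMap _))
  have hFpos' : IsTwoPositive F' := (IsTwoPositive.congrMap _).comp (hpos'.comp (.congrMap _))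
  have hFn : ∀ Z, hsNorm (F Z) ≤ (1 + ε) * hsNorm Z := by
    refine hFpos.hsNorm_apply_le (hsym.congr Q) (by linarith) hσ huσ fun x => ?_
    rw [← imPart_diagonal, app]
    exact hΦ x
  have hFn' : ∀ Z, hsNorm (F' Z) ≤ (1 - δ) * hsNorm Z := by
    refine hFpos'.hsNorm_apply_le (hsym'.congr Q) (by linarith) hσ huσ fun x => ?_
    rw [← imPart_diagonal, app']
    exact hΦ' x
  have huu : ∀ i, star (u i) * u i = 1 := fun i => by
    rw [RCLike.star_def, RCLike.conj_mul, hu]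
    simp
  have main := norm_le_of_rotation (hsVec.conj F) (hsVec.conj F')
    (hsVec.conj (sandwichMap (diagonal u))) (hsVec.conj (sandwichMap (diagonal (star u))))
    (hsym.congr Q).isSymmetric hε hδ hδ1 hσ hσ1 hεδ ?_ ?_ ?_ ?_ ?_ ?_ ?_ (hsVec Y)
  · rw [conjapp, conjapp, ← map_sub, app] at main
    exact main
  · intro y
    obtain ⟨Y, rfl⟩ := hsVec.surjective y
    rw [conjapp]
    exact hFn Y
  · intro y
    obtain ⟨Y, rfl⟩ := hsVec.surjective y
    rw [conjapp]
    exact hFn' Y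
  · intro y
    obtain ⟨Y, rfl⟩ := hsVec.surjective y
    rw [conjapp, conjapp, inner_hsVec, inner_hsVec, hF, hF', LinearMap.comp_apply,
      LinearMap.comp_apply, LinearMap.comp_apply, LinearMap.comp_apply,
      trace_conjTranspose_mul_congrMap, trace_conjTranspose_mul_congrMap]
    exact hle _
  · intro y
    obtain ⟨Y, rfl⟩ := hsVec.surjective y
    rw [conjapp, conjapp]
    congr 1
    ext i j
    rw [sandwichMap_diagonal, sandwichMap_diagonal, Pi.star_apply, Pi.star_apply]
    linear_combination (Y i j * (star (u j) * u j)) * huu i + Y i j * huu j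
  · intro y
    obtain ⟨Y, rfl⟩ := hsVec.surjective y
    rw [conjapp]
    exact hsNorm_sandwich_diagonal hu Y
  · intro y
    obtain ⟨Y, rfl⟩ := hsVec.surjective y
    rw [conjapp]
    exact hsNorm_sandwich_diagonal (fun i => by simpa using hu i) Y
  · intro y
    obtain ⟨Y, rfl⟩ := hsVec.surjective y
    rw [conjapp]
    change _ ≤ _ * hsNorm Y ^ 2
    rw [hsNorm_sq, PiLp.inner_apply, Fintype.sum_prod_type, Complex.re_sum, Finset.mul_sum]
    refine Finset.sum_le_sum fun i _ => ?_
    rw [Complex.re_sum, Finset.mul_sum]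
    refine Finset.sum_le_sum fun j _ => ?_
    have e1 : inner ℂ ((hsVec Y) (i, j)) ((hsVec (sandwichMap (diagonal (star u)) Y)) (i, j))
        = star (u i * u j) * ((‖Y i j‖ ^ 2 : ℝ) : ℂ) := by
      change inner ℂ (Y i j) (sandwichMap (diagonal (star u)) Y i j) = _
      rw [sandwichMap_diagonal, RCLike.inner_apply, mul_assoc, RCLike.mul_conj, Pi.star_apply,
        Pi.star_apply, star_mul']
      push_cast
      rfl
    rw [e1, mul_comm, Complex.re_ofReal_mul, mul_comm, RCLike.star_def, Complex.conj_re]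
    exact mul_le_mul_of_nonneg_right
      (re_mul_le_of_im_ge (hu i) (hu j) hσ (huσ i) (huσ j)) (by positivity)

end Balanced

/-! ### Balanced factorization of matrices with positive imaginary part. -/

section Factorization
set_option linter.unusedSectionVars false
open Matrix
variable {n : Type*} [Fintype n] [DecidableEq n]

open scoped MatrixOrder ComplexOrder in
theorem exists_eq_conjTranspose_mul_self {𝕜 : Type*} [RCLike 𝕜] {A : Matrix n n 𝕜}
    (hA : A.PosSemidef) : ∃ B : Matrix n n 𝕜, A = Bᴴ * B :=
  CStarAlgebra.nonneg_iff_eq_star_mul_self.1 (Matrix.nonneg_iff_posSemidef.2 hA)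

open scoped Matrix.Norms.L2Operator

open scoped ComplexOrder in
theorem posDef_imPart_of_le {G : Matrix n n ℂ} {a : ℝ} (ha : 0 < a)
    (h : ∀ x, a * vecNorm x ^ 2 ≤ (qf G x x).im) : (imPart G).PosDef := by
  refine Matrix.PosDef.of_dotProduct_mulVec_pos (imPart_isHermitian G) fun {x} hx => ?_
  change 0 < qf (imPart G) x x
  rw [qf_imPart, Complex.zero_lt_real]
  refine lt_of_lt_of_le ?_ (h x)
  have : 0 < vecNorm x := (vecNorm_nonneg x).lt_of_ne (by rwa [ne_comm, Ne, vecNorm_eq_zero])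
  positivity

theorem opNorm_le_inv_of_le {A B : Matrix n n ℂ} {a : ℝ} (ha : 0 < a) (hAB : A * B = 1)
    (h : ∀ x, a * vecNorm x ≤ vecNorm (A *ᵥ x)) : ‖B‖ ≤ 1 / a := by
  refine opNorm_le_of_vecNorm (by positivity) fun x => ?_
  have := h (B *ᵥ x)
  rw [mulVec_mulVec, hAB, one_mulVec] at this
  rw [div_mul_eq_mul_div, one_mul, le_div_iff₀ ha]
  linarith

open scoped ComplexOrder in
/-- Simultaneous diagonalization of real and imaginary part by congruence. -/
theorem exists_congr_diagonal {G : Matrix n n ℂ} {a : ℝ} (ha : 0 < a)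
    (h : ∀ x, a * vecNorm x ^ 2 ≤ (qf G x x).im) :
    ∃ (P P' : Matrix n n ℂ) (d : n → ℂ), (∀ i, (d i).im = 1) ∧ P * P' = 1 ∧ P' * P = 1 ∧
      G = P * diagonal d * Pᴴ := by
  have hpd := posDef_imPart_of_le ha h
  obtain ⟨B, hB⟩ := exists_eq_conjTranspose_mul_self hpd.posSemidef
  have hBu : IsUnit B := by
    have := hpd.isUnit
    rw [hB] at this
    exact (isUnit_iff_isUnit_det _).2 (by
      rw [isUnit_iff_isUnit_det, det_mul] at this
      exact isUnit_of_mul_isUnit_right this)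
  obtain ⟨C, hBC, hCB⟩ := isUnit_iff_exists.1 hBu
  -- With `imPart G = Bᴴ * B` and `C` inverse to `B`, one has `G = Bᴴ (H + i) B`. The matrix `H` is
  -- Hermitian, so diagonalizing it by a unitary keeps the imaginary part equal to `1`.
  set H : Matrix n n ℂ := Cᴴ * (G - Complex.I • imPart G) * C with hH
  have hG' : G - Complex.I • imPart G = (1 / 2 : ℂ) • (G + Gᴴ) := by
    rw [imPart, smul_smul]
    have : Complex.I * (1 / (2 * Complex.I)) = 1 / 2 := by
      field_simp
    rw [this]
    module
  have hHh : H.IsHermitian := by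
    rw [hH, hG']
    have : ((1 / 2 : ℂ) • (G + Gᴴ)).IsHermitian := by
      rw [Matrix.IsHermitian, conjTranspose_smul, conjTranspose_add, conjTranspose_conjTranspose,
        add_comm]
      simp
    exact isHermitian_conjTranspose_mul_mul C this
  set O : Matrix n n ℂ := hHh.eigenvectorUnitary.1 with hO
  have hOO : O * Oᴴ = 1 := Unitary.coe_mul_star_self _
  have hOO' : Oᴴ * O = 1 := Unitary.coe_star_mul_self _
  set e : n → ℂ := fun i => (hHh.eigenvalues i : ℂ) with he
  have hspec : H = O * diagonal e * Oᴴ := by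
    conv_lhs => rw [hHh.spectral_theorem]
    rfl
  have hBCh : Bᴴ * Cᴴ = 1 := by rw [← conjTranspose_mul, hCB, conjTranspose_one]
  have hCBh : Cᴴ * Bᴴ = 1 := by rw [← conjTranspose_mul, hBC, conjTranspose_one]
  refine ⟨Bᴴ * O, Oᴴ * Cᴴ, fun i => e i + Complex.I, fun i => by simp [he], ?_, ?_, ?_⟩
  · rw [mul_assoc, ← mul_assoc O, hOO, one_mul, hBCh]
  · rw [mul_assoc, ← mul_assoc Cᴴ, hCBh, one_mul, hOO']
  · have h1 : diagonal (fun i => e i + Complex.I) = diagonal e + Complex.I • (1 : Matrix n n ℂ) := by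
      rw [smul_one_eq_diagonal, diagonal_add]
    have h2 : Bᴴ * H * B = G - Complex.I • imPart G := by
      rw [hH]
      calc Bᴴ * (Cᴴ * (G - Complex.I • imPart G) * C) * B
          = (Bᴴ * Cᴴ) * (G - Complex.I • imPart G) * (C * B) := by simp only [mul_assoc]
        _ = _ := by rw [hBCh, hCB, one_mul, mul_one]
    have h3 : Bᴴ * O * diagonal (fun i => e i + Complex.I) * (Bᴴ * O)ᴴ
        = Bᴴ * (O * diagonal e * Oᴴ) * B + Complex.I • (Bᴴ * (O * Oᴴ) * B) := by
      rw [h1, conjTranspose_mul, conjTranspose_conjTranspose]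
      simp only [mul_add, add_mul, Matrix.mul_smul, Matrix.smul_mul, mul_one, mul_assoc]
    rw [h3, ← hspec, hOO, mul_one, ← hB, h2, sub_add_cancel]

/-- Start from `G = P diag(d) Pᴴ` with `Im d = 1`, and move the square root of `‖d i‖` into `P`, so
that `u i = d i / ‖d i‖`. Here `P Pᴴ = Im G`, so `P` and its inverse are controlled by `g` and `a`;
hence `1 ≤ ‖d i‖ ≤ g / a`, and `Im (u i) = 1 / ‖d i‖`. -/
theorem exists_balanced_factorization {G : Matrix n n ℂ} {a g : ℝ} (ha : 0 < a)
    (h : ∀ x, a * vecNorm x ^ 2 ≤ (qf G x x).im) (hg : ‖G‖ ≤ g) :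
    ∃ (Q Q' : Matrix n n ℂ) (u : n → ℂ), Q * Q' = 1 ∧ Q' * Q = 1 ∧
      G = Q * diagonal u * Qᴴ ∧ (∀ i, ‖u i‖ = 1) ∧ (∀ i, a / g ≤ (u i).im) ∧
      ‖Q‖ ^ 2 ≤ g ^ 2 / a ∧ ‖Q'‖ ^ 2 ≤ 1 / a := by
  obtain ⟨P, P', d, hd, hPP', hP'P, hGP⟩ := exists_congr_diagonal ha h
  have hg0 : 0 ≤ g := (norm_nonneg _).trans hg
  have hPP : P * Pᴴ = imPart G := by
    have h1 : diagonal (fun i => (((d i).im : ℝ) : ℂ)) = (1 : Matrix n n ℂ) := by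
      rw [← diagonal_one]
      congr 1
      funext i
      simp [hd]
    rw [hGP, imPart_conj, imPart_diagonal, h1, mul_one]
  have hPn : ‖P‖ ^ 2 ≤ g := by
    have h1 := Matrix.l2_opNorm_conjTranspose_mul_self Pᴴ
    rw [conjTranspose_conjTranspose, hPP, Matrix.l2_opNorm_conjTranspose] at h1
    rw [sq, ← h1]
    exact (norm_imPart_le G).trans hg
  have hP'n : ‖P'‖ ^ 2 ≤ 1 / a := by
    have h0 : Pᴴ * P'ᴴ = 1 := by rw [← conjTranspose_mul, hP'P, conjTranspose_one]
    have h1 : ‖P'ᴴ‖ ≤ 1 / √a := by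
      refine opNorm_le_inv_of_le (Real.sqrt_pos.2 ha) h0 fun x => ?_
      refine abs_le_of_sq_le_sq' ?_ (vecNorm_nonneg _) |>.2
      rw [mul_pow, Real.sq_sqrt ha.le]
      refine (h x).trans (le_of_eq ?_)
      have h2 : qf (imPart G) x x = ((vecNorm (Pᴴ *ᵥ x) ^ 2 : ℝ) : ℂ) := by
        rw [← hPP, ← qf_one, ← qf_conj_mul, conjTranspose_conjTranspose, mul_one]
      rw [qf_imPart] at h2
      exact_mod_cast h2
    rw [Matrix.l2_opNorm_conjTranspose] at h1
    calc ‖P'‖ ^ 2 ≤ (1 / √a) ^ 2 := pow_le_pow_left₀ (norm_nonneg _) h1 2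
      _ = 1 / a := by rw [div_pow, one_pow, Real.sq_sqrt ha.le]
  have hdn : ∀ i, ‖d i‖ ≤ g / a := by
    intro i
    have h1 : diagonal d = P' * G * P'ᴴ := by
      have h0 : Pᴴ * P'ᴴ = 1 := by rw [← conjTranspose_mul, hP'P, conjTranspose_one]
      calc diagonal d = (P' * P) * diagonal d * (Pᴴ * P'ᴴ) := by rw [hP'P, h0, one_mul, mul_one]
        _ = P' * (P * diagonal d * Pᴴ) * P'ᴴ := by simp only [mul_assoc]
        _ = _ := by rw [← hGP]
    have h2 := norm_entry_le_opNorm (diagonal d) i i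
    rw [diagonal_apply_eq] at h2
    refine h2.trans ?_
    rw [h1]
    calc ‖P' * G * P'ᴴ‖ ≤ ‖P'‖ * ‖G‖ * ‖P'ᴴ‖ :=
          (norm_mul_le _ _).trans (mul_le_mul_of_nonneg_right (norm_mul_le _ _) (norm_nonneg _))
      _ = ‖P'‖ ^ 2 * ‖G‖ := by rw [Matrix.l2_opNorm_conjTranspose]; ring
      _ ≤ 1 / a * g := by gcongr
      _ = g / a := by ring
  have hd1 : ∀ i, 1 ≤ ‖d i‖ := fun i => by
    have := Complex.abs_im_le_norm (d i)
    rwa [hd, abs_one] at this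
  have hd0 : ∀ i, 0 < ‖d i‖ := fun i => lt_of_lt_of_le one_pos (hd1 i)
  set w : n → ℝ := fun i => √‖d i‖ with hw
  have hw0 : ∀ i, 0 < w i := fun i => Real.sqrt_pos.2 (hd0 i)
  have hww : ∀ i, w i * w i = ‖d i‖ := fun i => Real.mul_self_sqrt (norm_nonneg _)
  have hwC : ∀ i, (w i : ℂ) ≠ 0 := fun i => by exact_mod_cast (hw0 i).ne'
  have hdC : ∀ i, (‖d i‖ : ℂ) ≠ 0 := fun i => by exact_mod_cast (hd0 i).ne'
  refine ⟨P * diagonal (fun i => (w i : ℂ)), diagonal (fun i => (w i : ℂ)⁻¹) * P',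
    fun i => d i / ‖d i‖, ?_, ?_, ?_, ?_, ?_, ?_, ?_⟩
  · rw [mul_assoc, ← mul_assoc (diagonal _), diagonal_mul_diagonal]
    have : diagonal (fun i => (w i : ℂ) * (w i : ℂ)⁻¹) = (1 : Matrix n n ℂ) := by
      rw [← diagonal_one]
      congr 1
      funext i
      exact mul_inv_cancel₀ (hwC i)
    rw [this, one_mul, hPP']
  · rw [mul_assoc, ← mul_assoc P', hP'P, one_mul, diagonal_mul_diagonal, ← diagonal_one]
    congr 1
    funext i
    exact inv_mul_cancel₀ (hwC i)
  · rw [conjTranspose_mul, diagonal_conjTranspose]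
    have : diagonal d = diagonal (fun i => (w i : ℂ)) * diagonal (fun i => d i / ‖d i‖)
        * diagonal (star fun i => (w i : ℂ)) := by
      rw [diagonal_mul_diagonal, diagonal_mul_diagonal]
      congr 1
      funext i
      have e1 : star (w i : ℂ) = (w i : ℂ) := Complex.conj_ofReal _
      have e2 : (w i : ℂ) * (w i : ℂ) = (‖d i‖ : ℂ) := by exact_mod_cast hww i
      rw [Pi.star_apply, e1]
      calc d i = (w i : ℂ) * (w i : ℂ) * (d i / ‖d i‖) := by
            rw [e2, mul_div_cancel₀ _ (hdC i)]
        _ = _ := by ring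
    rw [hGP, this]
    simp only [mul_assoc]
  · intro i
    rw [norm_div, Complex.norm_real, norm_norm, div_self (hd0 i).ne']
  · intro i
    have e1 : (d i / ‖d i‖).im = 1 / ‖d i‖ := by
      rw [Complex.div_ofReal_im, hd]
    rw [e1, div_le_div_iff₀ ?_ (hd0 i)]
    · have := hdn i
      rw [le_div_iff₀ ha] at this
      linarith
    · by_contra! hcon
      have := hdn i
      have h2 : g / a ≤ 0 := div_nonpos_of_nonpos_of_nonneg hcon ha.le
      linarith [hd1 i]
  · have h1 : ‖diagonal (fun i => (w i : ℂ))‖ ≤ √(g / a) := by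
      rw [Matrix.l2_opNorm_diagonal, pi_norm_le_iff_of_nonneg (Real.sqrt_nonneg _)]
      intro i
      rw [Complex.norm_real, Real.norm_eq_abs, abs_of_pos (hw0 i)]
      exact Real.sqrt_le_sqrt (hdn i)
    calc ‖P * diagonal (fun i => (w i : ℂ))‖ ^ 2
        ≤ (‖P‖ * √(g / a)) ^ 2 := by
          refine pow_le_pow_left₀ (norm_nonneg _) ((norm_mul_le _ _).trans ?_) 2
          gcongr
      _ = ‖P‖ ^ 2 * (g / a) := by rw [mul_pow, Real.sq_sqrt (by positivity)]
      _ ≤ g * (g / a) := by gcongr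
      _ = _ := by ring
  · have h1 : ‖diagonal (fun i => (w i : ℂ)⁻¹)‖ ≤ 1 := by
      rw [Matrix.l2_opNorm_diagonal, pi_norm_le_iff_of_nonneg zero_le_one]
      intro i
      rw [norm_inv, Complex.norm_real, Real.norm_eq_abs, abs_of_pos (hw0 i)]
      exact inv_le_one_of_one_le₀ (Real.one_le_sqrt.2 (hd1 i))
    refine le_trans (pow_le_pow_left₀ (norm_nonneg _) ((norm_mul_le _ _).trans ?_) 2) hP'n
    calc _ ≤ 1 * ‖P'‖ := by gcongr
      _ = _ := one_mul _

end Factorization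

/-! ### Self-energies and a priori bounds for approximate solutions. -/

section Stability
set_option linter.unusedSectionVars false
open Matrix
open scoped Matrix.Norms.L2Operator
variable {n : Type*} [Fintype n] [DecidableEq n]

/-- The operator `X ↦ Φ(X) - c₀ ⟨X⟩`, with `⟨X⟩` the normalized trace. -/
noncomputable def flatPart (c₀ : ℝ) : Matrix n n ℂ →ₗ[ℂ] Matrix n n ℂ where
  toFun X := ((c₀ / Fintype.card n : ℝ) * X.trace) • (1 : Matrix n n ℂ)
  map_add' X Y := by rw [trace_add, mul_add, add_smul]
  map_smul' c X := by
    rw [trace_smul, smul_eq_mul, RingHom.id_apply, smul_smul]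
    congr 1
    ring

theorem flatPart_apply (c₀ : ℝ) (X : Matrix n n ℂ) :
    flatPart c₀ X = ((c₀ / Fintype.card n : ℝ) * X.trace) • (1 : Matrix n n ℂ) := rfl

/-- Symmetric flat positive operators which are bounded from the Hilbert–Schmidt norm to the
operator norm. -/
structure IsSymSelfEnergy (c₀ κ : ℝ) (Φ : Matrix n n ℂ →ₗ[ℂ] Matrix n n ℂ) : Prop where
  symm : IsHSSymmetric Φ
  twoPos : IsTwoPositive Φ
  twoPos' : IsTwoPositive (Φ - flatPart c₀)
  bound : ∀ X, √(Fintype.card n) * ‖Φ X‖ ≤ κ * hsNorm X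

/-- Flat positive operators which are bounded from the Hilbert–Schmidt norm to the operator norm
and `θ`-close to a symmetric one. -/
structure IsSelfEnergy (c₀ κ θ : ℝ) (Φ : Matrix n n ℂ →ₗ[ℂ] Matrix n n ℂ) : Prop where
  star : ∀ X, Φ Xᴴ = (Φ X)ᴴ
  twoPos : IsTwoPositive Φ
  twoPos' : IsTwoPositive (Φ - flatPart c₀)
  bound : ∀ X, √(Fintype.card n) * ‖Φ X‖ ≤ κ * hsNorm X
  near : ∃ Φs, IsSymSelfEnergy c₀ κ Φs ∧ ∀ X, ‖Φ X - Φs X‖ ≤ θ * ‖X‖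

/-- `G` is invertible with inverse `-z - Φ(G) - E`, where `‖E‖ ≤ ε`, and `Im G ≥ 0`,
`⟨Im G⟩ ≥ ω`. -/
structure IsApproxSolution (Φ : Matrix n n ℂ →ₗ[ℂ] Matrix n n ℂ) (z : ℂ) (ω ε : ℝ)
    (G E : Matrix n n ℂ) : Prop where
  inv : G * (-(z • (1 : Matrix n n ℂ)) - Φ G - E) = 1
  im_nonneg : ∀ x, 0 ≤ (qf G x x).im
  trace_ge : ω * Fintype.card n ≤ G.trace.im
  error : ‖E‖ ≤ ε

theorem IsTwoPositive.nonneg {Φ : Matrix n n ℂ →ₗ[ℂ] Matrix n n ℂ} (h : IsTwoPositive Φ)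
    {A : Matrix n n ℂ} (hA : ∀ x, 0 ≤ (qf A x x).re) (x : n → ℂ) : 0 ≤ (qf (Φ A) x x).re := by
  have h1 := h 0 A A (fun x y => by
    have : qf (0 : Matrix n n ℂ) x y = 0 := by simp [qf]
    rw [this, norm_zero, mul_zero]
    exact add_nonneg (hA x) (hA y)) x x
  rw [map_zero] at h1
  have : qf (0 : Matrix n n ℂ) x x = 0 := by simp [qf]
  rw [this, norm_zero, mul_zero] at h1
  linarith

theorem IsSelfEnergy.map_imPart {Φ : Matrix n n ℂ →ₗ[ℂ] Matrix n n ℂ} {c₀ κ θ : ℝ}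
    (h : IsSelfEnergy c₀ κ θ Φ) (A : Matrix n n ℂ) : Φ (imPart A) = imPart (Φ A) := by
  rw [imPart, imPart, map_smul, map_sub, h.star]

theorem qf_flatPart (c₀ : ℝ) (A : Matrix n n ℂ) (x : n → ℂ) :
    (qf (flatPart c₀ (imPart A)) x x).re
      = c₀ / Fintype.card n * A.trace.im * vecNorm x ^ 2 := by
  rw [flatPart_apply, trace_imPart, qf_smul, qf_one, ← Complex.ofReal_mul, ← Complex.ofReal_mul,
    Complex.ofReal_re]

/-- A positive map applied to `Im A ≥ 0` is nonnegative; for `Φ - c₀ ⟨·⟩` this says that `Φ (Im A)`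
dominates `c₀ ⟨Im A⟩`. -/
theorem flat_lower {Φ : Matrix n n ℂ →ₗ[ℂ] Matrix n n ℂ} {c₀ ω : ℝ} (hc₀ : 0 ≤ c₀)
    (h : IsTwoPositive (Φ - flatPart c₀)) {A : Matrix n n ℂ}
    (hA : ∀ x, 0 ≤ (qf A x x).im) (htr : ω * Fintype.card n ≤ A.trace.im) (x : n → ℂ) :
    c₀ * ω * vecNorm x ^ 2 ≤ (qf (Φ (imPart A)) x x).re := by
  have h1 := h.nonneg (A := imPart A) (fun x => by
    rw [qf_imPart, Complex.ofReal_re]; exact hA x) x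
  rw [LinearMap.sub_apply, qf_sub, Complex.sub_re, qf_flatPart] at h1
  rcases isEmpty_or_nonempty n with hn | hn
  · have : vecNorm x ^ 2 = 0 := by rw [vecNorm_sq]; simp
    rw [this] at h1 ⊢
    linarith
  have hN : (0 : ℝ) < Fintype.card n := by exact_mod_cast Fintype.card_pos
  have h2 : c₀ * ω ≤ c₀ / Fintype.card n * A.trace.im := by
    rw [div_mul_eq_mul_div, le_div_iff₀ hN, mul_assoc]
    exact mul_le_mul_of_nonneg_left htr hc₀
  have := mul_le_mul_of_nonneg_right h2 (sq_nonneg (vecNorm x))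
  linarith

theorem opNorm_le_of_bound {Φ : Matrix n n ℂ →ₗ[ℂ] Matrix n n ℂ} {κ : ℝ} (hκ : 0 ≤ κ)
    (h : ∀ X, √(Fintype.card n) * ‖Φ X‖ ≤ κ * hsNorm X) (X : Matrix n n ℂ) :
    ‖Φ X‖ ≤ κ * ‖X‖ := by
  rcases isEmpty_or_nonempty n with hn | hn
  · have : Φ X = 0 := Subsingleton.elim _ _
    rw [this, norm_zero]
    positivity
  have hN : (0 : ℝ) < √(Fintype.card n) := Real.sqrt_pos.2 (by exact_mod_cast Fintype.card_pos)
  have h1 : hsNorm X ≤ √(Fintype.card n) * ‖X‖ := by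
    refine abs_le_of_sq_le_sq' ?_ (by positivity) |>.2
    rw [mul_pow, Real.sq_sqrt (by positivity)]
    exact hsNorm_sq_le_opNorm X
  have h2 := (h X).trans (mul_le_mul_of_nonneg_left h1 hκ)
  have h3 : √(Fintype.card n) * ‖Φ X‖ ≤ √(Fintype.card n) * (κ * ‖X‖) := by linarith
  exact le_of_mul_le_mul_left h3 hN

section
variable {Φ : Matrix n n ℂ →ₗ[ℂ] Matrix n n ℂ} {c₀ κ θ ω ε : ℝ} {z : ℂ} {G E : Matrix n n ℂ}

theorem IsSelfEnergy.neg_im_qf (hΦ : IsSelfEnergy c₀ κ θ Φ) (z : ℂ) (G E : Matrix n n ℂ)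
    (x : n → ℂ) : -(qf (-(z • (1 : Matrix n n ℂ)) - Φ G - E) x x).im
      = z.im * vecNorm x ^ 2 + (qf (Φ (imPart G)) x x).re + (qf E x x).im := by
  have h1 : (qf (Φ (imPart G)) x x).re = (qf (Φ G) x x).im := by
    rw [hΦ.map_imPart, qf_imPart, Complex.ofReal_re]
  rw [h1, qf_sub, qf_sub, qf_neg, qf_smul, qf_one, Complex.sub_im, Complex.sub_im, Complex.neg_im,
    Complex.im_mul_ofReal]
  ring

/-- Flatness contributes `c₀ ω`, of which the error `E` consumes at most half; `Im z` only helps. -/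
theorem IsApproxSolution.inv_im_ge (hΦ : IsSelfEnergy c₀ κ θ Φ) (hc₀ : 0 ≤ c₀)
    (hz : 0 ≤ z.im) (hG : IsApproxSolution Φ z ω ε G E) (hε : 2 * ε ≤ c₀ * ω) (x : n → ℂ) :
    c₀ * ω / 2 * vecNorm x ^ 2 ≤ -(qf (-(z • (1 : Matrix n n ℂ)) - Φ G - E) x x).im := by
  rw [hΦ.neg_im_qf]
  have h1 := flat_lower hc₀ hΦ.twoPos' hG.im_nonneg hG.trace_ge x
  have h2 : -(ε * vecNorm x ^ 2) ≤ (qf E x x).im := by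
    have h3 := (Complex.abs_im_le_norm _).trans (norm_qf_le E x x)
    have h4 := (abs_le.1 h3).1
    have h5 := mul_le_mul_of_nonneg_right hG.error (sq_nonneg (vecNorm x))
    nlinarith
  have h3 : 0 ≤ z.im * vecNorm x ^ 2 := by positivity
  have h4 := mul_le_mul_of_nonneg_right hε (sq_nonneg (vecNorm x))
  linarith

theorem IsApproxSolution.norm_le (hΦ : IsSelfEnergy c₀ κ θ Φ) (hc₀ : 0 < c₀) (hω : 0 < ω)
    (hz : 0 ≤ z.im) (hG : IsApproxSolution Φ z ω ε G E) (hε : 2 * ε ≤ c₀ * ω) :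
    ‖G‖ ≤ 2 / (c₀ * ω) := by
  set T := -(z • (1 : Matrix n n ℂ)) - Φ G - E with hT
  have hTG : T * G = 1 := mul_eq_one_comm.1 hG.inv
  have : 2 / (c₀ * ω) = 1 / (c₀ * ω / 2) := by rw [one_div_div]
  rw [this]
  refine opNorm_le_inv_of_le (A := T) (by positivity) hTG fun x => ?_
  have h1 := hG.inv_im_ge hΦ hc₀.le hz hε x
  have h2 : -(qf T x x).im ≤ vecNorm x * vecNorm (T *ᵥ x) :=
    (neg_le_abs _).trans ((Complex.abs_im_le_norm _).trans (norm_star_dotProduct_le x _))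
  rcases (vecNorm_nonneg x).eq_or_lt with h0 | h0
  · rw [← h0, mul_zero]; exact vecNorm_nonneg _
  · have h3 : vecNorm x * (c₀ * ω / 2 * vecNorm x) ≤ vecNorm x * vecNorm (T *ᵥ x) := by
      rw [← hT] at h1
      nlinarith
    exact le_of_mul_le_mul_left h3 h0

/-- The point is that `z` itself is bounded: the trace bound forces `‖G‖ ≥ ω`, while `z G = -(1 + G
(Φ G + E))` is bounded. -/
theorem IsApproxSolution.norm_inv_le [Nonempty n] (hΦ : IsSelfEnergy c₀ κ θ Φ) (hc₀ : 0 < c₀)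
    (hκ : 0 ≤ κ) (hω : 0 < ω) (hε1 : ε ≤ 1)
    (hz : 0 ≤ z.im) (hG : IsApproxSolution Φ z ω ε G E) (hε : 2 * ε ≤ c₀ * ω) {g : ℝ}
    (hg : g = 2 / (c₀ * ω)) :
    ‖-(z • (1 : Matrix n n ℂ)) - Φ G - E‖ ≤ (1 + (κ * g + 1) * g) / ω + (κ * g + 1) := by
  have hGn : ‖G‖ ≤ g := hg ▸ hG.norm_le hΦ hc₀ hω hz hε
  have hg0 : 0 ≤ g := (norm_nonneg _).trans hGn
  have h1 : ‖Φ G + E‖ ≤ κ * g + 1 := by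
    refine (norm_add_le _ _).trans (add_le_add ?_ (hG.error.trans hε1))
    exact (opNorm_le_of_bound hκ hΦ.bound G).trans (by gcongr)
  have hN : (0 : ℝ) < Fintype.card n := by exact_mod_cast Fintype.card_pos
  have hωG : ω ≤ ‖G‖ := by
    have h2 := ((Complex.im_le_norm _).trans (norm_trace_le G))
    have h3 := hG.trace_ge.trans h2
    rw [mul_comm] at h3
    exact le_of_mul_le_mul_left h3 hN
  have h4 : z • G = -(1 + G * (Φ G + E)) := by
    have h5 := hG.inv
    rw [sub_sub, mul_sub, mul_neg, Matrix.mul_smul, mul_one] at h5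
    rw [← h5]
    abel
  have hn1 : ‖(1 : Matrix n n ℂ)‖ ≤ 1 := by
    refine opNorm_le_of_vecNorm zero_le_one fun x => ?_
    rw [one_mulVec, one_mul]
  have h6 : ‖z‖ * ω ≤ 1 + (κ * g + 1) * g := by
    calc ‖z‖ * ω ≤ ‖z‖ * ‖G‖ := by gcongr
      _ = ‖z • G‖ := (norm_smul _ _).symm
      _ ≤ ‖(1 : Matrix n n ℂ)‖ + ‖G‖ * ‖Φ G + E‖ := by
          rw [h4, norm_neg]
          exact (norm_add_le _ _).trans (by gcongr; exact norm_mul_le _ _)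
      _ ≤ 1 + g * (κ * g + 1) := by gcongr
      _ = _ := by ring
  rw [sub_sub, ← neg_add', norm_neg]
  refine (norm_add_le _ _).trans (add_le_add ?_ h1)
  rw [norm_smul, le_div_iff₀ hω]
  calc ‖z‖ * ‖(1 : Matrix n n ℂ)‖ * ω ≤ ‖z‖ * 1 * ω := by gcongr
    _ ≤ _ := by rw [mul_one]; exact h6

/-- With `T = G⁻¹` one has `Im G = G (-Im T) Gᴴ`, where `-Im T` is bounded below and `‖T‖ ≤ h`
bounds `Gᴴ` below by `1 / h`. -/
theorem IsApproxSolution.im_ge (hΦ : IsSelfEnergy c₀ κ θ Φ) (hc₀ : 0 < c₀)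
    (hω : 0 < ω) (hz : 0 ≤ z.im) (hG : IsApproxSolution Φ z ω ε G E) (hε : 2 * ε ≤ c₀ * ω) {h : ℝ}
    (hh : 0 < h) (hT : ‖-(z • (1 : Matrix n n ℂ)) - Φ G - E‖ ≤ h) (x : n → ℂ) :
    c₀ * ω / 2 / h ^ 2 * vecNorm x ^ 2 ≤ (qf G x x).im := by
  have h0 := hG.inv_im_ge hΦ hc₀.le hz hε
  set T := -(z • (1 : Matrix n n ℂ)) - Φ G - E with hTdef
  have hGT : G * T = 1 := hG.inv
  have hTG : Tᴴ * Gᴴ = 1 := by rw [← conjTranspose_mul, hGT, conjTranspose_one]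
  have h1 : (qf G x x).im = -(qf T (Gᴴ *ᵥ x) (Gᴴ *ᵥ x)).im := by
    have h2 : G = Gᴴᴴ * Tᴴ * Gᴴ := by rw [conjTranspose_conjTranspose, mul_assoc, hTG, mul_one]
    conv_lhs => rw [h2, qf_conj_mul, qf_conjTranspose, RCLike.star_def, Complex.conj_im]
  rw [h1]
  refine le_trans ?_ (h0 (Gᴴ *ᵥ x))
  have h3 : vecNorm x ≤ h * vecNorm (Gᴴ *ᵥ x) := by
    calc vecNorm x = vecNorm (Tᴴ *ᵥ (Gᴴ *ᵥ x)) := by rw [mulVec_mulVec, hTG, one_mulVec]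
      _ ≤ ‖Tᴴ‖ * vecNorm (Gᴴ *ᵥ x) := vecNorm_mulVec_le _ _
      _ ≤ _ := by
          rw [Matrix.l2_opNorm_conjTranspose]
          exact mul_le_mul_of_nonneg_right hT (vecNorm_nonneg _)
  have h4 : vecNorm x ^ 2 ≤ h ^ 2 * vecNorm (Gᴴ *ᵥ x) ^ 2 := by
    rw [← mul_pow]
    exact pow_le_pow_left₀ (vecNorm_nonneg _) h3 2
  calc c₀ * ω / 2 / h ^ 2 * vecNorm x ^ 2
      ≤ c₀ * ω / 2 / h ^ 2 * (h ^ 2 * vecNorm (Gᴴ *ᵥ x) ^ 2) := by gcongr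
    _ = _ := by field_simp

end

end Stability

/-! ### Hilbert–Schmidt stability of the linearized equation. -/

section LinearStability
set_option linter.unusedSectionVars false
open Matrix
open scoped Matrix.Norms.L2Operator
variable {n : Type*} [Fintype n] [DecidableEq n]

/-- The quadratic form of the flat part is `c₀ |tr Y|² / n ≥ 0`. This is what turns the contraction
bound for the map without its flat part into a spectral gap at `-1` for the full map. -/
theorem trace_flatPart_le {Φs : Matrix n n ℂ →ₗ[ℂ] Matrix n n ℂ} {c₀ : ℝ} (hc₀ : 0 ≤ c₀)
    (Y : Matrix n n ℂ) :
    (Yᴴ * (Φs - flatPart c₀ : Matrix n n ℂ →ₗ[ℂ] Matrix n n ℂ) Y).trace.re ≤ (Yᴴ * Φs Y).trace.re := by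
  rw [LinearMap.sub_apply, mul_sub, trace_sub, Complex.sub_re, flatPart_apply, Matrix.mul_smul,
    mul_one, trace_smul, trace_conjTranspose, smul_eq_mul, mul_assoc, RCLike.star_def,
    RCLike.mul_conj, Complex.re_ofReal_mul]
  have : 0 ≤ ((‖Y.trace‖ : ℂ) ^ 2).re := by
    rw [← Complex.ofReal_pow, Complex.ofReal_re]
    positivity
  have h2 : 0 ≤ c₀ / Fintype.card n * ((‖Y.trace‖ : ℂ) ^ 2).re := by positivity
  simpa using h2

theorem isHSSymmetric_flatPart (c₀ : ℝ) : IsHSSymmetric (flatPart c₀ : Matrix n n ℂ →ₗ[ℂ] _) := by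
  intro X Y
  rw [flatPart_apply, flatPart_apply, conjTranspose_smul, Matrix.smul_mul, Matrix.mul_smul,
    conjTranspose_one, one_mul, mul_one, trace_smul, trace_smul, trace_conjTranspose,
    star_mul', smul_eq_mul, smul_eq_mul]
  have : star ((c₀ / Fintype.card n : ℝ) : ℂ) = ((c₀ / Fintype.card n : ℝ) : ℂ) :=
    Complex.conj_ofReal _
  rw [this]
  ring

theorem IsHSSymmetric.sub {Φ Ψ : Matrix n n ℂ →ₗ[ℂ] Matrix n n ℂ} (h : IsHSSymmetric Φ)
    (h' : IsHSSymmetric Ψ) : IsHSSymmetric (Φ - Ψ) := by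
  intro X Y
  simp only [LinearMap.sub_apply, conjTranspose_sub, sub_mul, mul_sub, trace_sub, h X Y, h' X Y]

variable {Φ Φs : Matrix n n ℂ →ₗ[ℂ] Matrix n n ℂ} {c₀ κ ω ε : ℝ} {z : ℂ} {G E : Matrix n n ℂ}

set_option maxHeartbeats 1000000 in
/-- Hilbert–Schmidt stability for the symmetrized self-energy. -/
theorem hsNorm_le_of_approxSolution (hΦ : IsSelfEnergy c₀ κ ε Φ) (hΦs : IsSymSelfEnergy c₀ κ Φs)
    (hnear : ∀ X, ‖Φ X - Φs X‖ ≤ ε * ‖X‖) (hc₀ : 0 < c₀) (hω : 0 < ω)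
    (hz : 0 ≤ z.im) (hG : IsApproxSolution Φ z ω ε G E)
    {a g σ δ : ℝ} (hε : 0 ≤ ε) (ha : 0 < a) (hGn : ‖G‖ ≤ g) (hga : ∀ x, a * vecNorm x ^ 2 ≤ (qf G x x).im)
    (hσ : 0 < σ) (hσ1 : σ ≤ 1) (hσg : σ ≤ a / g) (hδ : 0 < δ) (hδ1 : δ ≤ 1)
    (hδω : 2 * δ ≤ c₀ * ω * a)
    (hεδ : 2 * (ε * (1 + g) * (g ^ 2 / a) / σ) ≤ δ * σ ^ 2) (X : Matrix n n ℂ) :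
    hsNorm X ≤ g ^ 2 / a * (4 / (δ * σ ^ 2)) * (1 / a) * hsNorm (X - G * Φs X * G) := by
  obtain ⟨Q, Q', u, hQQ', hQ'Q, hGQ, hu, hua, hQn, hQ'n⟩ := exists_balanced_factorization ha hga hGn
  have hg0 : 0 ≤ g := (norm_nonneg _).trans hGn
  set S := imPart (diagonal u) with hS
  have hA : Q * S * Qᴴ = imPart G := by rw [hS, ← imPart_conj, ← hGQ]
  set T := -(z • (1 : Matrix n n ℂ)) - Φ G - E with hT
  have hTG : T * G = 1 := mul_eq_one_comm.1 hG.inv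
  have hSx : ∀ x, qf S x x = ((∑ i, (u i).im * ‖x i‖ ^ 2 : ℝ) : ℂ) := fun x => by
    rw [hS, imPart_diagonal, qf_diagonal]
    push_cast
    rfl
  have hSlow : ∀ x, σ * vecNorm x ^ 2 ≤ (qf S x x).re := fun x => by
    rw [hSx, Complex.ofReal_re, vecNorm_sq, Finset.mul_sum]
    exact Finset.sum_le_sum fun i _ =>
      mul_le_mul_of_nonneg_right (hσg.trans (hua i)) (by positivity)
  have hSup : ∀ x, (qf S x x).re ≤ vecNorm x ^ 2 := fun x => by
    rw [hSx, Complex.ofReal_re, vecNorm_sq]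
    refine Finset.sum_le_sum fun i _ => ?_
    have := (Complex.im_le_norm (u i)).trans_eq (hu i)
    nlinarith [sq_nonneg ‖x i‖]
  have hUU : diagonal u * diagonal (star u) = (1 : Matrix n n ℂ) := by
    rw [diagonal_mul_diagonal, ← diagonal_one]
    congr 1
    funext i
    rw [Pi.star_apply, RCLike.star_def, RCLike.mul_conj, hu]
    simp
  -- In balanced coordinates the inverse `T` of `G` is diagonal, and the negative of its imaginary
  -- part is exactly `S`.
  have hQTQ : Qᴴ * T * Q = diagonal (star u) := by
    have hQh : Qᴴ * Q'ᴴ = 1 := by rw [← conjTranspose_mul, hQ'Q, conjTranspose_one]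
    have h1 : Qᴴ * T * Q * diagonal u = 1 := by
      calc Qᴴ * T * Q * diagonal u = Qᴴ * T * Q * diagonal u * (Qᴴ * Q'ᴴ) := by rw [hQh, mul_one]
        _ = Qᴴ * (T * (Q * diagonal u * Qᴴ)) * Q'ᴴ := by simp only [mul_assoc]
        _ = 1 := by rw [← hGQ, hTG, mul_one, hQh]
    calc Qᴴ * T * Q = Qᴴ * T * Q * (diagonal u * diagonal (star u)) := by rw [hUU, mul_one]
      _ = (Qᴴ * T * Q * diagonal u) * diagonal (star u) := by simp only [mul_assoc]
      _ = _ := by rw [h1, one_mul]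
  have hTQ : ∀ x, -(qf T (Q *ᵥ x) (Q *ᵥ x)).im = (qf S x x).re := fun x => by
    rw [← qf_conj_mul, hQTQ, hSx, Complex.ofReal_re, qf_diagonal, Complex.im_sum,
      ← Finset.sum_neg_distrib]
    refine Finset.sum_congr rfl fun i _ => ?_
    rw [Complex.im_mul_ofReal, Pi.star_apply, RCLike.star_def, Complex.conj_im]
    ring
  -- The imaginary part of the equation, with `Im z ≥ 0` dropped, makes `S` almost subinvariant. The
  -- errors are `ε` from `E` and at most `ε g` from replacing `Φ` by `Φs`; they are measured against
  -- `S` through `‖Q‖² ≤ g² / a` and `S ≥ σ`.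
  have hmain : ∀ x, (qf (Φs (imPart G)) (Q *ᵥ x) (Q *ᵥ x)).re
      ≤ (1 + ε * (1 + g) * (g ^ 2 / a) / σ) * (qf S x x).re := by
    intro x
    set y := Q *ᵥ x with hy
    have h1 := hΦ.neg_im_qf z G E y
    rw [← hT, hTQ] at h1
    have h2 : (qf (Φs (imPart G)) y y).re
        ≤ (qf (Φ (imPart G)) y y).re + ε * g * vecNorm y ^ 2 := by
      have h3 := hnear (imPart G)
      have h4 := (neg_le_abs _).trans ((Complex.abs_re_le_norm _).trans
        (norm_qf_le (Φ (imPart G) - Φs (imPart G)) y y))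
      rw [qf_sub, Complex.sub_re] at h4
      have h5 : ε * ‖imPart G‖ ≤ ε * g := by
        gcongr
        exact (norm_imPart_le G).trans hGn
      have h6 := mul_le_mul_of_nonneg_right (h3.trans h5) (sq_nonneg (vecNorm y))
      nlinarith
    have h3 : -(ε * vecNorm y ^ 2) ≤ (qf E y y).im := by
      have h3 := (Complex.abs_im_le_norm _).trans (norm_qf_le E y y)
      have h4 := (abs_le.1 h3).1
      have h5 := mul_le_mul_of_nonneg_right hG.error (sq_nonneg (vecNorm y))
      nlinarith
    have h4 : vecNorm y ^ 2 ≤ g ^ 2 / a * ((qf S x x).re / σ) := by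
      have h5 : vecNorm y ^ 2 ≤ ‖Q‖ ^ 2 * vecNorm x ^ 2 := by
        rw [← mul_pow]
        exact pow_le_pow_left₀ (vecNorm_nonneg _) (vecNorm_mulVec_le Q x) 2
      have h6 : vecNorm x ^ 2 ≤ (qf S x x).re / σ := by
        rw [le_div_iff₀ hσ, mul_comm]
        exact hSlow x
      exact h5.trans (mul_le_mul hQn h6 (by positivity) (by positivity))
    have h5 : 0 ≤ z.im * vecNorm y ^ 2 := by positivity
    have h6 : ε * (1 + g) * vecNorm y ^ 2 ≤ ε * (1 + g) * (g ^ 2 / a * ((qf S x x).re / σ)) := by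
      gcongr
    have h7 : ε * (1 + g) * (g ^ 2 / a * ((qf S x x).re / σ))
      = ε * (1 + g) * (g ^ 2 / a) / σ * (qf S x x).re := by ring
    nlinarith
  have hflat : ∀ x, c₀ * ω * a * (qf S x x).re
      ≤ (qf (flatPart c₀ (imPart G)) (Q *ᵥ x) (Q *ᵥ x)).re := by
    intro x
    rw [qf_flatPart]
    rcases isEmpty_or_nonempty n with hn | hn
    · have : (qf S x x).re = 0 := by rw [hSx]; simp
      have h2 : vecNorm (Q *ᵥ x) ^ 2 = 0 := by rw [vecNorm_sq]; simp
      rw [this, h2, mul_zero, mul_zero]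
    have hN : (0 : ℝ) < Fintype.card n := by exact_mod_cast Fintype.card_pos
    have h2 : c₀ * ω ≤ c₀ / Fintype.card n * G.trace.im := by
      rw [div_mul_eq_mul_div, le_div_iff₀ hN, mul_assoc]
      exact mul_le_mul_of_nonneg_left hG.trace_ge hc₀.le
    have h3 : a * (qf S x x).re ≤ vecNorm (Q *ᵥ x) ^ 2 := by
      have h4 : vecNorm x ≤ ‖Q'‖ * vecNorm (Q *ᵥ x) := by
        have := vecNorm_mulVec_le Q' (Q *ᵥ x)
        rwa [mulVec_mulVec, hQ'Q, one_mulVec] at this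
      have h5 : vecNorm x ^ 2 ≤ 1 / a * vecNorm (Q *ᵥ x) ^ 2 := by
        calc vecNorm x ^ 2 ≤ (‖Q'‖ * vecNorm (Q *ᵥ x)) ^ 2 :=
              pow_le_pow_left₀ (vecNorm_nonneg _) h4 2
          _ = ‖Q'‖ ^ 2 * vecNorm (Q *ᵥ x) ^ 2 := mul_pow _ _ _
          _ ≤ _ := by gcongr
      rw [div_mul_eq_mul_div, one_mul, le_div_iff₀ ha] at h5
      have := mul_le_mul_of_nonneg_left (hSup x) ha.le
      linarith
    rw [mul_assoc (c₀ * ω)]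
    exact mul_le_mul h2 h3 (mul_nonneg ha.le (le_trans (by positivity) (hSlow x))) (by
      exact le_trans (by positivity) h2)
  -- Since the flat part removes at least `2 δ`, this leaves the factor `1 + δ - 2 δ = 1 - δ` for
  -- the map without it.
  have hεε : ε * (1 + g) * (g ^ 2 / a) / σ ≤ δ := by
    have := mul_le_of_le_one_right hδ.le (pow_le_one₀ hσ.le hσ1 : σ ^ 2 ≤ 1)
    linarith
  have bal := hsNorm_le_of_balanced hΦs.symm (hΦs.symm.sub (isHSSymmetric_flatPart c₀)) hΦs.twoPos
    hΦs.twoPos' (trace_flatPart_le hc₀.le) (ε := ε * (1 + g) * (g ^ 2 / a) / σ) (by positivity) hδ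
    hδ1 hσ hσ1 hεδ hu
    (fun i => hσg.trans (hua i)) Q (fun x => by
      rw [← hS, hA, qf_conj_mul]; exact hmain x) (fun x => by
      rw [← hS, hA, qf_conj_mul, LinearMap.sub_apply, qf_sub, Complex.sub_re]
      have h1 := hmain x
      have h2 := hflat x
      have h3 : 0 ≤ (qf S x x).re := le_trans (by positivity) (hSlow x)
      nlinarith) (Q' * X * Q'ᴴ)
  have hQh : Qᴴ * Q'ᴴ = 1 := by rw [← conjTranspose_mul, hQ'Q, conjTranspose_one]
  have hQh' : Q'ᴴ * Qᴴ = 1 := by rw [← conjTranspose_mul, hQQ', conjTranspose_one]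
  have hback : Q * (Q' * X * Q'ᴴ) * Qᴴ = X := by
    calc Q * (Q' * X * Q'ᴴ) * Qᴴ = (Q * Q') * X * (Q'ᴴ * Qᴴ) := by simp only [mul_assoc]
      _ = X := by rw [hQQ', hQh', one_mul, mul_one]
  rw [hback] at bal
  have hres : Q' * X * Q'ᴴ - diagonal u * (Qᴴ * Φs X * Q) * diagonal u
      = Q' * (X - G * Φs X * G) * Q'ᴴ := by
    have : Q' * (G * Φs X * G) * Q'ᴴ = diagonal u * (Qᴴ * Φs X * Q) * diagonal u := by
      calc Q' * (G * Φs X * G) * Q'ᴴ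
          = Q' * (Q * diagonal u * Qᴴ * Φs X * (Q * diagonal u * Qᴴ)) * Q'ᴴ := by rw [← hGQ]
        _ = (Q' * Q) * (diagonal u * (Qᴴ * Φs X * Q) * diagonal u) * (Qᴴ * Q'ᴴ) := by
            simp only [mul_assoc]
        _ = _ := by rw [hQ'Q, hQh, one_mul, mul_one]
    rw [mul_sub, sub_mul, this]
  rw [hres] at bal
  have h1 : ∀ P Z : Matrix n n ℂ, hsNorm (P * Z * Pᴴ) ≤ ‖P‖ ^ 2 * hsNorm Z := fun P Z => by
    calc hsNorm (P * Z * Pᴴ) ≤ hsNorm (P * Z) * ‖Pᴴ‖ := hsNorm_mul_le_right _ _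
      _ ≤ ‖P‖ * hsNorm Z * ‖Pᴴ‖ := by gcongr; exact hsNorm_mul_le_left _ _
      _ = _ := by rw [Matrix.l2_opNorm_conjTranspose]; ring
  have hδσ : 0 < δ * σ ^ 2 := by positivity
  have h2 : hsNorm (Q' * X * Q'ᴴ) ≤ 4 / (δ * σ ^ 2) * (1 / a * hsNorm (X - G * Φs X * G)) := by
    rw [div_mul_eq_mul_div, le_div_iff₀ hδσ, mul_comm]
    refine bal.trans ?_
    gcongr
    refine (h1 _ _).trans ?_
    gcongr
    exact hsNorm_nonneg _
  calc hsNorm X = hsNorm (Q * (Q' * X * Q'ᴴ) * Qᴴ) := by rw [hback]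
    _ ≤ ‖Q‖ ^ 2 * hsNorm (Q' * X * Q'ᴴ) := h1 _ _
    _ ≤ g ^ 2 / a * (4 / (δ * σ ^ 2) * (1 / a * hsNorm (X - G * Φs X * G))) := by
        gcongr
        exact hsNorm_nonneg _
    _ = _ := by ring

end LinearStability

/-! ### Linear stability in operator norm with uniform constants. -/

section LinearStabilityUniform
open Matrix
open scoped Matrix.Norms.L2Operator
universe v

/-- Approximate solutions with `⟨Im G⟩ ≥ ω` are bounded, have imaginary part bounded below, and
the linearized equation at them is stable, with constants which only depend on `c₀, κ, ω`. -/
theorem exists_linear_stability {c₀ κ ω : ℝ} (hc₀ : 0 < c₀) (hκ : 0 ≤ κ) (hω : 0 < ω) :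
    ∃ ε C g a : ℝ, 0 < ε ∧ 0 < C ∧ 0 < g ∧ 0 < a ∧
      ∀ (n : Type v) [Fintype n] [DecidableEq n] [Nonempty n] (Φ : Matrix n n ℂ →ₗ[ℂ] Matrix n n ℂ)
        (z : ℂ) (G E : Matrix n n ℂ), 0 ≤ z.im → IsSelfEnergy c₀ κ ε Φ →
        IsApproxSolution Φ z ω ε G E →
        ‖G‖ ≤ g ∧ (∀ x, a * vecNorm x ^ 2 ≤ (qf G x x).im) ∧
        ∀ X, ‖X‖ ≤ C * ‖X - G * Φ X * G‖ := by
  set g : ℝ := 2 / (c₀ * ω) with hg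
  have hg0 : 0 < g := by positivity
  set h : ℝ := (1 + (κ * g + 1) * g) / ω + (κ * g + 1) with hh
  have hh0 : 0 < h := by positivity
  set a : ℝ := c₀ * ω / 2 / h ^ 2 with ha
  have ha0 : 0 < a := by positivity
  set σ : ℝ := min 1 (a / g) with hσ
  have hσ0 : 0 < σ := lt_min one_pos (by positivity)
  set δ : ℝ := min 1 (c₀ * ω * a / 2) with hδ
  have hδ0 : 0 < δ := lt_min one_pos (by positivity)
  set C₁ : ℝ := g ^ 2 / a * (4 / (δ * σ ^ 2)) * (1 / a) with hC₁
  have hC₁0 : 0 < C₁ := by positivity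
  set C₂ : ℝ := 1 + g ^ 2 * (κ * C₁) with hC₂
  have hC₂0 : 0 < C₂ := by positivity
  set B : ℝ := 2 * ((1 + g) * (g ^ 2 / a) / σ) with hB
  have hB0 : 0 < B := by positivity
  -- In this order: the bound on `G⁻¹`, the error against flatness, the smallness condition of the
  -- rotation lemma, and the absorption of `Φ - Φs` at the end.
  set ε : ℝ := min (min 1 (c₀ * ω / 2)) (min (δ * σ ^ 2 / B) (1 / (2 * C₂ * g ^ 2))) with hε
  have hε0 : 0 < ε := by
    refine lt_min (lt_min one_pos ?_) (lt_min ?_ ?_) <;> positivity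
  have hε1 : ε ≤ 1 := (min_le_left _ _).trans (min_le_left _ _)
  have hε2 : 2 * ε ≤ c₀ * ω := by
    have : ε ≤ c₀ * ω / 2 := (min_le_left _ _).trans (min_le_right _ _)
    linarith
  have hε3 : 2 * (ε * (1 + g) * (g ^ 2 / a) / σ) ≤ δ * σ ^ 2 := by
    have h1 : ε ≤ δ * σ ^ 2 / B := (min_le_right _ _).trans (min_le_left _ _)
    rw [le_div_iff₀ hB0, hB] at h1
    refine le_trans (le_of_eq ?_) h1
    ring
  have hε4 : C₂ * g ^ 2 * ε ≤ 1 / 2 := by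
    have h1 : ε ≤ 1 / (2 * C₂ * g ^ 2) := (min_le_right _ _).trans (min_le_right _ _)
    rw [le_div_iff₀ (by positivity)] at h1
    linarith
  refine ⟨ε, 2 * C₂, g, a, hε0, by positivity, hg0, ha0, ?_⟩
  intro n _ _ _ Φ z G E hz hΦ hG
  have hGn : ‖G‖ ≤ g := hG.norm_le hΦ hc₀ hω hz hε2
  have hga := hG.im_ge hΦ hc₀ hω hz hε2 hh0 (hG.norm_inv_le hΦ hc₀ hκ hω hε1 hz hε2 hg)
  refine ⟨hGn, hga, fun X => ?_⟩
  obtain ⟨Φs, hΦs, hnear⟩ := hΦ.near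
  have hs := hsNorm_le_of_approxSolution hΦ hΦs hnear hc₀ hω hz hG hε0.le ha0 hGn hga hσ0
    (min_le_left _ _) (min_le_right _ _) hδ0 (min_le_left _ _)
    (by have : δ ≤ c₀ * ω * a / 2 := min_le_right _ _
        linarith) hε3 X
  rw [← hC₁] at hs
  set V := X - G * Φs X * G with hV
  have hN : (0 : ℝ) < √(Fintype.card n) := Real.sqrt_pos.2 (by exact_mod_cast Fintype.card_pos)
  have hVhs : hsNorm V ≤ √(Fintype.card n) * ‖V‖ := by
    refine abs_le_of_sq_le_sq' ?_ (by positivity) |>.2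
    rw [mul_pow, Real.sq_sqrt (by positivity)]
    exact hsNorm_sq_le_opNorm V
  -- The factor `√n` lost in passing from the operator norm of `V` to its Hilbert–Schmidt norm is
  -- regained since `Φs` maps back into the operator norm. Then `X = V + G Φs(X) G` is bounded too.
  have hΦX : ‖Φs X‖ ≤ κ * C₁ * ‖V‖ := by
    have h1 : √(Fintype.card n) * ‖Φs X‖ ≤ √(Fintype.card n) * (κ * C₁ * ‖V‖) := by
      calc √(Fintype.card n) * ‖Φs X‖ ≤ κ * hsNorm X := hΦs.bound X
        _ ≤ κ * (C₁ * (√(Fintype.card n) * ‖V‖)) := by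
            gcongr
            exact hs.trans (by gcongr)
        _ = _ := by ring
    exact le_of_mul_le_mul_left h1 hN
  have hsand : ∀ Z : Matrix n n ℂ, ‖G * Z * G‖ ≤ g ^ 2 * ‖Z‖ := fun Z => by
    calc ‖G * Z * G‖ ≤ ‖G‖ * ‖Z‖ * ‖G‖ :=
          (norm_mul_le _ _).trans (mul_le_mul_of_nonneg_right (norm_mul_le _ _) (norm_nonneg _))
      _ ≤ g * ‖Z‖ * g := by gcongr
      _ = _ := by ring
  have hX1 : ‖X‖ ≤ C₂ * ‖V‖ := by
    calc ‖X‖ = ‖V + G * Φs X * G‖ := by rw [hV, sub_add_cancel]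
      _ ≤ ‖V‖ + g ^ 2 * (κ * C₁ * ‖V‖) :=
          (norm_add_le _ _).trans (by gcongr; exact (hsand _).trans (by gcongr))
      _ = _ := by rw [hC₂]; ring
  have hV' : ‖V‖ ≤ ‖X - G * Φ X * G‖ + g ^ 2 * (ε * ‖X‖) := by
    have : V = (X - G * Φ X * G) + G * (Φ X - Φs X) * G := by
      rw [hV, mul_sub, sub_mul]
      abel
    rw [this]
    refine (norm_add_le _ _).trans ?_
    gcongr
    exact (hsand _).trans (by gcongr; exact hnear X)
  have h1 : C₂ * ‖V‖ ≤ C₂ * (‖X - G * Φ X * G‖ + g ^ 2 * (ε * ‖X‖)) := by gcongr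
  have h2 : C₂ * g ^ 2 * ε * ‖X‖ ≤ 1 / 2 * ‖X‖ := by gcongr
  linarith

end LinearStabilityUniform

/-! ### Uniqueness of the solution with nonnegative imaginary part. -/

section Uniqueness
set_option linter.unusedSectionVars false
open Matrix
open scoped Matrix.Norms.L2Operator
variable {n : Type*} [Fintype n] [DecidableEq n]
variable {Φ : Matrix n n ℂ →ₗ[ℂ] Matrix n n ℂ} {z : ℂ} {M M₁ M₂ : Matrix n n ℂ}

/-- Sandwiching the imaginary part of `M⁻¹ = -z - Φ(M)` in either order gives `Im M = Mᴴ (Im z +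
Φ(Im M)) M = M (Im z + Φ(Im M)) Mᴴ`. -/
theorem im_qf_solution (hstar : ∀ X, Φ Xᴴ = (Φ X)ᴴ)
    (hM : M * (-(z • (1 : Matrix n n ℂ)) - Φ M) = 1) (x y : n → ℂ)
    (hy : y = M *ᵥ x ∨ y = Mᴴ *ᵥ x) :
    (qf M x x).im = z.im * vecNorm y ^ 2 + (qf (Φ (imPart M)) y y).re := by
  set T := -(z • (1 : Matrix n n ℂ)) - Φ M with hT
  have hTM : T * M = 1 := mul_eq_one_comm.1 hM
  have h1 : (qf (Φ (imPart M)) y y).re = (qf (Φ M) y y).im := by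
    have : Φ (imPart M) = imPart (Φ M) := by
      rw [imPart, imPart, map_smul, map_sub, hstar]
    rw [this, qf_imPart, Complex.ofReal_re]
  have h2 : -(qf T y y).im = z.im * vecNorm y ^ 2 + (qf (Φ (imPart M)) y y).re := by
    rw [h1, hT, qf_sub, qf_neg, qf_smul, qf_one, Complex.sub_im, Complex.neg_im,
      Complex.im_mul_ofReal]
    ring
  rw [← h2]
  rcases hy with rfl | rfl
  · have h3 : qf Tᴴ (M *ᵥ x) (M *ᵥ x) = qf M x x := by
      rw [← qf_conj_mul, ← conjTranspose_mul, hTM, conjTranspose_one, one_mul]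
    rw [← h3, qf_conjTranspose, RCLike.star_def, Complex.conj_im]
  · have h3 : qf Tᴴ (Mᴴ *ᵥ x) (Mᴴ *ᵥ x) = qf M x x := by
      rw [← qf_conj_mul, conjTranspose_conjTranspose, mul_assoc, ← conjTranspose_mul, hM,
        conjTranspose_one, mul_one]
    rw [← h3, qf_conjTranspose, RCLike.star_def, Complex.conj_im]

/-- For `Im z > 0` the term with `Im z` is a definite fraction `c` of `Im M`, so the term with `Φ`
is strictly smaller than `Im M`. The constants may depend on `M` and `z`: they serve uniqueness
only. -/
theorem exists_contraction (hpos : IsTwoPositive Φ) (hstar : ∀ X, Φ Xᴴ = (Φ X)ᴴ)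
    (hz : 0 < z.im) (hM : M * (-(z • (1 : Matrix n n ℂ)) - Φ M) = 1)
    (him : ∀ x, 0 ≤ (qf M x x).im) :
    ∃ a c : ℝ, 0 < a ∧ 0 < c ∧ c ≤ 1 ∧ ∀ x y, (y = M *ᵥ x ∨ y = Mᴴ *ᵥ x) →
      a * vecNorm x ^ 2 ≤ (qf M x x).im ∧
      (qf (Φ (imPart M)) y y).re ≤ (1 - c) * (qf M x x).im := by
  set T := -(z • (1 : Matrix n n ℂ)) - Φ M with hT
  have hTM : T * M = 1 := mul_eq_one_comm.1 hM
  refine ⟨z.im / (‖T‖ ^ 2 + 1), z.im / (‖M‖ * ‖T‖ ^ 2 + z.im), by positivity, by positivity, ?_, ?_⟩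
  · rw [div_le_one (by positivity)]
    have : 0 ≤ ‖M‖ * ‖T‖ ^ 2 := by positivity
    linarith
  intro x y hy
  have h1 := im_qf_solution hstar hM x y hy
  have h2 : vecNorm x ≤ ‖T‖ * vecNorm y := by
    rcases hy with rfl | rfl
    · have := vecNorm_mulVec_le T (M *ᵥ x)
      rwa [mulVec_mulVec, hTM, one_mulVec] at this
    · have := vecNorm_mulVec_le Tᴴ (Mᴴ *ᵥ x)
      rwa [mulVec_mulVec, ← conjTranspose_mul, hM, conjTranspose_one, one_mulVec,
        Matrix.l2_opNorm_conjTranspose] at this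
  have h3 : vecNorm x ^ 2 ≤ ‖T‖ ^ 2 * vecNorm y ^ 2 := by
    rw [← mul_pow]
    exact pow_le_pow_left₀ (vecNorm_nonneg _) h2 2
  have h4 : 0 ≤ (qf (Φ (imPart M)) y y).re := hpos.nonneg (fun x => by
    rw [qf_imPart, Complex.ofReal_re]; exact him x) y
  constructor
  · rw [div_mul_eq_mul_div, div_le_iff₀ (by positivity)]
    have h5 : z.im * vecNorm x ^ 2 ≤ z.im * (‖T‖ ^ 2 * vecNorm y ^ 2) := by gcongr
    have h6 : z.im * vecNorm y ^ 2 * (‖T‖ ^ 2 + 1) ≤ (qf M x x).im * (‖T‖ ^ 2 + 1) := by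
      gcongr
      linarith
    have h7 : 0 ≤ z.im * vecNorm y ^ 2 := by positivity
    linarith
  · have h5 : z.im / (‖M‖ * ‖T‖ ^ 2 + z.im) * (qf M x x).im ≤ z.im * vecNorm y ^ 2 := by
      rw [div_mul_eq_mul_div, div_le_iff₀ (by positivity), mul_assoc]
      gcongr
      have h6 : (qf M x x).im ≤ ‖M‖ * vecNorm x ^ 2 := by
        refine (Complex.im_le_norm _).trans ((norm_qf_le M x x).trans (le_of_eq ?_))
        ring
      have h7 : ‖M‖ * vecNorm x ^ 2 ≤ ‖M‖ * (‖T‖ ^ 2 * vecNorm y ^ 2) := by gcongr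
      have h8 : 0 ≤ vecNorm y ^ 2 * z.im := by positivity
      linarith
    linarith

/-- Uniqueness of the solution with nonnegative imaginary part. -/
theorem solution_unique (hpos : IsTwoPositive Φ) (hstar : ∀ X, Φ Xᴴ = (Φ X)ᴴ)
    (hz : 0 < z.im) (hM₁ : M₁ * (-(z • (1 : Matrix n n ℂ)) - Φ M₁) = 1)
    (hM₂ : M₂ * (-(z • (1 : Matrix n n ℂ)) - Φ M₂) = 1)
    (him₁ : ∀ x, 0 ≤ (qf M₁ x x).im) (him₂ : ∀ x, 0 ≤ (qf M₂ x x).im) : M₁ = M₂ := by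
  obtain ⟨a₁, c₁, ha₁, hc₁, hc₁', h₁⟩ := exists_contraction hpos hstar hz hM₁ him₁
  obtain ⟨a₂, c₂, ha₂, hc₂, hc₂', h₂⟩ := exists_contraction hpos hstar hz hM₂ him₂
  set Δ := M₁ - M₂ with hΔ
  have hΔeq : Δ = M₁ * Φ Δ * M₂ := by
    have h3 : (-(z • (1 : Matrix n n ℂ)) - Φ M₂) * M₂ = 1 := mul_eq_one_comm.1 hM₂
    have h4 : Φ Δ = (-(z • (1 : Matrix n n ℂ)) - Φ M₂) - (-(z • (1 : Matrix n n ℂ)) - Φ M₁) := by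
      rw [hΔ, map_sub]
      abel
    rw [h4, mul_sub, sub_mul, hM₁, one_mul, mul_assoc, h3, mul_one]
  set a := min a₁ a₂ with ha
  have ha0 : 0 < a := lt_min ha₁ ha₂
  set c := min c₁ c₂ with hc
  have hc0 : 0 < c := lt_min hc₁ hc₂
  have hc1 : c ≤ 1 := (min_le_left _ _).trans hc₁'
  have imre : ∀ (M : Matrix n n ℂ) (t : ℝ) x, (qf ((t : ℂ) • imPart M) x x).re
      = t * (qf M x x).im := fun M t x => by
    rw [qf_smul, Complex.re_ofReal_mul, qf_imPart, Complex.ofReal_re]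
  -- Domination by `Im M₁` and `Im M₂` is fed through `Δ = M₁ Φ(Δ) M₂` and improves by `1 - c` each
  -- time. The test vectors become `M₁ᴴ x` and `M₂ y`, hence the two cases in `exists_contraction`.
  have dom : ∀ k : ℕ, Dominated Δ (((‖Δ‖ / a * (1 - c) ^ k : ℝ) : ℂ) • imPart M₁)
      (((‖Δ‖ / a * (1 - c) ^ k : ℝ) : ℂ) • imPart M₂) := by
    intro k
    induction k with
    | zero =>
      intro x y
      rw [imre, imre, pow_zero, mul_one, ← mul_add, div_mul_eq_mul_div, le_div_iff₀ ha0]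
      have h3 := norm_qf_le Δ x y
      have h4 : 2 * (vecNorm x * vecNorm y) ≤ vecNorm x ^ 2 + vecNorm y ^ 2 := by
        nlinarith [sq_nonneg (vecNorm x - vecNorm y)]
      have h5 : a * vecNorm x ^ 2 ≤ (qf M₁ x x).im :=
        le_trans (by gcongr; exact min_le_left _ _) (h₁ x _ (Or.inl rfl)).1
      have h6 : a * vecNorm y ^ 2 ≤ (qf M₂ y y).im :=
        le_trans (by gcongr; exact min_le_right _ _) (h₂ y _ (Or.inl rfl)).1
      calc 2 * ‖qf Δ x y‖ * a ≤ 2 * (‖Δ‖ * (vecNorm x * vecNorm y)) * a := by gcongr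
        _ = ‖Δ‖ * (a * (2 * (vecNorm x * vecNorm y))) := by ring
        _ ≤ ‖Δ‖ * (a * (vecNorm x ^ 2 + vecNorm y ^ 2)) := by gcongr
        _ ≤ _ := by gcongr; linarith
    | succ k ih =>
      intro x y
      have h3 := hpos _ _ _ ih (M₁ᴴ *ᵥ x) (M₂ *ᵥ y)
      rw [← qf_conj_mul, conjTranspose_conjTranspose, ← hΔeq] at h3
      refine h3.trans ?_
      rw [map_smul, map_smul, qf_smul, qf_smul, Complex.re_ofReal_mul, Complex.re_ofReal_mul, imre,
        imre, pow_succ]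
      have h4 := (h₁ x _ (Or.inr rfl)).2
      have h5 := (h₂ y _ (Or.inl rfl)).2
      have h6 : (1 - c₁) * (qf M₁ x x).im ≤ (1 - c) * (qf M₁ x x).im :=
        mul_le_mul_of_nonneg_right (by linarith [min_le_left c₁ c₂]) (him₁ x)
      have h7 : (1 - c₂) * (qf M₂ y y).im ≤ (1 - c) * (qf M₂ y y).im :=
        mul_le_mul_of_nonneg_right (by linarith [min_le_right c₁ c₂]) (him₂ y)
      have hk : 0 ≤ ‖Δ‖ / a * (1 - c) ^ k :=
        mul_nonneg (by positivity) (pow_nonneg (by linarith) _)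
      have h8 := mul_le_mul_of_nonneg_left (h4.trans h6) hk
      have h9 := mul_le_mul_of_nonneg_left (h5.trans h7) hk
      linarith
  have hzero : Δ = 0 := by
    ext i j
    have h3 : ∀ k : ℕ, 2 * ‖Δ i j‖ ≤ ‖Δ‖ / a * (1 - c) ^ k *
        ((qf M₁ (Pi.single i 1) (Pi.single i 1)).im
          + (qf M₂ (Pi.single j 1) (Pi.single j 1)).im) := fun k => by
      have := dom k (Pi.single i 1) (Pi.single j 1)
      rwa [imre, imre, qf_single Δ, ← mul_add] at this
    have h4 : Filter.Tendsto (fun k : ℕ => ‖Δ‖ / a * (1 - c) ^ k *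
        ((qf M₁ (Pi.single i 1) (Pi.single i 1)).im
          + (qf M₂ (Pi.single j 1) (Pi.single j 1)).im)) Filter.atTop (nhds (‖Δ‖ / a * 0 *
        ((qf M₁ (Pi.single i 1) (Pi.single i 1)).im
          + (qf M₂ (Pi.single j 1) (Pi.single j 1)).im))) :=
      ((tendsto_pow_atTop_nhds_zero_of_lt_one (by linarith) (by linarith)).const_mul _).mul_const _
    have h5 := ge_of_tendsto' h4 h3
    rw [mul_zero, zero_mul] at h5
    have h6 : ‖Δ i j‖ = 0 := le_antisymm (by linarith) (norm_nonneg _)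
    simpa using h6
  exact sub_eq_zero.1 hzero

end Uniqueness

/-! ### A quantitative inverse function theorem and perturbation of inverses. -/

section Existence
set_option linter.unusedSectionVars false
open Matrix
open scoped Matrix.Norms.L2Operator

/-- A quantitative inverse function theorem: a map close to a boundedly invertible linear map on a
ball has a zero there, if its value at the center is small. -/
theorem exists_zero_of_approximatesLinear {E : Type*} [NormedAddCommGroup E] [NormedSpace ℂ E]
    [FiniteDimensional ℂ E] (B : E →ₗ[ℂ] E) {C c r : ℝ} (hC : 0 < C) (hc : 0 ≤ c) (hr : 0 ≤ r)
    (hB : ∀ x, ‖x‖ ≤ C * ‖B x‖) (f : E → E) (b : E)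
    (hf : ∀ x y, ‖x - b‖ ≤ r → ‖y - b‖ ≤ r → ‖f x - f y - B (x - y)‖ ≤ c * ‖x - y‖)
    (hCc : 2 * C * c ≤ 1) (hfb : 2 * C * ‖f b‖ ≤ r) : ∃ x, ‖x - b‖ ≤ r ∧ f x = 0 := by
  have : CompleteSpace E := FiniteDimensional.complete ℂ E
  have hinj : Function.Injective B := by
    rw [injective_iff_map_eq_zero]
    intro x hx
    have := hB x
    rw [hx, norm_zero, mul_zero] at this
    exact norm_le_zero_iff.1 this
  have hsurj : Function.Surjective B := LinearMap.injective_iff_surjective.1 hinj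
  choose g hg using hsurj
  let B' : E →L[ℂ] E := B.toContinuousLinearMap
  let inv : B'.NonlinearRightInverse :=
    { toFun := g
      nnnorm := ⟨C, hC.le⟩
      bound' := fun y => by
        have := hB (g y)
        rwa [hg] at this
      right_inv' := hg }
  have happ : ApproximatesLinearOn f B' (Metric.closedBall b r) ⟨c, hc⟩ := by
    intro x hx y hy
    rw [Metric.mem_closedBall, dist_eq_norm] at hx hy
    exact hf x y hx hy
  obtain ⟨x, hx, hx0⟩ := happ.surjOn_closedBall_of_nonlinearRightInverse inv hr le_rfl
    (show (0 : E) ∈ _ by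
      rw [Metric.mem_closedBall, dist_eq_norm, zero_sub, norm_neg]
      change ‖f b‖ ≤ (C⁻¹ - c) * r
      have h1 : C⁻¹ / 2 * r ≤ (C⁻¹ - c) * r := by
        gcongr
        have : c ≤ C⁻¹ / 2 := by
          rw [inv_eq_one_div, div_div, le_div_iff₀ (by positivity)]
          linarith
        linarith
      refine le_trans ?_ h1
      rw [inv_eq_one_div, div_div, div_mul_eq_mul_div, one_mul, le_div_iff₀ (by positivity)]
      linarith)
  exact ⟨x, by rwa [Metric.mem_closedBall, dist_eq_norm] at hx, hx0⟩

variable {n : Type*} [Fintype n] [DecidableEq n]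

theorem norm_mul_mul_le {A B D : Matrix n n ℂ} {a b d : ℝ} (hA : ‖A‖ ≤ a) (hB : ‖B‖ ≤ b)
    (hD : ‖D‖ ≤ d) : ‖A * B * D‖ ≤ a * b * d := by
  have ha := (norm_nonneg A).trans hA
  have hb := (norm_nonneg B).trans hB
  calc ‖A * B * D‖ ≤ ‖A‖ * ‖B‖ * ‖D‖ :=
        (norm_mul_le _ _).trans (mul_le_mul_of_nonneg_right (norm_mul_le _ _) (norm_nonneg _))
    _ ≤ _ := by gcongr

theorem inv_perturbation {T G P : Matrix n n ℂ} {g : ℝ} (hGT : G * T = 1) (hg : ‖G‖ ≤ g)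
    (hP : 2 * (g * ‖P‖) ≤ 1) :
    (T - P) * (T - P)⁻¹ = 1 ∧ (T - P)⁻¹ * (T - P) = 1 ∧ ‖(T - P)⁻¹‖ ≤ 2 * g ∧
      (T - P)⁻¹ - G = (T - P)⁻¹ * P * G := by
  have hTG : T * G = 1 := mul_eq_one_comm.1 hGT
  have hGP : ‖G * P‖ < 1 := by
    have h1 : ‖G * P‖ ≤ g * ‖P‖ := (norm_mul_le _ _).trans (by gcongr)
    linarith
  have : CompleteSpace (Matrix n n ℂ) := FiniteDimensional.complete ℂ _
  have hu : IsUnit (T - P) := by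
    have h1 : T - P = T * (1 - G * P) := by
      rw [mul_sub, mul_one, ← mul_assoc, hTG, one_mul]
    rw [h1]
    exact (IsUnit.of_mul_eq_one _ hTG).mul (isUnit_one_sub_of_norm_lt_one hGP)
  have hdet : IsUnit (T - P).det := (isUnit_iff_isUnit_det _).1 hu
  have h1 : (T - P) * (T - P)⁻¹ = 1 := mul_nonsing_inv _ hdet
  have h2 : (T - P)⁻¹ * (T - P) = 1 := nonsing_inv_mul _ hdet
  have h3 : (T - P)⁻¹ - G = (T - P)⁻¹ * P * G := by
    calc (T - P)⁻¹ - G = (T - P)⁻¹ * (T * G) - (T - P)⁻¹ * (T - P) * G := by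
          rw [hTG, h2, mul_one, one_mul]
      _ = (T - P)⁻¹ * P * G := by noncomm_ring
  refine ⟨h1, h2, ?_, h3⟩
  have h5 : ‖(T - P)⁻¹‖ ≤ ‖G‖ + ‖(T - P)⁻¹‖ * ‖P‖ * ‖G‖ := by
    calc ‖(T - P)⁻¹‖ = ‖G + (T - P)⁻¹ * P * G‖ := by rw [← h3]; congr 1; abel
      _ ≤ _ := (norm_add_le _ _).trans (by gcongr; exact norm_mul_mul_le le_rfl le_rfl le_rfl)
  have h6 : ‖(T - P)⁻¹‖ * ‖P‖ * ‖G‖ ≤ ‖(T - P)⁻¹‖ * (‖P‖ * g) := by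
    rw [mul_assoc]
    gcongr
  have h7 : ‖(T - P)⁻¹‖ * (‖P‖ * g) ≤ ‖(T - P)⁻¹‖ * (1 / 2) := by
    gcongr
    linarith
  linarith

theorem IsSelfEnergy.mono {Φ : Matrix n n ℂ →ₗ[ℂ] Matrix n n ℂ} {c₀ κ θ θ' : ℝ}
    (h : IsSelfEnergy c₀ κ θ Φ) (hθ : θ ≤ θ') : IsSelfEnergy c₀ κ θ' Φ :=
  { h with
    near := by
      obtain ⟨Φs, h1, h2⟩ := h.near
      exact ⟨Φs, h1, fun X => (h2 X).trans (by gcongr)⟩ }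

end Existence

/-! ### Lower bound on the trace and stability in maximum norm. -/

section Uniform
open Matrix
open scoped Matrix.Norms.L2Operator
universe v

/-- If there is an approximate solution with `⟨Im G⟩ ≥ ω` then every solution `M` with `Im M ≥ 0`
satisfies `⟨Im M⟩ ≥ ω / 2`. -/
theorem exists_trace_lower_bound {c₀ κ ω : ℝ} (hc₀ : 0 < c₀) (hκ : 0 ≤ κ) (hω : 0 < ω) :
    ∃ ε : ℝ, 0 < ε ∧
      ∀ (n : Type v) [Fintype n] [DecidableEq n] [Nonempty n] (Φ : Matrix n n ℂ →ₗ[ℂ] Matrix n n ℂ)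
        (z : ℂ) (G E M : Matrix n n ℂ), 0 < z.im → IsSelfEnergy c₀ κ ε Φ →
        IsApproxSolution Φ z ω ε G E →
        M * (-(z • (1 : Matrix n n ℂ)) - Φ M) = 1 → (∀ x, 0 ≤ (qf M x x).im) →
        ω / 2 * Fintype.card n ≤ M.trace.im := by
  obtain ⟨ε₁, C, g, a, hε₁, hC, hg, ha, H⟩ := exists_linear_stability.{v} hc₀ hκ hω
  -- the radius of the ball in which the solution is found
  set L : ℝ := 6 * g ^ 3 * κ with hL
  have hL0 : 0 ≤ L := by positivity
  set r : ℝ := min (min (ω / 2) a) (min (1 / (4 * g * (κ + 1))) (1 / (4 * C * (L * κ + 1)))) with hr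
  have hr0 : 0 < r := by
    refine lt_min (lt_min ?_ ha) (lt_min ?_ ?_) <;> positivity
  have hr1 : r ≤ ω / 2 := (min_le_left _ _).trans (min_le_left _ _)
  have hr2 : r ≤ a := (min_le_left _ _).trans (min_le_right _ _)
  have hr3 : 4 * g * (κ * r) ≤ 1 := by
    have h1 : r ≤ 1 / (4 * g * (κ + 1)) := (min_le_right _ _).trans (min_le_left _ _)
    rw [le_div_iff₀ (by positivity)] at h1
    have : 0 ≤ r * (4 * g) := by positivity
    linarith
  have hr4 : 4 * C * (L * (κ * r)) ≤ 1 := by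
    have h1 : r ≤ 1 / (4 * C * (L * κ + 1)) := (min_le_right _ _).trans (min_le_right _ _)
    rw [le_div_iff₀ (by positivity)] at h1
    have : 0 ≤ r * (4 * C) := by positivity
    linarith
  -- In this order: linear stability at `G`, invertibility of `-z - Φ(X)` on the ball, a small
  -- linearization error there, and a small value at the center.
  set ε : ℝ := min (min ε₁ (1 / (4 * g))) (min (1 / (4 * C * (L + 1))) (r / (4 * C * g ^ 2))) with hε
  have hε0 : 0 < ε := by
    refine lt_min (lt_min hε₁ ?_) (lt_min ?_ ?_) <;> positivity
  have hε2 : 4 * g * ε ≤ 1 := by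
    have h1 : ε ≤ 1 / (4 * g) := (min_le_left _ _).trans (min_le_right _ _)
    rw [le_div_iff₀ (by positivity)] at h1
    linarith
  have hε3 : 4 * C * (L * ε) ≤ 1 := by
    have h1 : ε ≤ 1 / (4 * C * (L + 1)) := (min_le_right _ _).trans (min_le_left _ _)
    rw [le_div_iff₀ (by positivity)] at h1
    have : 0 ≤ ε * (4 * C) := by positivity
    linarith
  have hε4 : 4 * C * g ^ 2 * ε ≤ r := by
    have h1 : ε ≤ r / (4 * C * g ^ 2) := (min_le_right _ _).trans (min_le_right _ _)
    rw [le_div_iff₀ (by positivity)] at h1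
    linarith
  refine ⟨ε, hε0, ?_⟩
  intro n _ _ _ Φ z G E M hz hΦ hG hM him
  have hεε₁ : ε ≤ ε₁ := (min_le_left _ _).trans (min_le_left _ _)
  obtain ⟨hGn, hGa, hstab⟩ := H n Φ z G E hz.le (hΦ.mono hεε₁)
    ⟨hG.inv, hG.im_nonneg, hG.trace_ge, hG.error.trans hεε₁⟩
  set T := -(z • (1 : Matrix n n ℂ)) - Φ G - E with hT
  have hΦn := opNorm_le_of_bound hκ hΦ.bound
  have hTX : ∀ X, -(z • (1 : Matrix n n ℂ)) - Φ X = T - (Φ (X - G) - E) := fun X => by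
    rw [hT, map_sub]
    abel
  have hPX : ∀ X, ‖X - G‖ ≤ r → ‖Φ (X - G) - E‖ ≤ κ * r + ε := fun X hX =>
    (norm_sub_le _ _).trans (add_le_add ((hΦn _).trans (by gcongr)) hG.error)
  -- Solutions are the zeros of `X - R X`. Since `R X - R Y = R X Φ(X - Y) R Y` and `R` stays close
  -- to `G` on the ball, this map is approximated by `B X = X - G Φ(X) G`.
  set R : Matrix n n ℂ → Matrix n n ℂ := fun X => (-(z • (1 : Matrix n n ℂ)) - Φ X)⁻¹ with hR
  have hRX : ∀ X, ‖X - G‖ ≤ r → (-(z • (1 : Matrix n n ℂ)) - Φ X) * R X = 1 ∧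
      R X * (-(z • (1 : Matrix n n ℂ)) - Φ X) = 1 ∧ ‖R X‖ ≤ 2 * g ∧
      ‖R X - G‖ ≤ 2 * g ^ 2 * (κ * r + ε) ∧ R X - G = R X * (Φ (X - G) - E) * G := by
    intro X hX
    have h1 := inv_perturbation (P := Φ (X - G) - E) hG.inv hGn (by
      have := mul_le_mul_of_nonneg_left (hPX X hX) hg.le
      linarith)
    rw [← hTX] at h1
    obtain ⟨h2, h3, h4, h5⟩ := h1
    refine ⟨h2, h3, h4, ?_, h5⟩
    change ‖(-(z • (1 : Matrix n n ℂ)) - Φ X)⁻¹ - G‖ ≤ _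
    rw [h5]
    refine (norm_mul_mul_le h4 (hPX X hX) hGn).trans (le_of_eq ?_)
    ring
  obtain ⟨B, hBdef⟩ : ∃ B : Matrix n n ℂ →ₗ[ℂ] Matrix n n ℂ, ∀ X, B X = X - G * Φ X * G :=
    ⟨LinearMap.id - (LinearMap.mulLeftRight ℂ (G, G)) ∘ₗ Φ, fun X => by simp⟩
  have hB : ∀ X, ‖X‖ ≤ C * ‖B X‖ := fun X => by
    rw [hBdef]
    exact hstab X
  have hlin : ∀ X Y, ‖X - G‖ ≤ r → ‖Y - G‖ ≤ r →
      ‖(X - R X) - (Y - R Y) - B (X - Y)‖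
        ≤ L * (κ * r + ε) * ‖X - Y‖ := by
    intro X Y hX hY
    obtain ⟨hX1, hX2, hX3, hX4, -⟩ := hRX X hX
    obtain ⟨hY1, hY2, hY3, hY4, -⟩ := hRX Y hY
    have h1 : R X - R Y = R X * Φ (X - Y) * R Y := by
      have h2 : Φ (X - Y) = (-(z • (1 : Matrix n n ℂ)) - Φ Y) - (-(z • (1 : Matrix n n ℂ)) - Φ X) := by
        rw [map_sub]
        abel
      rw [h2, mul_sub, hX2, sub_mul, one_mul, mul_assoc, hY1, mul_one]
    have h3 : (X - R X) - (Y - R Y) - B (X - Y)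
        = -((R X - G) * Φ (X - Y) * R Y + G * Φ (X - Y) * (R Y - G)) := by
      rw [hBdef]
      have h5 : (R X - G) * Φ (X - Y) * R Y + G * Φ (X - Y) * (R Y - G)
          = (R X - R Y) - G * Φ (X - Y) * G := by
        rw [h1]
        noncomm_ring
      rw [h5]
      abel
    rw [h3, norm_neg]
    have h6 : ‖Φ (X - Y)‖ ≤ κ * ‖X - Y‖ := hΦn _
    refine (norm_add_le _ _).trans ?_
    refine (add_le_add (norm_mul_mul_le hX4 h6 hY3) (norm_mul_mul_le hGn h6 hY4)).trans
      (le_of_eq ?_)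
    rw [hL]
    ring
  obtain ⟨X, hX, hX0⟩ := exists_zero_of_approximatesLinear B hC
    (c := L * (κ * r + ε)) (by positivity) hr0.le hB (fun X => X - R X) G hlin
    (by linarith) (by
      obtain ⟨-, -, h3, -, h5⟩ := hRX G (by rw [sub_self, norm_zero]; exact hr0.le)
      have h6 : ‖G - R G‖ ≤ 2 * g * ε * g := by
        rw [norm_sub_rev, h5]
        refine norm_mul_mul_le h3 ?_ hGn
        rw [sub_self, map_zero, zero_sub, norm_neg]
        exact hG.error
      have h7 := mul_le_mul_of_nonneg_left h6 (by positivity : 0 ≤ 2 * C)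
      linarith)
  have hXR : X = R X := sub_eq_zero.1 hX0
  have hXsol : X * (-(z • (1 : Matrix n n ℂ)) - Φ X) = 1 := by
    have h1 := (hRX X hX).2.1
    rwa [← hXR] at h1
  have hXim : ∀ x, 0 ≤ (qf X x x).im := by
    intro x
    have h1 : qf X x x = qf G x x + qf (X - G) x x := by rw [← qf_add]; congr 1; abel
    have h2 := (abs_le.1 ((Complex.abs_im_le_norm _).trans (norm_qf_le (X - G) x x))).1
    have h3 : ‖X - G‖ * (vecNorm x * vecNorm x) ≤ a * (vecNorm x * vecNorm x) := by
      have := vecNorm_nonneg x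
      gcongr
      exact hX.trans hr2
    have h4 := hGa x
    rw [h1, Complex.add_im]
    nlinarith
  -- The radius is at most `a`, so `Im X` is still nonnegative and uniqueness applies; it is at most
  -- `ω / 2`, so at least half of the trace survives.
  have hMX : M = X := solution_unique hΦ.twoPos hΦ.star hz hM hXsol him hXim
  rw [hMX]
  have h1 : X.trace = G.trace + (X - G).trace := by rw [← trace_add]; congr 1; abel
  have h2 := (abs_le.1 ((Complex.abs_im_le_norm _).trans (norm_trace_le (X - G)))).1
  have h3 : (Fintype.card n : ℝ) * ‖X - G‖ ≤ Fintype.card n * (ω / 2) := by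
    gcongr
    exact hX.trans hr1
  have h4 := hG.trace_ge
  rw [h1, Complex.add_im]
  linarith

/-- Stability of the equation in the maximum norm around a solution with `⟨Im M⟩ ≥ ω`. -/
theorem exists_max_stability {c₀ κ κ' ω : ℝ} (hc₀ : 0 < c₀) (hκ : 0 ≤ κ) (hκ' : 0 ≤ κ')
    (hω : 0 < ω) :
    ∃ θ ε C : ℝ, 0 < θ ∧ 0 < ε ∧ 0 < C ∧
      ∀ (n : Type v) [Fintype n] [DecidableEq n] [Nonempty n] (Φ : Matrix n n ℂ →ₗ[ℂ] Matrix n n ℂ)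
        (z : ℂ) (M M' R : Matrix n n ℂ), 0 ≤ z.im → IsSelfEnergy c₀ κ θ Φ →
        (∀ (X : Matrix n n ℂ) (b : ℝ), (∀ i j, ‖X i j‖ ≤ b) → ‖Φ X‖ ≤ κ' * b) →
        M * (-(z • (1 : Matrix n n ℂ)) - Φ M) = 1 → (∀ x, 0 ≤ (qf M x x).im) →
        ω * Fintype.card n ≤ M.trace.im →
        M' = (-(z • (1 : Matrix n n ℂ)) - Φ M')⁻¹ + R →
        (∀ i j, ‖(M' - M) i j‖ ≤ ε) →
        ∀ ρ : ℝ, (∀ i j, ‖R i j‖ ≤ ρ) → ∀ i j, ‖(M' - M) i j‖ ≤ C * ρ := by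
  obtain ⟨θ, C, g, a, hθ, hC, hg, ha, H⟩ := exists_linear_stability.{v} hc₀ hκ hω
  set ε : ℝ := min (1 / (2 * g * (κ' + 1))) (1 / (4 * C * g ^ 3 * κ * κ' + 1)) with hε
  have hε0 : 0 < ε := by
    refine lt_min ?_ ?_ <;> positivity
  have hε1 : 2 * (g * (κ' * ε)) ≤ 1 := by
    have h1 : ε ≤ 1 / (2 * g * (κ' + 1)) := min_le_left _ _
    rw [le_div_iff₀ (by positivity)] at h1
    have : 0 ≤ ε * (2 * g) := by positivity
    linarith
  have hε2 : C * (2 * g * (κ' * ε) * g * κ * g) ≤ 1 / 2 := by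
    have h1 : ε ≤ 1 / (4 * C * g ^ 3 * κ * κ' + 1) := min_le_right _ _
    rw [le_div_iff₀ (by positivity)] at h1
    linarith
  refine ⟨θ, ε, 4 * C * g ^ 2 * κ' + 1, hθ, hε0, by positivity, ?_⟩
  intro n _ _ _ Φ z M M' R hz hΦ hmax hM him htr hM' hΔ ρ hR i j
  have hM0 : M * (-(z • (1 : Matrix n n ℂ)) - Φ M - 0) = 1 := by rw [sub_zero]; exact hM
  obtain ⟨hMn, -, hstab⟩ := H n Φ z M 0 hz hΦ
    ⟨hM0, him, htr, by rw [norm_zero]; exact hθ.le⟩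
  have hρ0 : 0 ≤ ρ := (norm_nonneg _).trans (hR i j)
  have hΦn := opNorm_le_of_bound hκ hΦ.bound
  have hP : ‖Φ (M' - M)‖ ≤ κ' * ε := hmax _ _ hΔ
  have hT' : -(z • (1 : Matrix n n ℂ)) - Φ M'
      = (-(z • (1 : Matrix n n ℂ)) - Φ M) - Φ (M' - M) := by
    rw [map_sub]
    abel
  obtain ⟨-, -, hG3, hG4⟩ := inv_perturbation (P := Φ (M' - M)) hM hMn (by
    have := mul_le_mul_of_nonneg_left hP hg.le
    linarith)
  rw [← hT'] at hG3 hG4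
  set G' := (-(z • (1 : Matrix n n ℂ)) - Φ M')⁻¹ with hG'
  -- `R` is small only entrywise, so it is split off: `W` is controlled in operator norm, because
  -- `Φ` maps the maximum norm into the operator norm.
  set W := G' - M with hW
  have hΔW : M' - M = W + R := by rw [hW, hM']; abel
  have hWn : ‖W‖ ≤ 2 * g * (κ' * ε) * g := by
    rw [hG4]
    exact norm_mul_mul_le hG3 hP hMn
  -- The linearized operator at `M` produces a quadratic term, absorbed by the smallness of `ε`, and
  -- a term linear in `R`.
  have hWeq : W - M * Φ W * M = W * Φ W * M + G' * Φ R * M := by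
    have h1 : W = G' * (Φ W + Φ R) * M := by rw [← map_add, ← hΔW]; exact hG4
    have h2 : G' = W + M := by rw [hW]; abel
    calc W - M * Φ W * M = G' * (Φ W + Φ R) * M - M * Φ W * M := by rw [← h1]
      _ = (G' - M) * Φ W * M + G' * Φ R * M := by noncomm_ring
      _ = _ := by rw [← hW]
  have h1 : ‖W - M * Φ W * M‖
      ≤ 2 * g * (κ' * ε) * g * (κ * ‖W‖) * g + 2 * g * (κ' * ρ) * g := by
    rw [hWeq]
    exact (norm_add_le _ _).trans (add_le_add (norm_mul_mul_le hWn (hΦn _) hMn)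
      (norm_mul_mul_le hG3 (hmax _ _ hR) hMn))
  have h2 : ‖W‖ ≤ C * (2 * g * (κ' * ε) * g * κ * g) * ‖W‖ + C * (2 * g * (κ' * ρ) * g) := by
    refine (hstab W).trans ((mul_le_mul_of_nonneg_left h1 hC.le).trans (le_of_eq ?_))
    ring
  have h3 : C * (2 * g * (κ' * ε) * g * κ * g) * ‖W‖ ≤ 1 / 2 * ‖W‖ := by gcongr
  have h4 : ‖W‖ ≤ 4 * C * g ^ 2 * κ' * ρ := by linarith
  rw [hΔW, Matrix.add_apply, add_mul, one_mul]
  exact (norm_add_le _ _).trans (add_le_add ((norm_entry_le_opNorm W i j).trans h4) (hR i j))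

end Uniform

/-! ### The operator `Ξ` of a covariance tensor is a self-energy. -/

section Tensor
open Matrix
open scoped Matrix.Norms.L2Operator

/-- The properties of the tensor `ξ` of a model: it is bounded by `1`, of range `K`, symmetric,
almost symmetric under transposition, and `ξ - c₀` is a positive quadratic form. -/
structure IsCovTensor (K : ℕ) (c₀ : ℝ) {N : ℕ} (ξ : Fin N → Fin N → Fin N → Fin N → ℝ) : Prop where
  bound : ∀ i j k l, |ξ i j k l| ≤ 1
  band : ∀ i j k l : Fin N, (K : ℤ) < |(i : ℤ) - k| ∨ (K : ℤ) < |(j : ℤ) - l| → ξ i j k l = 0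
  symm : ∀ i j k l, ξ i j k l = ξ k l i j
  swap : ∀ i j k l, i ≠ j → k ≠ l → ξ i j k l = ξ j i l k
  kraus : ∃ (ι : Type) (_ : Fintype ι) (κ : ι → Fin N → Fin N → ℝ), ∀ i j k l,
    ξ i j k l = (if i = k ∧ j = l then c₀ else 0) + ∑ a, κ a i j * κ a k l

/-- The transposed tensor `ξ_{jilk}`. -/
def tensorTranspose {N : ℕ} (ξ : Fin N → Fin N → Fin N → Fin N → ℝ) :
    Fin N → Fin N → Fin N → Fin N → ℝ := fun i j k l => ξ j i l k

variable {K N : ℕ} {c₀ : ℝ} {ξ : Fin N → Fin N → Fin N → Fin N → ℝ}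

theorem IsCovTensor.transpose (h : IsCovTensor K c₀ ξ) : IsCovTensor K c₀ (tensorTranspose ξ) where
  bound i j k l := h.bound j i l k
  band i j k l hb := h.band j i l k hb.symm
  symm i j k l := h.symm j i l k
  swap i j k l hij hkl := h.swap j i l k hij.symm hkl.symm
  kraus := by
    obtain ⟨ι, hι, κ, hκ⟩ := h.kraus
    refine ⟨ι, hι, fun a i j => κ a j i, fun i j k l => ?_⟩
    rw [tensorTranspose, hκ]
    congr 1
    simp only [and_comm]

/-- The operator `Ξ` as a linear map. -/
noncomputable def XiLin (ξ : Fin N → Fin N → Fin N → Fin N → ℝ) :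
    Matrix (Fin N) (Fin N) ℂ →ₗ[ℂ] Matrix (Fin N) (Fin N) ℂ where
  toFun := Xi ξ
  map_add' X Y := by
    ext i k
    simp only [Xi, of_apply, Matrix.add_apply, mul_add, Finset.sum_add_distrib]
  map_smul' c X := by
    ext i k
    simp only [Xi, of_apply, Matrix.smul_apply, smul_eq_mul, RingHom.id_apply, Finset.mul_sum]
    refine Finset.sum_congr rfl fun j _ => Finset.sum_congr rfl fun l _ => ?_
    ring

theorem XiLin_apply (X : Matrix (Fin N) (Fin N) ℂ) : XiLin ξ X = Xi ξ X := rfl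

theorem Xi_apply (X : Matrix (Fin N) (Fin N) ℂ) (i k : Fin N) :
    Xi ξ X i k = (1 / (N : ℂ)) * ∑ j, ∑ l, (ξ i j k l : ℂ) * X j l := rfl

theorem card_band_le (K : ℕ) (j : Fin N) :
    (Finset.univ.filter fun l : Fin N => |(j : ℤ) - l| ≤ K).card ≤ 2 * K + 1 := by
  have h1 : ((Finset.univ.filter fun l : Fin N => |(j : ℤ) - l| ≤ K).image
      fun l : Fin N => (l : ℤ)) ⊆ Finset.Icc ((j : ℤ) - K) (j + K) := by
    intro t ht
    simp only [Finset.mem_image, Finset.mem_filter, Finset.mem_univ, true_and] at ht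
    obtain ⟨l, hl, rfl⟩ := ht
    rw [abs_le] at hl
    rw [Finset.mem_Icc]
    constructor <;> linarith [hl.1, hl.2]
  have h2 := Finset.card_le_card h1
  rw [Finset.card_image_of_injective _ (fun a b hab => by
    simpa [Fin.ext_iff] using hab), Int.card_Icc] at h2
  omega

theorem card_band_le_real (K : ℕ) (j : Fin N) :
    ((Finset.univ.filter fun l : Fin N => |(j : ℤ) - l| ≤ K).card : ℝ) ≤ 2 * K + 1 := by
  have := Nat.cast_le (α := ℝ).2 (card_band_le K j)
  push_cast at this
  exact this

/-- Cauchy–Schwarz over the at most `2 K + 1` entries of each row; each column meets at most `2 K +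
1` rows. -/
theorem opNorm_le_of_band (K : ℕ) {A : Matrix (Fin N) (Fin N) ℂ} {α : ℝ} (hα : 0 ≤ α)
    (hb : ∀ i k : Fin N, (K : ℤ) < |(i : ℤ) - k| → A i k = 0) (hA : ∀ i k, ‖A i k‖ ≤ α) :
    ‖A‖ ≤ (2 * K + 1) * α := by
  refine opNorm_le_of_vecNorm (by positivity) fun x => ?_
  refine abs_le_of_sq_le_sq' ?_ (mul_nonneg (by positivity) (vecNorm_nonneg _)) |>.2
  have hrow : ∀ i, ‖(A *ᵥ x) i‖ ^ 2
      ≤ (2 * K + 1) * α ^ 2 * ∑ k : Fin N, if |(i : ℤ) - k| ≤ K then ‖x k‖ ^ 2 else 0 := by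
    intro i
    set B := Finset.univ.filter fun k : Fin N => |(i : ℤ) - k| ≤ K with hB
    have h1 : (A *ᵥ x) i = ∑ k ∈ B, A i k * x k := by
      rw [mulVec, dotProduct, hB, Finset.sum_filter]
      refine Finset.sum_congr rfl fun k _ => ?_
      split_ifs with h
      · rfl
      · rw [hb i k (not_le.1 h), zero_mul]
    have h2 : ‖(A *ᵥ x) i‖ ≤ ∑ k ∈ B, α * ‖x k‖ := by
      rw [h1]
      refine (norm_sum_le _ _).trans (Finset.sum_le_sum fun k _ => ?_)
      rw [norm_mul]
      gcongr
      exact hA i k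
    have h3 : (B.card : ℝ) ≤ 2 * K + 1 := card_band_le_real K i
    calc ‖(A *ᵥ x) i‖ ^ 2 ≤ (∑ k ∈ B, α * ‖x k‖) ^ 2 := by gcongr
      _ = α ^ 2 * (∑ k ∈ B, ‖x k‖) ^ 2 := by rw [← Finset.mul_sum, mul_pow]
      _ ≤ α ^ 2 * (B.card * ∑ k ∈ B, ‖x k‖ ^ 2) := by
          gcongr
          exact sq_sum_le_card_mul_sum_sq
      _ ≤ α ^ 2 * ((2 * K + 1) * ∑ k ∈ B, ‖x k‖ ^ 2) := by gcongr
      _ = _ := by rw [hB, Finset.sum_filter]; ring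
  rw [vecNorm_sq, mul_pow, vecNorm_sq]
  calc ∑ i, ‖(A *ᵥ x) i‖ ^ 2
      ≤ ∑ i : Fin N, (2 * K + 1) * α ^ 2 * ∑ k : Fin N, (if |(i : ℤ) - k| ≤ K then ‖x k‖ ^ 2 else 0) :=
        Finset.sum_le_sum fun i _ => hrow i
    _ = (2 * K + 1) * α ^ 2 * ∑ k : Fin N, ∑ i : Fin N, (if |(k : ℤ) - i| ≤ K then ‖x k‖ ^ 2 else 0) := by
        rw [← Finset.mul_sum, Finset.sum_comm]
        simp only [abs_sub_comm]
    _ ≤ (2 * K + 1) * α ^ 2 * ∑ k, (2 * K + 1) * ‖x k‖ ^ 2 := by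
        gcongr with k
        rw [← Finset.sum_filter, Finset.sum_const, nsmul_eq_mul]
        gcongr
        exact card_band_le_real K k
    _ = _ := by rw [← Finset.mul_sum]; ring

theorem norm_Xi_entry_le (h : IsCovTensor K c₀ ξ) (X : Matrix (Fin N) (Fin N) ℂ) (i k : Fin N) :
    ‖Xi ξ X i k‖ ≤ 1 / N * ∑ j : Fin N, ∑ l : Fin N, if |(j : ℤ) - l| ≤ K then ‖X j l‖ else 0 := by
  rw [Xi_apply, norm_mul]
  have : ‖(1 / (N : ℂ))‖ = 1 / N := by simp
  rw [this]
  gcongr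
  refine (norm_sum_le _ _).trans (Finset.sum_le_sum fun j _ => ?_)
  refine (norm_sum_le _ _).trans (Finset.sum_le_sum fun l _ => ?_)
  split_ifs with hb
  · rw [norm_mul, Complex.norm_real, Real.norm_eq_abs]
    exact mul_le_of_le_one_left (norm_nonneg _) (h.bound i j k l)
  · rw [h.band i j k l (Or.inr (not_le.1 hb))]
    simp

theorem Xi_band (h : IsCovTensor K c₀ ξ) (X : Matrix (Fin N) (Fin N) ℂ) (i k : Fin N)
    (hik : (K : ℤ) < |(i : ℤ) - k|) : Xi ξ X i k = 0 := by
  rw [Xi_apply]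
  simp [h.band i _ k _ (Or.inl hik)]

/-- At most `N (2 K + 1)` pairs `(j, l)` contribute to an entry, against the prefactor `1 / N`; the
other factor `2 K + 1` comes from the band structure of the result. -/
theorem norm_Xi_le_max (h : IsCovTensor K c₀ ξ) (X : Matrix (Fin N) (Fin N) ℂ) {b : ℝ}
    (hN : 0 < N) (hb : ∀ i j, ‖X i j‖ ≤ b) : ‖XiLin ξ X‖ ≤ (2 * K + 1) ^ 2 * b := by
  have hb0 : 0 ≤ b := (norm_nonneg _).trans (hb ⟨0, hN⟩ ⟨0, hN⟩)
  have hN' : (0 : ℝ) < N := by exact_mod_cast hN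
  have h1 : ∀ i k, ‖Xi ξ X i k‖ ≤ (2 * K + 1) * b := by
    intro i k
    refine (norm_Xi_entry_le h X i k).trans ?_
    have h2 : ∀ j : Fin N, (∑ l : Fin N, if |(j : ℤ) - l| ≤ K then ‖X j l‖ else 0)
        ≤ (2 * K + 1) * b := by
      intro j
      rw [← Finset.sum_filter]
      refine (Finset.sum_le_card_nsmul _ _ b fun l _ => hb j l).trans ?_
      rw [nsmul_eq_mul]
      gcongr
      exact card_band_le_real K j
    calc 1 / (N : ℝ) * ∑ j : Fin N, ∑ l : Fin N, (if |(j : ℤ) - l| ≤ K then ‖X j l‖ else 0)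
        ≤ 1 / N * ∑ _j : Fin N, (2 * K + 1) * b := by
          gcongr with j
          exact h2 j
      _ = _ := by
          rw [Finset.sum_const, Finset.card_univ, Fintype.card_fin, nsmul_eq_mul, ← mul_assoc,
            one_div_mul_cancel hN'.ne', one_mul]
  refine (opNorm_le_of_band K (by positivity) (Xi_band h X) h1).trans (le_of_eq ?_)
  ring

/-- Cauchy–Schwarz over the contributing pairs gains `1 / √N`. This smoothing lets `ℓ²` arguments
control the operator norm uniformly in `N`. -/
theorem norm_Xi_le_hs (h : IsCovTensor K c₀ ξ) (X : Matrix (Fin N) (Fin N) ℂ) :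
    √N * ‖XiLin ξ X‖ ≤ (2 * K + 1) ^ 2 * hsNorm X := by
  have hN' : (0 : ℝ) ≤ N := by positivity
  have hhs := hsNorm_nonneg X
  have h1 : ∀ i k, ‖Xi ξ X i k‖ ≤ 1 / N * (√N * ((2 * K + 1) * hsNorm X)) := by
    intro i k
    refine (norm_Xi_entry_le h X i k).trans ?_
    gcongr
    refine abs_le_of_sq_le_sq' ?_ (by positivity) |>.2
    have h2 : ∀ j : Fin N, (∑ l : Fin N, if |(j : ℤ) - l| ≤ K then ‖X j l‖ else 0) ^ 2
        ≤ (2 * K + 1) * ∑ l, ‖X j l‖ ^ 2 := by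
      intro j
      rw [← Finset.sum_filter]
      refine sq_sum_le_card_mul_sum_sq.trans ?_
      gcongr
      · exact card_band_le_real K j
      · exact Finset.filter_subset _ _
    calc (∑ j : Fin N, ∑ l : Fin N, if |(j : ℤ) - l| ≤ K then ‖X j l‖ else 0) ^ 2
        ≤ N * ∑ j : Fin N, (∑ l : Fin N, if |(j : ℤ) - l| ≤ K then ‖X j l‖ else 0) ^ 2 := by
          refine sq_sum_le_card_mul_sum_sq.trans (le_of_eq ?_)
          simp
      _ ≤ N * ∑ j : Fin N, (2 * K + 1) * ∑ l, ‖X j l‖ ^ 2 := by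
          gcongr with j
          exact h2 j
      _ = N * ((2 * K + 1) * hsNorm X ^ 2) := by rw [← Finset.mul_sum, hsNorm_sq]
      _ ≤ N * ((2 * K + 1) ^ 2 * hsNorm X ^ 2) := by
          gcongr
          have : (1 : ℝ) ≤ 2 * K + 1 := by linarith [(Nat.cast_nonneg K : (0 : ℝ) ≤ K)]
          nlinarith
      _ = (√N * ((2 * K + 1) * hsNorm X)) ^ 2 := by
          rw [mul_pow (√(N : ℝ)), Real.sq_sqrt hN', mul_pow]
  have h2 := opNorm_le_of_band K (by positivity) (Xi_band h X) h1
  calc √N * ‖XiLin ξ X‖ ≤ √N * ((2 * K + 1) * (1 / N * (√N * ((2 * K + 1) * hsNorm X)))) := by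
        gcongr
        exact h2
    _ = (√N * √N) / N * ((2 * K + 1) ^ 2 * hsNorm X) := by ring
    _ ≤ 1 * ((2 * K + 1) ^ 2 * hsNorm X) := by
        gcongr
        rw [Real.mul_self_sqrt hN']
        exact div_self_le_one _
    _ = _ := one_mul _

theorem congrMap_entry (A Y : Matrix (Fin N) (Fin N) ℂ) (i k : Fin N) :
    congrMap A Y i k = ∑ j, ∑ l, A i j * star (A k l) * Y j l := by
  rw [congrMap_apply, Matrix.mul_apply, Finset.sum_comm]
  refine Finset.sum_congr rfl fun l _ => ?_
  rw [Matrix.mul_apply, Finset.sum_mul, conjTranspose_apply]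
  exact Finset.sum_congr rfl fun j _ => by ring

theorem flatPart_eq_sum (c₀ : ℝ) :
    (flatPart c₀ : Matrix (Fin N) (Fin N) ℂ →ₗ[ℂ] _)
      = ((c₀ / N : ℝ) : ℂ) • ∑ s : Fin N × Fin N, congrMap (Matrix.single s.1 s.2 1) := by
  refine LinearMap.ext fun Y => ?_
  ext i k
  have h1 : ∀ a b : Fin N, congrMap (Matrix.single a b (1 : ℂ)) Y i k
      = if a = i then (if a = k then Y b b else 0) else 0 := by
    intro a b
    rw [congrMap_entry]
    simp only [Matrix.single_apply, ite_and]
    rcases eq_or_ne a i with rfl | hi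
    · rcases eq_or_ne a k with rfl | hk
      · simp [apply_ite (starRingEnd ℂ)]
      · simp [hk]
    · simp [hi]
  rw [flatPart_apply, LinearMap.smul_apply, LinearMap.sum_apply, Fintype.sum_prod_type,
    Fintype.card_fin, Matrix.smul_apply, Matrix.smul_apply, Matrix.sum_apply]
  simp only [Matrix.sum_apply, h1, smul_eq_mul]
  by_cases hik : i = k
  · subst hik
    simp [Matrix.trace]
  · have : ∀ a b : Fin N, (if a = i then (if a = k then Y b b else 0) else 0) = 0 := by
      intro a b
      split_ifs with h h'
      · exact absurd (h.symm.trans h') hik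
      all_goals rfl
    simp [this, Matrix.one_apply_ne hik]

theorem isTwoPositive_flatPart (hc₀ : 0 ≤ c₀) :
    IsTwoPositive (flatPart c₀ : Matrix (Fin N) (Fin N) ℂ →ₗ[ℂ] _) := by
  rw [flatPart_eq_sum]
  exact (IsTwoPositive.sum _ fun s => .congrMap _).smul (by positivity)

/-- The decomposition `kraus` writes this map as `1 / N` times a sum of congruences; the diagonal
term `c₀` of the tensor is exactly `flatPart c₀`. -/
theorem IsCovTensor.twoPos' (h : IsCovTensor K c₀ ξ) :
    IsTwoPositive (XiLin ξ - flatPart c₀) := by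
  obtain ⟨ι, _, κ, hκ⟩ := h.kraus
  have : XiLin ξ - flatPart c₀
      = ((1 / N : ℝ) : ℂ) • ∑ a, congrMap (Matrix.of fun i j => ((κ a i j : ℝ) : ℂ)) := by
    refine LinearMap.ext fun Y => ?_
    ext i k
    rw [LinearMap.sub_apply, Matrix.sub_apply, XiLin_apply, Xi_apply, flatPart_apply,
      LinearMap.smul_apply, LinearMap.sum_apply, Matrix.smul_apply, Matrix.smul_apply,
      Matrix.sum_apply, Fintype.card_fin]
    simp only [congrMap_entry, of_apply, RCLike.star_def, Complex.conj_ofReal]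
    have h1 : ∑ a, ∑ j, ∑ l, ((κ a i j : ℝ) : ℂ) * ((κ a k l : ℝ) : ℂ) * Y j l
        = ∑ j, ∑ l, ∑ a, ((κ a i j : ℝ) : ℂ) * ((κ a k l : ℝ) : ℂ) * Y j l := by
      rw [Finset.sum_comm]
      exact Finset.sum_congr rfl fun j _ => Finset.sum_comm
    have h2 : ∑ j, ∑ l, (ξ i j k l : ℂ) * Y j l = (if i = k then c₀ * Y.trace else 0)
        + ∑ j, ∑ l, ∑ a, ((κ a i j : ℝ) : ℂ) * ((κ a k l : ℝ) : ℂ) * Y j l := by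
      have h3 : ∀ j l, (ξ i j k l : ℂ) * Y j l
          = (if i = k then (if j = l then c₀ * Y j l else 0) else 0)
            + ∑ a, ((κ a i j : ℝ) : ℂ) * ((κ a k l : ℝ) : ℂ) * Y j l := by
        intro j l
        rw [hκ, ite_and, ← Finset.sum_mul]
        push_cast
        rw [add_mul]
        congr 1
        split_ifs <;> simp
      simp only [h3, Finset.sum_add_distrib]
      congr 1
      by_cases hik : i = k
      · simp [hik, Matrix.trace, Finset.mul_sum]
      · simp [hik]
    rw [h1, h2, Matrix.one_apply]
    push_cast
    by_cases hik : i = k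
    · simp only [hik, if_true, smul_eq_mul]
      ring
    · simp only [hik, if_false, smul_eq_mul]
      ring
  rw [this]
  exact (IsTwoPositive.sum _ fun s => .congrMap _).smul (by positivity)

theorem IsCovTensor.twoPos (h : IsCovTensor K c₀ ξ) (hc₀ : 0 ≤ c₀) : IsTwoPositive (XiLin ξ) := by
  have := h.twoPos'.add (isTwoPositive_flatPart hc₀)
  rwa [sub_add_cancel] at this

theorem IsCovTensor.star (h : IsCovTensor K c₀ ξ) (X : Matrix (Fin N) (Fin N) ℂ) :
    XiLin ξ Xᴴ = (XiLin ξ X)ᴴ := by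
  ext i k
  rw [conjTranspose_apply, XiLin_apply, XiLin_apply, Xi_apply, Xi_apply, star_mul', star_sum,
    Finset.sum_comm]
  congr 1
  · simp
  · refine Finset.sum_congr rfl fun j _ => ?_
    rw [star_sum]
    refine Finset.sum_congr rfl fun l _ => ?_
    rw [star_mul', conjTranspose_apply, h.symm]
    congr 1
    exact (Complex.conj_ofReal _).symm

/-- Taking the adjoint exchanges the index pairs `(i, k)` and `(j, l)`, that is, transposes the
tensor. -/
theorem trace_XiLin (X Y : Matrix (Fin N) (Fin N) ℂ) :
    ((XiLin ξ X)ᴴ * Y).trace = (Xᴴ * XiLin (tensorTranspose ξ) Y).trace := by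
  have key : ∀ A B : Matrix (Fin N) (Fin N) ℂ, (Aᴴ * B).trace = ∑ i, ∑ k, star (A i k) * B i k := by
    intro A B
    rw [trace, Finset.sum_comm]
    rfl
  rw [key, key]
  have h1 : ∑ i, ∑ k, star (XiLin ξ X i k) * Y i k
      = ∑ i, ∑ k, ∑ j, ∑ l, (1 / (N : ℂ)) * (ξ i j k l : ℂ) * star (X j l) * Y i k := by
    refine Finset.sum_congr rfl fun i _ => Finset.sum_congr rfl fun k _ => ?_
    rw [XiLin_apply, Xi_apply, star_mul', star_sum, Finset.mul_sum, Finset.sum_mul]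
    refine Finset.sum_congr rfl fun j _ => ?_
    rw [star_sum, Finset.mul_sum, Finset.sum_mul]
    refine Finset.sum_congr rfl fun l _ => ?_
    have e1 : star (1 / (N : ℂ)) = 1 / (N : ℂ) := by simp
    have e2 : star (ξ i j k l : ℂ) = (ξ i j k l : ℂ) := Complex.conj_ofReal _
    rw [star_mul', e1, e2]
    ring
  have h2 : ∑ j, ∑ l, star (X j l) * XiLin (tensorTranspose ξ) Y j l
      = ∑ j, ∑ l, ∑ i, ∑ k, (1 / (N : ℂ)) * (ξ i j k l : ℂ) * star (X j l) * Y i k := by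
    refine Finset.sum_congr rfl fun j _ => Finset.sum_congr rfl fun l _ => ?_
    rw [XiLin_apply, Xi_apply, Finset.mul_sum, Finset.mul_sum]
    refine Finset.sum_congr rfl fun i _ => ?_
    rw [Finset.mul_sum, Finset.mul_sum]
    refine Finset.sum_congr rfl fun k _ => ?_
    rw [tensorTranspose]
    ring
  rw [h1, h2]
  have h3 : ∀ i : Fin N, (∑ k, ∑ j, ∑ l, (1 / (N : ℂ)) * (ξ i j k l : ℂ) * star (X j l) * Y i k)
      = ∑ j, ∑ l, ∑ k, (1 / (N : ℂ)) * (ξ i j k l : ℂ) * star (X j l) * Y i k := by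
    intro i
    rw [Finset.sum_comm]
    exact Finset.sum_congr rfl fun j _ => Finset.sum_comm
  rw [Finset.sum_congr rfl fun i _ => h3 i, Finset.sum_comm]
  exact Finset.sum_congr rfl fun j _ => Finset.sum_comm

/-- The tensor and its transpose differ only if `i = j` or `k = l`. For fixed `i, k` the band
condition leaves at most `2 K + 1` pairs `(j, l)` in either case, instead of order `N`, so the
prefactor `1 / N` survives. -/
theorem norm_Xi_sub_transpose_le (h : IsCovTensor K c₀ ξ) (X : Matrix (Fin N) (Fin N) ℂ) :
    ‖XiLin ξ X - XiLin (tensorTranspose ξ) X‖ ≤ 4 * (2 * K + 1) ^ 2 / N * ‖X‖ := by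
  have h1 : ∀ i k, ‖(XiLin ξ X - XiLin (tensorTranspose ξ) X) i k‖
      ≤ 1 / N * (4 * (2 * K + 1) * ‖X‖) := by
    intro i k
    have h2 : (XiLin ξ X - XiLin (tensorTranspose ξ) X) i k
        = (1 / (N : ℂ)) * ∑ j, ∑ l, ((ξ i j k l - ξ j i l k : ℝ) : ℂ) * X j l := by
      rw [Matrix.sub_apply, XiLin_apply, XiLin_apply, Xi_apply, Xi_apply, ← mul_sub,
        ← Finset.sum_sub_distrib]
      congr 1
      refine Finset.sum_congr rfl fun j _ => ?_
      rw [← Finset.sum_sub_distrib]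
      refine Finset.sum_congr rfl fun l _ => ?_
      rw [tensorTranspose]
      push_cast
      ring
    rw [h2, norm_mul]
    have e1 : ‖(1 / (N : ℂ))‖ = 1 / N := by simp
    rw [e1]
    gcongr
    have h3 : ∀ j l : Fin N, ‖((ξ i j k l - ξ j i l k : ℝ) : ℂ) * X j l‖
        ≤ (if i = j then (if |(i : ℤ) - l| ≤ K then 2 * ‖X‖ else 0) else 0)
          + (if k = l then (if |(k : ℤ) - j| ≤ K then 2 * ‖X‖ else 0) else 0) := by
      intro j l
      have hX : 0 ≤ 2 * ‖X‖ := by positivity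
      by_cases hne : i ≠ j ∧ k ≠ l
      · rw [h.swap i j k l hne.1 hne.2, sub_self, if_neg hne.1, if_neg hne.2]
        simp
      have hn : ‖((ξ i j k l - ξ j i l k : ℝ) : ℂ) * X j l‖ ≤ 2 * ‖X‖ := by
        rw [norm_mul, Complex.norm_real, Real.norm_eq_abs]
        gcongr
        · exact (abs_sub _ _).trans (by linarith [h.bound i j k l, h.bound j i l k])
        · exact norm_entry_le_opNorm X j l
      by_cases hb : |(j : ℤ) - l| ≤ K
      · by_cases hij : i = j
        · subst hij
          rw [if_pos rfl, if_pos hb]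
          refine hn.trans (le_add_of_nonneg_right ?_)
          split_ifs <;> first | exact hX | exact le_rfl
        · have hkl : k = l := by
            by_contra hkl
            exact hne ⟨hij, hkl⟩
          subst hkl
          rw [if_neg hij, if_pos rfl, if_pos (by rwa [abs_sub_comm]), zero_add]
          exact hn
      · rw [h.band i j k l (Or.inr (not_le.1 hb)), h.band j i l k (Or.inl (not_le.1 hb)), sub_self]
        simp only [Complex.ofReal_zero, zero_mul, norm_zero]
        refine add_nonneg ?_ ?_ <;> split_ifs <;> first | exact hX | exact le_rfl
    refine (norm_sum_le _ _).trans ((Finset.sum_le_sum fun j _ => (norm_sum_le _ _).trans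
      (Finset.sum_le_sum fun l _ => h3 j l)).trans ?_)
    have hcard : ∀ i : Fin N, (∑ l : Fin N, if |(i : ℤ) - l| ≤ K then 2 * ‖X‖ else 0)
        ≤ (2 * K + 1) * (2 * ‖X‖) := by
      intro i
      rw [← Finset.sum_filter, Finset.sum_const, nsmul_eq_mul]
      gcongr
      exact card_band_le_real K i
    have e2 : ∑ j : Fin N, ∑ l : Fin N, ((if i = j then (if |(i : ℤ) - l| ≤ K then 2 * ‖X‖ else 0) else 0)
          + (if k = l then (if |(k : ℤ) - j| ≤ K then 2 * ‖X‖ else 0) else 0))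
        = (∑ l : Fin N, if |(i : ℤ) - l| ≤ K then 2 * ‖X‖ else 0)
          + ∑ j : Fin N, if |(k : ℤ) - j| ≤ K then 2 * ‖X‖ else 0 := by
      simp only [Finset.sum_add_distrib]
      congr 1
      · rw [Finset.sum_comm]
        simp
      · simp
    rw [e2]
    linarith [hcard i, hcard k]
  refine (opNorm_le_of_band K (by positivity) (fun i k hik => ?_) h1).trans (le_of_eq (by ring))
  rw [Matrix.sub_apply, XiLin_apply, XiLin_apply, Xi_band h X i k hik,
    Xi_band h.transpose X i k hik, sub_self]

/-- The symmetric comparison map is the average of `Ξ` and its adjoint; it inherits positivity,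
flatness and the bound from both. -/
theorem IsCovTensor.isSelfEnergy (h : IsCovTensor K c₀ ξ) (hc₀ : 0 ≤ c₀) :
    IsSelfEnergy c₀ ((2 * K + 1) ^ 2) (2 * (2 * K + 1) ^ 2 / N) (XiLin ξ) where
  star := h.star
  twoPos := h.twoPos hc₀
  twoPos' := h.twoPos'
  bound X := by rw [Fintype.card_fin]; exact norm_Xi_le_hs h X
  near := by
    have half : (((1 / 2 : ℝ) : ℝ) : ℂ) = 1 / 2 := by push_cast; rfl
    refine ⟨((1 / 2 : ℝ) : ℂ) • (XiLin ξ + XiLin (tensorTranspose ξ)), ⟨?_, ?_, ?_, ?_⟩, ?_⟩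
    · intro X Y
      have h2 : tensorTranspose (tensorTranspose ξ) = ξ := rfl
      rw [LinearMap.smul_apply, LinearMap.smul_apply, LinearMap.add_apply, LinearMap.add_apply,
        conjTranspose_smul, conjTranspose_add, Matrix.smul_mul, Matrix.mul_smul, add_mul, mul_add,
        trace_smul, trace_smul, trace_add, trace_add, trace_XiLin, trace_XiLin, h2,
        RCLike.star_def, Complex.conj_ofReal, add_comm]
    · exact ((h.twoPos hc₀).add (h.transpose.twoPos hc₀)).smul (by norm_num)
    · have e : ((1 / 2 : ℝ) : ℂ) • (XiLin ξ + XiLin (tensorTranspose ξ)) - flatPart c₀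
          = ((1 / 2 : ℝ) : ℂ) • ((XiLin ξ - flatPart c₀)
            + (XiLin (tensorTranspose ξ) - flatPart c₀)) := by
        rw [half]
        module
      rw [e]
      exact (h.twoPos'.add h.transpose.twoPos').smul (by norm_num)
    · intro X
      rw [Fintype.card_fin, LinearMap.smul_apply, LinearMap.add_apply, norm_smul, half]
      have e1 : ‖(1 / 2 : ℂ)‖ = 1 / 2 := by simp
      rw [e1]
      have h1 := norm_Xi_le_hs h X
      have h2 := norm_Xi_le_hs h.transpose X
      have h3 := mul_le_mul_of_nonneg_left (norm_add_le (XiLin ξ X) (XiLin (tensorTranspose ξ) X))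
        (Real.sqrt_nonneg N)
      linarith
    · intro X
      have e : XiLin ξ X - (((1 / 2 : ℝ) : ℂ) • (XiLin ξ + XiLin (tensorTranspose ξ))) X
          = (1 / 2 : ℂ) • (XiLin ξ X - XiLin (tensorTranspose ξ) X) := by
        rw [half, LinearMap.smul_apply, LinearMap.add_apply]
        module
      rw [e, norm_smul]
      have e1 : ‖(1 / 2 : ℂ)‖ = 1 / 2 := by simp
      rw [e1]
      refine (mul_le_mul_of_nonneg_left (norm_Xi_sub_transpose_le h X) (by norm_num)).trans
        (le_of_eq (by ring))

end Tensor

/-! ### Covariances of the random matrix model. -/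

section Model

variable {K : ℕ} {τ : ℝ} {μ : ℕ → ℝ} {ψ : ℝ → ℝ → ℤ → ℤ → ℝ} {C c₀ : ℝ}
  {Ω : ℕ → Type*} [∀ N, MeasurableSpace (Ω N)] {P : ∀ N, Measure (Ω N)}
  {x : ∀ N, Fin N → Fin N → Ω N → ℝ}

theorem IsModel.integrable_sq (h : IsModel K τ μ ψ C P x) {N : ℕ} {i j : Fin N} (hij : i ≤ j) :
    Integrable (fun w => x N i j w ^ 2) (P N) := by
  simpa using (h.moments N i j hij 2 le_rfl).1

theorem IsModel.integral_sq_le (h : IsModel K τ μ ψ C P x) (hμ : μ 2 = 1) {N : ℕ} {i j : Fin N}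
    (hij : i ≤ j) : ∫ w, x N i j w ^ 2 ∂(P N) ≤ 1 := by
  simpa [hμ] using (h.moments N i j hij 2 le_rfl).2

theorem IsModel.integrable_mul (h : IsModel K τ μ ψ C P x) {N : ℕ} {i j k l : Fin N}
    (hij : i ≤ j) (hkl : k ≤ l) : Integrable (fun w => x N i j w * x N k l w) (P N) := by
  have h1 : MemLp (x N i j) 2 (P N) :=
    (memLp_two_iff_integrable_sq (h.measurable N i j hij).aestronglyMeasurable).2
      (h.integrable_sq hij)
  have h2 : MemLp (x N k l) 2 (P N) :=
    (memLp_two_iff_integrable_sq (h.measurable N k l hkl).aestronglyMeasurable).2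
      (h.integrable_sq hkl)
  exact h1.integrable_mul h2

theorem IsModel.abs_integral_mul_le (h : IsModel K τ μ ψ C P x) (hμ : μ 2 = 1) {N : ℕ}
    {i j k l : Fin N} (hij : i ≤ j) (hkl : k ≤ l) :
    |∫ w, x N i j w * x N k l w ∂(P N)| ≤ 1 := by
  have h1 := h.integral_sq_le hμ hij
  have h2 := h.integral_sq_le hμ hkl
  have h3 := (h.integrable_sq hij).add (h.integrable_sq hkl)
  have h4 : ∫ w, (x N i j w ^ 2 + x N k l w ^ 2) ∂(P N) ≤ 2 := by
    rw [integral_add (h.integrable_sq hij) (h.integrable_sq hkl)]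
    linarith
  have h5 : ∫ w, |x N i j w * x N k l w| ∂(P N)
      ≤ ∫ w, (1 / 2) * (x N i j w ^ 2 + x N k l w ^ 2) ∂(P N) := by
    refine integral_mono (h.integrable_mul hij hkl).abs (h3.const_mul _) fun w => ?_
    rw [abs_mul]
    have := two_mul_le_add_sq |x N i j w| |x N k l w|
    rw [sq_abs, sq_abs] at this
    simp only
    linarith
  rw [integral_const_mul] at h5
  exact (abs_integral_le_integral_abs).trans (by linarith)

theorem IsModel.integral_mul_eq_zero (h : IsModel K τ μ ψ C P x) {N : ℕ} {i j k l : Fin N}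
    (hij : i ≤ j) (hkl : k ≤ l) (hd : (K : ℤ) < pairDist i j k l) :
    ∫ w, x N i j w * x N k l w ∂(P N) = 0 := by
  have h1 : IndepFun (x N i j) (x N k l) (P N) :=
    (h.dependence N i j hij).comp measurable_id
      (measurable_pi_apply (⟨(k, l), hkl, hd⟩ :
        {s : Fin N × Fin N // s.1 ≤ s.2 ∧ (K : ℤ) < pairDist i j s.1 s.2}))
  rw [h1.integral_fun_mul_eq_mul_integral (h.measurable N i j hij).aestronglyMeasurable
    (h.measurable N k l hkl).aestronglyMeasurable, h.centered N i j hij, zero_mul]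

theorem IsModel.covMat_apply (h : IsModel K τ μ ψ C P x) {N : ℕ}
    (s t : {s : Fin N × Fin N // s.1 ≤ s.2}) :
    covMat (P N) (x N) s t = ∫ w, x N s.1.1 s.1.2 w * x N t.1.1 t.1.2 w ∂(P N) := by
  rw [covMat, Matrix.of_apply, covariance, h.centered N _ _ s.2, h.centered N _ _ t.2]
  simp

/-- The bound uses only second moments, normalized by `μ 2 = 1`; the band is independence of
centered variables; `kraus` is a square root of the covariance matrix minus `c₀`. -/
theorem IsModel.isCovTensor (h : IsModel K τ μ ψ C P x) (hμ : μ 2 = 1)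
    (hP : IsPosDefTensor c₀ P x) (N : ℕ) : IsCovTensor K c₀ (tensor (P N) (x N)) where
  bound i j k l := by
    unfold tensor
    split_ifs with h1 h2
    · exact h.abs_integral_mul_le hμ h1.1 h1.2
    · exact h.abs_integral_mul_le hμ h2.1.le h2.2.le
    · simp
  band i j k l hb := by
    unfold tensor
    split_ifs with h1 h2
    · exact h.integral_mul_eq_zero h1.1 h1.2 (lt_max_iff.2 hb)
    · exact h.integral_mul_eq_zero h2.1.le h2.2.le (lt_max_iff.2 hb.symm)
    · rfl
  symm i j k l := by
    unfold tensor
    simp only [and_comm (a := k ≤ l), and_comm (a := l < k), mul_comm]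
  swap i j k l hij hkl := by
    unfold tensor
    by_cases h1 : i ≤ j <;> by_cases h2 : k ≤ l
    · simp [h1, h2, not_le.2 (lt_of_le_of_ne h1 hij), lt_of_le_of_ne h1 hij,
        lt_of_le_of_ne h2 hkl]
    · simp [h1, h2, not_le.2 (lt_of_le_of_ne h1 hij), not_lt.2 (not_le.1 h2).le]
    · simp [h1, h2, not_le.2 (lt_of_le_of_ne h2 hkl), not_lt.2 (not_le.1 h1).le]
    · simp [h1, h2, (not_le.1 h1).le, (not_le.1 h2).le, not_le.1 h1, not_le.1 h2]
  kraus := by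
    obtain ⟨B, hB⟩ := exists_eq_conjTranspose_mul_self (hP N)
    have hB' : ∀ s t : {s : Fin N × Fin N // s.1 ≤ s.2},
        ∫ w, x N s.1.1 s.1.2 w * x N t.1.1 t.1.2 w ∂(P N)
          = (if s = t then c₀ else 0) + ∑ a, B a s * B a t := by
      intro s t
      have h1 := congrFun (congrFun hB s) t
      rw [Matrix.sub_apply, h.covMat_apply, Matrix.smul_apply, Matrix.one_apply,
        Matrix.mul_apply] at h1
      simp only [Matrix.conjTranspose_apply, star_trivial, smul_eq_mul, mul_ite, mul_one,
        mul_zero] at h1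
      linarith
    -- The Boolean separates a copy of the square root for the upper triangle from one for the
    -- strictly lower triangle. Products across the two copies vanish, as the tensor does for mixed
    -- index orders.
    refine ⟨{s : Fin N × Fin N // s.1 ≤ s.2} × Bool, inferInstance,
      fun a i j => if a.2 then (if h : i ≤ j then B a.1 ⟨(i, j), h⟩ else 0)
        else (if h : j < i then B a.1 ⟨(j, i), h.le⟩ else 0), fun i j k l => ?_⟩
    rw [Fintype.sum_prod_type]
    simp only [Fintype.sum_bool, if_true, Bool.false_eq_true, if_false, tensor]
    rcases le_or_gt i j with h1 | h1 <;> rcases le_or_gt k l with h2 | h2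
    · simp only [h1, h2, not_lt.2 h1, dif_pos, and_self, if_true, dif_neg, not_false_eq_true,
        zero_mul, add_zero]
      rw [hB' ⟨(i, j), h1⟩ ⟨(k, l), h2⟩]
      simp
    · have : ¬ (i = k ∧ j = l) := by rintro ⟨rfl, rfl⟩; exact absurd h1 (not_le.2 h2)
      simp [h1, h2, not_lt.2 h1, not_le.2 h2, this]
    · have : ¬ (i = k ∧ j = l) := by rintro ⟨rfl, rfl⟩; exact absurd h2 (not_le.2 h1)
      simp [h1, h2, not_le.2 h1, not_lt.2 h2, this]
    · simp only [h1, h2, not_le.2 h1, not_le.2 h2, dif_pos, and_self, if_true, dif_neg,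
        not_false_eq_true, zero_mul, zero_add, if_false]
      rw [hB' ⟨(j, i), h1.le⟩ ⟨(l, k), h2.le⟩]
      simp [and_comm]

/-- The values of the tensor approximate the profile at regular sites. -/
theorem IsModel.abs_tensor_sub_le (h : IsModel K τ μ ψ C P x) {N : ℕ} {i j k l : Fin N}
    (hij : i ≤ j) (hkl : k ≤ l)
    (hr : IsRegularSite K ψ i j ((k : ℤ) - (i : ℤ)) ((l : ℤ) - (j : ℤ))) :
    |tensor (P N) (x N) i j k l - ψ (pos i) (pos j) ((k : ℤ) - (i : ℤ)) ((l : ℤ) - (j : ℤ))|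
      ≤ C / N := by
  rw [tensor, if_pos ⟨hij, hkl⟩]
  exact h.discretization N i j k l hij hkl hr

end Model

/-! ### Piecewise Lipschitz profiles and regular sites. -/

section Profile

/-- The finite set `S` contains the end points of the intervals of continuity of `ψ`, and `L k l`
is both a bound and a Lipschitz constant for `ψ(·,·,k,l)`. -/
structure IsGrid (ψ : ℝ → ℝ → ℤ → ℤ → ℝ) (S : Finset ℝ) (L : ℤ → ℤ → ℝ) : Prop where
  zero_mem : (0 : ℝ) ∈ S
  one_mem : (1 : ℝ) ∈ S
  nonneg : ∀ k l, 0 ≤ L k l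
  bound : ∀ θ ∈ Set.Ico (0 : ℝ) 1, ∀ φ ∈ Set.Ico (0 : ℝ) 1, ∀ k l, |ψ θ φ k l| ≤ L k l
  lipschitz : ∀ θ ∈ Set.Ico (0 : ℝ) 1, ∀ φ ∈ Set.Ico (0 : ℝ) 1, ∀ θ' ∈ Set.Ico (0 : ℝ) 1,
    ∀ φ' ∈ Set.Ico (0 : ℝ) 1, (∀ e ∈ S, |θ - θ'| < |θ - e|) → (∀ e ∈ S, |φ - φ'| < |φ - e|) →
    ∀ k l, |ψ θ φ k l - ψ θ' φ' k l| ≤ L k l * max |θ - θ'| |φ - φ'|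
  measurable : ∀ θ ∈ Set.Ico (0 : ℝ) 1, ∀ k l,
    AEStronglyMeasurable (fun φ => ψ θ φ k l) unitMeasure

/-- A point closer to `x ∈ I` than both end points of `I` lies strictly between them. This allows
the pieces to be replaced by distances to a finite set. -/
theorem mem_of_ordConnected {I : Set ℝ} (hI : I.OrdConnected) (hI01 : I ⊆ Set.Ico (0 : ℝ) 1)
    {x y : ℝ} (hx : x ∈ I) (h1 : |x - y| < |x - sInf I|) (h2 : |x - y| < |x - sSup I|) : y ∈ I := by
  have hbb : BddBelow I := ⟨0, fun t ht => (hI01 ht).1⟩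
  have hba : BddAbove I := ⟨1, fun t ht => (hI01 ht).2.le⟩
  have hi := csInf_le hbb hx
  have hs := le_csSup hba hx
  rw [abs_of_nonneg (sub_nonneg.2 hi)] at h1
  rw [abs_sub_comm x (sSup I), abs_of_nonneg (sub_nonneg.2 hs)] at h2
  have h3 : sInf I < y := by linarith [(abs_lt.1 h1).2, (abs_lt.1 h1).1]
  have h4 : y < sSup I := by linarith [(abs_lt.1 h2).2, (abs_lt.1 h2).1]
  obtain ⟨u, hu, huy⟩ := exists_lt_of_csInf_lt ⟨x, hx⟩ h3
  obtain ⟨v, hv, hyv⟩ := exists_lt_of_lt_csSup ⟨x, hx⟩ h4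
  exact hI.out hu hv ⟨huy.le, hyv.le⟩

theorem IsProfile.exists_isGrid {ψ : ℝ → ℝ → ℤ → ℤ → ℝ} (h : IsProfile ψ) :
    ∃ S L, IsGrid ψ S L := by
  classical
  obtain ⟨n, I, hI, -, hU, hL⟩ := h.piecewise_lipschitz
  choose L hL using hL
  have hsub : ∀ α, I α ⊆ Set.Ico (0 : ℝ) 1 := fun α => hU ▸ Set.subset_iUnion I α
  have hex : ∀ t ∈ Set.Ico (0 : ℝ) 1, ∃ α, t ∈ I α := fun t ht => by
    rw [← hU] at ht
    exact Set.mem_iUnion.1 ht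
  have hB : ∀ α β k l, ∃ b : ℝ, 0 ≤ b ∧ ∀ θ ∈ I α, ∀ φ ∈ I β, |ψ θ φ k l| ≤ b := by
    intro α β k l
    rcases (I α ×ˢ I β).eq_empty_or_nonempty with he | ⟨p, hp⟩
    · exact ⟨0, le_rfl, fun θ hθ φ hφ =>
        absurd (Set.mk_mem_prod hθ hφ) (he ▸ Set.notMem_empty _)⟩
    refine ⟨|ψ p.1 p.2 k l| + L α β k l, by positivity, fun θ hθ φ hφ => ?_⟩
    have h1 := (hL α β k l).dist_le_mul (θ, φ) ⟨hθ, hφ⟩ p hp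
    rw [Prod.dist_eq, Real.dist_eq, Real.dist_eq, Real.dist_eq] at h1
    have h2 : max |θ - p.1| |φ - p.2| ≤ 1 := by
      have a1 := hsub α hθ
      have a2 := hsub α hp.1
      have a3 := hsub β hφ
      have a4 := hsub β hp.2
      refine max_le (abs_le.2 ⟨?_, ?_⟩) (abs_le.2 ⟨?_, ?_⟩) <;>
        linarith [a1.1, a1.2, a2.1, a2.2, a3.1, a3.2, a4.1, a4.2]
    have h3 := mul_le_of_le_one_right (NNReal.coe_nonneg (L α β k l)) h2
    have h4 := abs_sub_abs_le_abs_sub (ψ θ φ k l) (ψ p.1 p.2 k l)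
    simp only at h1
    linarith
  choose b hb0 hb using hB
  refine ⟨insert 0 (insert 1 (Finset.univ.image (fun α => sInf (I α)) ∪
      Finset.univ.image fun α => sSup (I α))),
    fun k l => ∑ α, ∑ β, (b α β k l + L α β k l), ?_⟩
  have hle : ∀ α β k l, b α β k l + L α β k l ≤ ∑ α, ∑ β, (b α β k l + (L α β k l : ℝ)) := by
    intro α β k l
    have h1 : ∀ α β, 0 ≤ b α β k l + (L α β k l : ℝ) := fun α β =>
      add_nonneg (hb0 _ _ _ _) (NNReal.coe_nonneg _)
    refine (Finset.single_le_sum (f := fun β => b α β k l + (L α β k l : ℝ)) (fun β _ => h1 α β)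
      (Finset.mem_univ β)).trans ?_
    exact Finset.single_le_sum (f := fun α => ∑ β, (b α β k l + (L α β k l : ℝ)))
      (fun α _ => Finset.sum_nonneg fun β _ => h1 α β) (Finset.mem_univ α)
  refine ⟨by simp, by simp, fun k l => Finset.sum_nonneg fun α _ =>
    Finset.sum_nonneg fun β _ => add_nonneg (hb0 _ _ _ _) (NNReal.coe_nonneg _), ?_, ?_, ?_⟩
  · intro θ hθ φ hφ k l
    obtain ⟨α, hα⟩ := hex θ hθ
    obtain ⟨β, hβ⟩ := hex φ hφ
    exact (hb α β k l θ hα φ hβ).trans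
      ((le_add_of_nonneg_right (NNReal.coe_nonneg _)).trans (hle α β k l))
  · intro θ hθ φ hφ θ' hθ' φ' hφ' h1 h2 k l
    obtain ⟨α, hα⟩ := hex θ hθ
    obtain ⟨β, hβ⟩ := hex φ hφ
    have hα' : θ' ∈ I α := mem_of_ordConnected (hI α) (hsub α) hα (h1 _ (by simp)) (h1 _ (by simp))
    have hβ' : φ' ∈ I β := mem_of_ordConnected (hI β) (hsub β) hβ (h2 _ (by simp)) (h2 _ (by simp))
    have := (hL α β k l).dist_le_mul (θ, φ) ⟨hα, hβ⟩ (θ', φ') ⟨hα', hβ'⟩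
    rw [Prod.dist_eq, Real.dist_eq, Real.dist_eq, Real.dist_eq] at this
    refine this.trans (mul_le_mul_of_nonneg_right ?_ (le_max_of_le_left (abs_nonneg _)))
    exact (le_add_of_nonneg_left (hb0 _ _ _ _)).trans (hle α β k l)
  · intro θ hθ k l
    obtain ⟨α, hα⟩ := hex θ hθ
    rw [unitMeasure, ← hU, aestronglyMeasurable_iUnion_iff]
    intro β
    have hc : ContinuousOn (fun φ => ψ θ φ k l) (I β) :=
      (hL α β k l).continuousOn.comp (f := fun φ => (θ, φ)) (by fun_prop) fun φ hφ => ⟨hα, hφ⟩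
    exact hc.aestronglyMeasurable (hI β).measurableSet

variable {ψ : ℝ → ℝ → ℤ → ℤ → ℝ} {S : Finset ℝ} {L : ℤ → ℤ → ℝ}

theorem exists_dist_grid {t : ℝ} (ht : t ∉ S) : ∃ d > 0, ∀ e ∈ S, d < |t - e| := by
  have h1 : ∀ᶠ d in nhdsWithin (0 : ℝ) (Set.Ioi 0), ∀ e ∈ S, d < |t - e| := by
    refine (Finset.eventually_all S).2 fun e he => ?_
    have : 0 < |t - e| := abs_pos.2 (sub_ne_zero.2 fun hte => ht (hte ▸ he))
    exact (eventually_lt_nhds this).filter_mono nhdsWithin_le_nhds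
  obtain ⟨d, hd, hd0⟩ := (h1.and self_mem_nhdsWithin).exists
  exact ⟨d, hd0, hd⟩

theorem IsGrid.continuousWithinAt (h : IsGrid ψ S L) {p : ℝ × ℝ} (hp : p ∈ unitSquare)
    (h1 : p.1 ∉ S) (h2 : p.2 ∉ S) (k l : ℤ) :
    ContinuousWithinAt (fun q : ℝ × ℝ => ψ q.1 q.2 k l) unitSquare p := by
  obtain ⟨d1, hd1, hd1'⟩ := exists_dist_grid h1
  obtain ⟨d2, hd2, hd2'⟩ := exists_dist_grid h2
  rw [Metric.continuousWithinAt_iff]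
  intro ε hε
  refine ⟨min (min d1 d2) (ε / (L k l + 1)), lt_min (lt_min hd1 hd2)
    (div_pos hε (by linarith [h.nonneg k l])), fun q hq hd => ?_⟩
  rw [dist_comm, Real.dist_eq]
  rw [dist_comm, Prod.dist_eq, Real.dist_eq, Real.dist_eq] at hd
  obtain ⟨hd3, hd4⟩ := lt_min_iff.1 hd
  obtain ⟨hd5, hd6⟩ := lt_min_iff.1 hd3
  have := h.lipschitz p.1 hp.1 p.2 hp.2 q.1 hq.1 q.2 hq.2
    (fun e he => ((le_max_left _ _).trans_lt hd5).trans (hd1' e he))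
    (fun e he => ((le_max_right _ _).trans_lt hd6).trans (hd2' e he)) k l
  refine this.trans_lt ?_
  have h3 : max |p.1 - q.1| |p.2 - q.2| * (L k l + 1) < ε := by
    rwa [lt_div_iff₀ (by linarith [h.nonneg k l])] at hd4
  have : 0 ≤ max |p.1 - q.1| |p.2 - q.2| := le_max_of_le_left (abs_nonneg _)
  linarith

theorem pos_pos {N : ℕ} (i : Fin N) : 0 < pos i := by
  have : 0 < N := i.pos
  unfold pos
  positivity

theorem pos_le_one {N : ℕ} (i : Fin N) : pos i ≤ 1 := by
  have : (0 : ℝ) < N := by exact_mod_cast i.pos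
  rw [pos, div_le_one this]
  exact_mod_cast i.isLt

theorem IsGrid.pos_mem (h : IsGrid ψ S L) {N : ℕ} {i : Fin N} (hi : pos i ∉ S) :
    pos i ∈ Set.Ico (0 : ℝ) 1 :=
  ⟨(pos_pos i).le, lt_of_le_of_ne (pos_le_one i) fun h1 => hi (h1 ▸ h.one_mem)⟩

/-- Every discontinuity has a coordinate in `S`, so for the maximum distance it suffices that both
coordinates stay away from `S`. Membership of `1` in `S` keeps the site inside the half-open square.
-/
theorem IsGrid.isRegularSite (h : IsGrid ψ S L) {N K : ℕ} {i j : Fin N}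
    (hi : ∀ e ∈ S, (K : ℝ) / N < |pos i - e|) (hj : ∀ e ∈ S, (K : ℝ) / N < |pos j - e|) (a b : ℤ) :
    IsRegularSite K ψ i j a b := by
  have hnot : ∀ {i : Fin N}, (∀ e ∈ S, (K : ℝ) / N < |pos i - e|) → pos i ∉ S := by
    intro i hi hmem
    have := hi _ hmem
    rw [sub_self, abs_zero] at this
    exact absurd this (not_lt.2 (by positivity))
  refine ⟨⟨h.pos_mem (hnot hi), h.pos_mem (hnot hj)⟩, fun p hp hc => ?_⟩
  rw [Prod.dist_eq, Real.dist_eq, Real.dist_eq]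
  by_cases h1 : p.1 ∈ S
  · exact lt_max_of_lt_left (hi _ h1)
  by_cases h2 : p.2 ∈ S
  · exact lt_max_of_lt_right (hj _ h2)
  exact absurd (h.continuousWithinAt hp h1 h2 a b) hc

end Profile

/-! ### From the limiting function space to Toeplitz positivity. -/

section Fourier

open scoped ComplexConjugate

/-- Apply the convolution to the unit sequence, which lies in `ℓ²`. -/
theorem IsConvolver.memlp {a : ℤ → ℂ} (h : IsConvolver a) : Memℓp a 2 := by
  have hd : Memℓp (delta : ℤ → ℂ) 2 := memℓp_gen (by
    refine summable_of_hasFiniteSupport ((Set.finite_singleton (0 : ℤ)).subset fun k hk => ?_)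
    by_contra hk0
    exact hk (by simp [delta, show k ≠ 0 from hk0]))
  have h1 := (h delta hd).2
  have h2 : conv a delta = a := by
    funext n
    rw [conv, tsum_eq_single n]
    · simp [delta]
    · intro k hk
      simp [delta, sub_eq_zero, hk.symm]
  rwa [h2] at h1

theorem eq_integral_symbol {a : ℤ → ℂ} (h : Memℓp a 2) (k : ℤ) :
    a k = ∫ ζ, fourier (-k) ζ * symbol a ζ ∂(AddCircle.haarAddCircle : Measure UnitAddCircle) := by
  have h1 := fourierBasis_repr (T := (1 : ℝ)) (symbol a) k
  rw [symbol, dif_pos h, LinearIsometryEquiv.apply_symm_apply] at h1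
  rw [symbol, dif_pos h]
  exact h1

/-- A measurable bounded field of sequences whose Toeplitz matrices have nonnegative imaginary
part. -/
structure IsPosField (B : ℝ) (f : ℝ → ℤ → ℂ) : Prop where
  measurable : ∀ k, AEStronglyMeasurable (fun θ => f θ k) unitMeasure
  bound : ∀ᵐ θ ∂unitMeasure, ∀ k, ‖f θ k‖ ≤ B
  im_nonneg : ∀ᵐ θ ∂unitMeasure, ∀ (n : ℕ) (u : Fin n → ℂ),
    0 ≤ (∑ a : Fin n, ∑ b : Fin n, conj (u a) * f θ ((b : ℤ) - (a : ℤ)) * u b).im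

/-- The entries are Fourier coefficients of a bounded symbol. The Toeplitz form is the integral of
the symbol against the squared modulus of a trigonometric polynomial, so positivity of the imaginary
part carries over. -/
theorem MemTPlus.exists_isPosField {f : ℝ → ℤ → ℂ} (h : MemTPlus f) : ∃ B, IsPosField B f := by
  obtain ⟨⟨hm, hc, B, hB⟩, c, hc0, hpos⟩ := h
  refine ⟨B, hm, ?_, ?_⟩
  · filter_upwards [hc, hB] with θ hcθ hBθ k
    rw [eq_integral_symbol hcθ.memlp k]
    refine (norm_integral_le_of_norm_le_const (C := B) ?_).trans (by simp)
    filter_upwards [hBθ] with ζ hζ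
    rw [norm_mul, fourier_apply]
    rwa [Circle.norm_coe, one_mul]
  · filter_upwards [hc, hpos] with θ hcθ hpθ n u
    have hint : Integrable (symbol (f θ)) (AddCircle.haarAddCircle : Measure UnitAddCircle) :=
      (Lp.memLp _).integrable (by norm_num)
    have hint' : ∀ k : ℤ, Integrable (fun ζ => fourier (-k) ζ * symbol (f θ) ζ)
        (AddCircle.haarAddCircle : Measure UnitAddCircle) := by
      intro k
      refine hint.bdd_mul (c := 1) (fourier (-k)).continuous.aestronglyMeasurable
        (Filter.Eventually.of_forall fun ζ => ?_)
      rw [fourier_apply, Circle.norm_coe]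
    have e : ∑ a : Fin n, ∑ b : Fin n, conj (u a) * f θ ((b : ℤ) - (a : ℤ)) * u b
        = ∫ ζ, (∑ a : Fin n, ∑ b : Fin n, conj (u a) * (fourier (-((b : ℤ) - (a : ℤ))) ζ * symbol (f θ) ζ) * u b)
          ∂(AddCircle.haarAddCircle : Measure UnitAddCircle) := by
      rw [integral_finsetSum _ fun a _ => integrable_finsetSum _ fun b _ =>
        ((hint' _).const_mul _).mul_const _]
      refine Finset.sum_congr rfl fun a _ => ?_
      rw [integral_finsetSum _ fun b _ => ((hint' _).const_mul _).mul_const _]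
      refine Finset.sum_congr rfl fun b _ => ?_
      rw [integral_mul_const, integral_const_mul, ← eq_integral_symbol hcθ.memlp]
    rw [e]
    have hI : Integrable (fun ζ => ∑ a : Fin n, ∑ b : Fin n, conj (u a)
        * (fourier (-((b : ℤ) - (a : ℤ))) ζ * symbol (f θ) ζ) * u b)
        (AddCircle.haarAddCircle : Measure UnitAddCircle) :=
      integrable_finsetSum _ fun a _ => integrable_finsetSum _ fun b _ =>
        ((hint' _).const_mul _).mul_const _
    have him := Complex.imCLM.integral_comp_comm hI
    simp only [Complex.imCLM_apply] at him
    rw [← him]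
    refine integral_nonneg_of_ae ?_
    filter_upwards [hpθ] with ζ hζ
    have key : ∑ a : Fin n, ∑ b : Fin n, conj (u a) * (fourier (-((b : ℤ) - (a : ℤ))) ζ * symbol (f θ) ζ) * u b
        = ((Complex.normSq (∑ b : Fin n, fourier (-(b : ℤ)) ζ * u b) : ℝ) : ℂ) * symbol (f θ) ζ := by
      rw [Complex.normSq_eq_conj_mul_self, map_sum, Finset.sum_mul_sum, Finset.sum_mul]
      refine Finset.sum_congr rfl fun a _ => ?_
      rw [Finset.sum_mul]
      refine Finset.sum_congr rfl fun b _ => ?_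
      rw [map_mul, ← fourier_neg, neg_neg, neg_sub, sub_eq_add_neg, fourier_add]
      ring
    simp only [Pi.zero_apply]
    rw [key, Complex.im_ofReal_mul]
    exact mul_nonneg (Complex.normSq_nonneg _) (hc0.le.trans hζ)

end Fourier

/-! ### Block averages and quadrature. -/

section Blocks
open Matrix
open scoped ComplexConjugate

variable {N q : ℕ}

/-- The indicator function of the block of length `q` which contains `j`. -/
noncomputable def blockInd (q : ℕ) (j : Fin N) (φ : ℝ) : ℝ :=
  if ⌊(N : ℝ) * φ⌋₊ / q = (j : ℕ) / q then 1 else 0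

theorem blockInd_nonneg (j : Fin N) (φ : ℝ) : 0 ≤ blockInd q j φ := by
  unfold blockInd
  split_ifs <;> norm_num

theorem blockInd_le_one (j : Fin N) (φ : ℝ) : blockInd q j φ ≤ 1 := by
  unfold blockInd
  split_ifs <;> norm_num

theorem measurable_blockInd (j : Fin N) : Measurable (blockInd q j) := by
  unfold blockInd
  refine Measurable.ite ?_ measurable_const measurable_const
  have h1 : Measurable fun φ : ℝ => ⌊(N : ℝ) * φ⌋₊ / q :=
    (measurable_from_nat (f := fun n => n / q)).comp
      (Nat.measurable_floor.comp (measurable_const.mul measurable_id))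
  exact h1 (measurableSet_singleton _)

/-- The block diagonal matrix which averages the Toeplitz matrices of `f` over blocks of
length `q`. -/
noncomputable def blockAvg (N q : ℕ) (f : ℝ → ℤ → ℂ) : Matrix (Fin N) (Fin N) ℂ :=
  Matrix.of fun j l => ((N / q : ℝ) : ℂ) *
    ∫ φ, ((blockInd q j φ * blockInd q l φ : ℝ) : ℂ) * f φ ((l : ℤ) - (j : ℤ)) ∂unitMeasure

instance : IsProbabilityMeasure unitMeasure := ⟨by simp [unitMeasure]⟩

theorem ae_mem_Ico : ∀ᵐ φ ∂unitMeasure, φ ∈ Set.Ico (0 : ℝ) 1 :=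
  ae_restrict_mem measurableSet_Ico

variable {f : ℝ → ℤ → ℂ} {B : ℝ}

theorem IsPosField.nonneg (hf : IsPosField B f) : 0 ≤ B := by
  obtain ⟨φ, hφ⟩ := hf.bound.exists
  exact (norm_nonneg _).trans (hφ 0)

theorem IsPosField.integrable (hf : IsPosField B f) (k : ℤ) :
    Integrable (fun φ => f φ k) unitMeasure :=
  Integrable.of_bound (hf.measurable k) B (by filter_upwards [hf.bound] with φ hφ using hφ k)

theorem IsPosField.integrable_mul (hf : IsPosField B f) (k : ℤ) {g : ℝ → ℝ} {b : ℝ}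
    (hg : AEStronglyMeasurable g unitMeasure) (hb : ∀ φ ∈ Set.Ico (0 : ℝ) 1, |g φ| ≤ b) :
    Integrable (fun φ => (g φ : ℂ) * f φ k) unitMeasure := by
  refine (hf.integrable k).bdd_mul (c := b)
    (Complex.continuous_ofReal.comp_aestronglyMeasurable hg) ?_
  filter_upwards [ae_mem_Ico] with φ hφ
  rw [Complex.norm_real]
  exact hb φ hφ

theorem IsPosField.integrable_blockInd (hf : IsPosField B f) (j l : Fin N) (k : ℤ) :
    Integrable (fun φ => ((blockInd q j φ * blockInd q l φ : ℝ) : ℂ) * f φ k) unitMeasure := by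
  refine hf.integrable_mul k (b := 1)
    ((measurable_blockInd j).mul (measurable_blockInd l)).aestronglyMeasurable fun φ _ => ?_
  rw [abs_of_nonneg (mul_nonneg (blockInd_nonneg _ _) (blockInd_nonneg _ _))]
  exact mul_le_one₀ (blockInd_le_one _ _) (blockInd_nonneg _ _) (blockInd_le_one _ _)

theorem sum_mul_blockAvg (hf : IsPosField B f) (c : Fin N → Fin N → ℂ) :
    ∑ j, ∑ l, c j l * blockAvg N q f j l = ((N / q : ℝ) : ℂ) * ∫ φ, ∑ j, ∑ l,
      c j l * (((blockInd q j φ * blockInd q l φ : ℝ) : ℂ) * f φ ((l : ℤ) - (j : ℤ)))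
        ∂unitMeasure := by
  rw [integral_finsetSum _ fun j _ => integrable_finsetSum _ fun l _ =>
    (hf.integrable_blockInd j l _).const_mul _, Finset.mul_sum]
  refine Finset.sum_congr rfl fun j _ => ?_
  rw [integral_finsetSum _ fun l _ => (hf.integrable_blockInd j l _).const_mul _, Finset.mul_sum]
  refine Finset.sum_congr rfl fun l _ => ?_
  rw [integral_const_mul, blockAvg, of_apply]
  ring

/-- The matrix is an average over `φ` of Toeplitz matrices of `f φ` compressed to the block of `φ`,
and compression preserves a nonnegative imaginary part. -/
theorem im_qf_blockAvg_nonneg (hf : IsPosField B f) (x : Fin N → ℂ) :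
    0 ≤ (qf (blockAvg N q f) x x).im := by
  have h1 : qf (blockAvg N q f) x x
      = ∑ j, ∑ l, (conj (x j) * x l) * blockAvg N q f j l := by
    rw [qf, dotProduct]
    refine Finset.sum_congr rfl fun j _ => ?_
    rw [mulVec, dotProduct, Finset.mul_sum]
    refine Finset.sum_congr rfl fun l _ => ?_
    rw [Pi.star_apply, RCLike.star_def]
    ring
  rw [h1, sum_mul_blockAvg hf, Complex.im_ofReal_mul]
  refine mul_nonneg (by positivity) ?_
  have hI : Integrable (fun φ => ∑ j, ∑ l, (conj (x j) * x l) *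
      (((blockInd q j φ * blockInd q l φ : ℝ) : ℂ) * f φ ((l : ℤ) - (j : ℤ)))) unitMeasure :=
    integrable_finsetSum _ fun j _ => integrable_finsetSum _ fun l _ =>
    (hf.integrable_blockInd j l _).const_mul _
  have him := Complex.imCLM.integral_comp_comm hI
  simp only [Complex.imCLM_apply] at him
  rw [← him]
  refine integral_nonneg_of_ae ?_
  filter_upwards [hf.im_nonneg] with φ hφ
  have := hφ N fun j => blockInd q j φ * x j
  refine this.trans (le_of_eq (congrArg Complex.im ?_))
  refine Finset.sum_congr rfl fun j _ => Finset.sum_congr rfl fun l _ => ?_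
  rw [map_mul, Complex.conj_ofReal]
  push_cast
  ring

theorem abs_pos_sub_le {r : ℝ} (hq0 : 0 < q) (hq : (q : ℝ) + 1 ≤ r * N) {φ : ℝ} (hφ : 0 ≤ φ) {j : Fin N}
    (hj : blockInd q j φ ≠ 0) : |pos j - φ| ≤ r := by
  have hN : (0 : ℝ) < N := by exact_mod_cast j.pos
  unfold blockInd at hj
  have hj' : ⌊(N : ℝ) * φ⌋₊ / q = (j : ℕ) / q := by
    by_contra h
    exact hj (if_neg h)
  have h1 := Nat.div_add_mod ⌊(N : ℝ) * φ⌋₊ q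
  have h2 := Nat.div_add_mod (j : ℕ) q
  have h3 := Nat.mod_lt ⌊(N : ℝ) * φ⌋₊ hq0
  have h4 := Nat.mod_lt (j : ℕ) hq0
  rw [hj'] at h1
  have h5 : ⌊(N : ℝ) * φ⌋₊ + 1 ≤ (j : ℕ) + q := by omega
  have h6 : (j : ℕ) + 1 ≤ ⌊(N : ℝ) * φ⌋₊ + q := by omega
  have h5' : (⌊(N : ℝ) * φ⌋₊ : ℝ) + 1 ≤ (j : ℕ) + q := by exact_mod_cast h5
  have h6' : ((j : ℕ) : ℝ) + 1 ≤ ⌊(N : ℝ) * φ⌋₊ + q := by exact_mod_cast h6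
  have h7 := Nat.floor_le (mul_nonneg hN.le hφ)
  have h8 := Nat.lt_floor_add_one ((N : ℝ) * φ)
  have h9 : pos j * N = j + 1 := by rw [pos]; field_simp
  rw [abs_le]
  constructor
  · by_contra hlt
    push Not at hlt
    nlinarith
  · by_contra hlt
    push Not at hlt
    nlinarith

/-- The pairs of indices in the block of `φ` with difference `b`. -/
noncomputable def blockPairs (N q : ℕ) (φ : ℝ) (b : ℤ) : Finset (Fin N × Fin N) :=
  Finset.univ.filter fun s => ⌊(N : ℝ) * φ⌋₊ / q = (s.1 : ℕ) / q ∧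
    ⌊(N : ℝ) * φ⌋₊ / q = (s.2 : ℕ) / q ∧ (s.2 : ℤ) - (s.1 : ℤ) = b

theorem card_blockPairs_le (hq : 0 < q) (φ : ℝ) (b : ℤ) : (blockPairs N q φ b).card ≤ q := by
  set X := ⌊(N : ℝ) * φ⌋₊ / q
  have h1 : (blockPairs N q φ b).card ≤ (Finset.Ico (X * q) (X * q + q)).card := by
    refine Finset.card_le_card_of_injOn (fun s => (s.1 : ℕ)) ?_ ?_
    · intro s hs
      simp only [blockPairs, Finset.coe_filter, Finset.mem_univ, true_and, Set.mem_ofPred_eq] at hs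
      simp only [Finset.coe_Ico, Set.mem_Ico]
      have h2 := Nat.div_add_mod (s.1 : ℕ) q
      have h4 := Nat.mod_lt (s.1 : ℕ) hq
      have h5 : X = (s.1 : ℕ) / q := hs.1
      rw [← h5, mul_comm] at h2
      omega
    · intro s hs t ht hst
      simp only [blockPairs, Finset.coe_filter, Finset.mem_univ, true_and, Set.mem_ofPred_eq] at hs ht
      simp only at hst
      refine Prod.ext (Fin.ext hst) (Fin.ext ?_)
      omega
  simpa using h1

/-- A complete block, one not cut off at `N`, contains the pairs obtained by sliding two indices at
distance `|b|`; the order of the two depends on the sign of `b`. -/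
theorem le_card_blockPairs (hq : 0 < q) {φ : ℝ} (hφ : (⌊(N : ℝ) * φ⌋₊ / q + 1) * q ≤ N) (b : ℤ) :
    q - b.natAbs ≤ (blockPairs N q φ b).card := by
  set X := ⌊(N : ℝ) * φ⌋₊ / q with hX
  have hXq : X * q + q ≤ N := by rwa [add_mul, one_mul] at hφ
  have hdiv : ∀ t, t < q → (X * q + t) / q = X := by
    intro t ht
    rw [mul_comm, Nat.mul_add_div hq, Nat.div_eq_of_lt ht, add_zero]
  have h1 : (Finset.univ : Finset (Fin (q - b.natAbs))).card ≤ (blockPairs N q φ b).card := by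
    refine Finset.card_le_card_of_injOn (fun t =>
      (⟨X * q + (t + (-b).toNat), by have := t.isLt; omega⟩,
        ⟨X * q + (t + b.toNat), by have := t.isLt; omega⟩)) ?_ ?_
    · intro t _
      have ht := t.isLt
      simp only [blockPairs, Finset.coe_filter, Finset.mem_univ, true_and, Set.mem_ofPred_eq]
      rw [← hX, hdiv _ (by omega), hdiv _ (by omega)]
      refine ⟨rfl, rfl, ?_⟩
      push_cast
      omega
    · intro s _ t _ hst
      simp only [Prod.mk.injEq, Fin.mk.injEq] at hst
      exact Fin.ext (by omega)
  simpa using h1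

theorem sum_blockInd_eq (φ : ℝ) (b : ℤ) (c : Fin N → Fin N → ℝ) :
    ∑ j : Fin N, ∑ l : Fin N, (if (l : ℤ) - (j : ℤ) = b then c j l * (blockInd q j φ * blockInd q l φ) else 0)
      = ∑ s ∈ blockPairs N q φ b, c s.1 s.2 := by
  rw [blockPairs, Finset.sum_filter, Fintype.sum_prod_type]
  refine Finset.sum_congr rfl fun j _ => Finset.sum_congr rfl fun l _ => ?_
  unfold blockInd
  by_cases h1 : ⌊(N : ℝ) * φ⌋₊ / q = (j : ℕ) / q <;>
    by_cases h2 : ⌊(N : ℝ) * φ⌋₊ / q = (l : ℕ) / q <;>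
    by_cases h3 : (l : ℤ) - (j : ℤ) = b <;> simp [h1, h2, h3]

/-- The kernel of the functional `f ↦ N⁻¹ ∑ c_{jl} (blockAvg N q f)_{jl}`. -/
noncomputable def blockKernel (q : ℕ) (c : Fin N → Fin N → ℝ) (b : ℤ) (φ : ℝ) : ℝ :=
  1 / q * ∑ s ∈ blockPairs N q φ b, c s.1 s.2

theorem measurable_blockKernel (c : Fin N → Fin N → ℝ) (b : ℤ) :
    Measurable (blockKernel q c b) := by
  unfold blockKernel
  simp only [← sum_blockInd_eq]
  refine measurable_const.mul (Finset.measurable_fun_sum _ fun j _ =>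
    Finset.measurable_fun_sum _ fun l _ => ?_)
  split_ifs
  · exact measurable_const.mul ((measurable_blockInd j).mul (measurable_blockInd l))
  · exact measurable_const

theorem abs_blockKernel_le (hq : 0 < q) {c : Fin N → Fin N → ℝ} (hc : ∀ j l, |c j l| ≤ 1) (b : ℤ)
    (φ : ℝ) : |blockKernel q c b φ| ≤ 1 := by
  have hq' : (0 : ℝ) < q := by exact_mod_cast hq
  rw [blockKernel, abs_mul, abs_of_nonneg (by positivity : (0 : ℝ) ≤ 1 / q), one_div,
    inv_mul_le_iff₀ hq', mul_one]
  refine (Finset.abs_sum_le_sum_abs _ _).trans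
    ((Finset.sum_le_card_nsmul _ _ 1 fun s _ => hc _ _).trans ?_)
  rw [nsmul_eq_mul, mul_one]
  exact_mod_cast card_blockPairs_le hq φ b

/-- The kernel sums values near `g` with total weight between `1 - K / q` and `1`; the missing
weight costs `|g| K / q`. -/
theorem abs_blockKernel_sub_le (hq : 0 < q) {c : Fin N → Fin N → ℝ} {K : ℕ} {b : ℤ}
    (hb : b.natAbs ≤ K) {φ g η : ℝ} (hη : 0 ≤ η) (hφ : (⌊(N : ℝ) * φ⌋₊ / q + 1) * q ≤ N)
    (hc : ∀ s ∈ blockPairs N q φ b, |c s.1 s.2 - g| ≤ η) :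
    |blockKernel q c b φ - g| ≤ η + |g| * (K / q) := by
  have hq' : (0 : ℝ) < q := by exact_mod_cast hq
  have h1 : (blockPairs N q φ b).card ≤ (q : ℝ) := by exact_mod_cast card_blockPairs_le hq φ b
  have h2 : (q : ℝ) ≤ (blockPairs N q φ b).card + K := by
    have := le_card_blockPairs hq hφ b
    exact_mod_cast (show q ≤ (blockPairs N q φ b).card + K by omega)
  have e : blockKernel q c b φ - g = 1 / q * (∑ s ∈ blockPairs N q φ b, (c s.1 s.2 - g)
      - (q - (blockPairs N q φ b).card) * g) := by
    rw [blockKernel, Finset.sum_sub_distrib, Finset.sum_const, nsmul_eq_mul]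
    field_simp
    ring
  rw [e, abs_mul, abs_of_nonneg (by positivity : (0 : ℝ) ≤ 1 / q), one_div, inv_mul_le_iff₀ hq']
  have h3 : |∑ s ∈ blockPairs N q φ b, (c s.1 s.2 - g)| ≤ q * η := by
    refine (Finset.abs_sum_le_sum_abs _ _).trans ((Finset.sum_le_card_nsmul _ _ η hc).trans ?_)
    rw [nsmul_eq_mul]
    gcongr
  have h4 : |(q - (blockPairs N q φ b).card) * g| ≤ K * |g| := by
    rw [abs_mul, abs_of_nonneg (by linarith)]
    gcongr
    linarith
  have e2 : (q : ℝ) * (η + |g| * (K / q)) = q * η + K * |g| := by field_simp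
  rw [e2]
  exact (abs_sub _ _).trans (add_le_add h3 h4)

/-- The entry `(j, l)` of the block average only involves the coefficient `f φ (l - j)`. Grouping by
`b = l - j` leaves one integral kernel for each diagonal of the band, with normalization `N⁻¹ (N /
q) = 1 / q`. -/
theorem sum_mul_blockAvg_eq (hf : IsPosField B f) (hN : 0 < N) (hq : 0 < q) {K : ℕ}
    {c : Fin N → Fin N → ℝ} (hc1 : ∀ j l, |c j l| ≤ 1)
    (hc : ∀ j l : Fin N, (K : ℤ) < |(j : ℤ) - l| → c j l = 0) :
    (1 / (N : ℂ)) * ∑ j, ∑ l, (c j l : ℂ) * blockAvg N q f j l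
      = ∑ b ∈ Finset.Icc (-(K : ℤ)) K, ∫ φ, (blockKernel q c b φ : ℂ) * f φ b ∂unitMeasure := by
  have hN' : (N : ℂ) ≠ 0 := by exact_mod_cast hN.ne'
  have hq' : (q : ℂ) ≠ 0 := by exact_mod_cast hq.ne'
  rw [sum_mul_blockAvg hf fun j l => (c j l : ℂ), ← mul_assoc]
  have e1 : (1 / (N : ℂ)) * ((N / q : ℝ) : ℂ) = 1 / q := by
    push_cast
    field_simp
  rw [e1, ← integral_finsetSum _ fun b _ => hf.integrable_mul b (b := 1)
    (measurable_blockKernel c b).aestronglyMeasurable fun φ _ => abs_blockKernel_le hq hc1 b φ,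
    ← integral_const_mul]
  refine integral_congr_ae (Filter.Eventually.of_forall fun φ => ?_)
  simp only [blockKernel, ← sum_blockInd_eq]
  push_cast
  simp only [mul_assoc, Finset.sum_mul]
  rw [← Finset.mul_sum, Finset.sum_comm (s := Finset.Icc (-(K : ℤ)) K)]
  congr 1
  refine Finset.sum_congr rfl fun j _ => ?_
  rw [Finset.sum_comm (s := Finset.Icc (-(K : ℤ)) K)]
  refine Finset.sum_congr rfl fun l _ => ?_
  by_cases hjl : |(j : ℤ) - l| ≤ K
  · rw [Finset.sum_eq_single ((l : ℤ) - j)]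
    · rw [if_pos rfl]
      push_cast
      ring
    · intro b _ hb
      rw [if_neg hb.symm]
      simp
    · intro hn
      rw [abs_le] at hjl
      exact absurd (Finset.mem_Icc.2 ⟨by linarith [hjl.2], by linarith [hjl.1]⟩) hn
  · rw [hc j l (not_le.1 hjl)]
    simp

/-- The scale `q` of the blocks is large compared to `K` and small compared to `N`. -/
structure IsBlockScale (K : ℕ) (r : ℝ) (N q : ℕ) : Prop where
  pos : 0 < q
  le : (K : ℝ) ≤ r * q
  add_le : (q : ℝ) + K + 2 ≤ r * N

theorem IsBlockScale.N_pos {K : ℕ} {r : ℝ} (h : IsBlockScale K r N q) : 0 < N := by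
  rcases Nat.eq_zero_or_pos N with rfl | hN
  · have := h.add_le
    have h1 : (0 : ℝ) ≤ q := by positivity
    have h2 : (0 : ℝ) ≤ K := by positivity
    norm_num at this
    linarith
  · exact hN

theorem IsBlockScale.r_pos {K : ℕ} {r : ℝ} (h : IsBlockScale K r N q) : 0 < r := by
  have hN : (0 : ℝ) < N := by exact_mod_cast h.N_pos
  have h1 : (0 : ℝ) ≤ q := by positivity
  have h2 : (0 : ℝ) ≤ K := by positivity
  exact pos_of_mul_pos_left (by linarith [h.add_le]) hN.le

theorem exists_isBlockScale (K : ℕ) {r : ℝ} (hr : 0 < r) :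
    ∃ N₀ : ℕ, ∀ N, N₀ ≤ N → ∃ q, IsBlockScale K r N q := by
  obtain ⟨q, hq⟩ := exists_nat_gt (K / r)
  obtain ⟨N₀, hN₀⟩ := exists_nat_gt ((q + 1 + K + 2) / r)
  refine ⟨N₀, fun N hN => ⟨q + 1, by omega, ?_, ?_⟩⟩
  · rw [div_lt_iff₀ hr] at hq
    push_cast
    nlinarith
  · have : (N₀ : ℝ) ≤ N := by exact_mod_cast hN
    rw [div_lt_iff₀ hr] at hN₀
    push_cast
    nlinarith

theorem floor_div_add_one_mul_le {φ r : ℝ} (hφ : 0 ≤ φ) (hr : (q : ℝ) ≤ r * N) (h1 : φ + r ≤ 1) :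
    (⌊(N : ℝ) * φ⌋₊ / q + 1) * q ≤ N := by
  have h2 := Nat.floor_le (mul_nonneg (Nat.cast_nonneg N : (0 : ℝ) ≤ N) hφ)
  have h3 : ((⌊(N : ℝ) * φ⌋₊ + q : ℕ) : ℝ) ≤ N := by
    push_cast
    nlinarith [(Nat.cast_nonneg N : (0 : ℝ) ≤ N)]
  rw [add_mul, one_mul]
  exact (Nat.add_le_add_right (Nat.div_mul_le_self _ _) _).trans (by exact_mod_cast h3)

theorem integral_indicator_near_le (e : ℝ) {r : ℝ} (hr : 0 ≤ r) :
    ∫ φ, (Set.Icc (e - r) (e + r)).indicator (fun _ => (1 : ℝ)) φ ∂unitMeasure ≤ 2 * r := by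
  rw [integral_indicator_const _ measurableSet_Icc, smul_eq_mul, mul_one]
  calc unitMeasure.real (Set.Icc (e - r) (e + r)) ≤ volume.real (Set.Icc (e - r) (e + r)) :=
        ENNReal.toReal_mono measure_Icc_lt_top.ne (Measure.restrict_apply_le _ _)
    _ = 2 * r := by
        rw [Real.volume_real_Icc, max_eq_left (by linarith)]
        ring

/-- The quadrature estimate behind every comparison of `Ξ` with `Ψ`: if the coefficients `c` follow
`g` away from `T`, sums against the block average follow integrals of `g f`. The terms are the
pointwise error `η`, the weight defect `Bg * r` at the block ends, and the `6 r`-long intervals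
around the points of `T`. -/
theorem norm_sum_blockAvg_sub_le (hf : IsPosField B f) {K : ℕ} {r : ℝ} (hs : IsBlockScale K r N q)
    {c : Fin N → Fin N → ℝ} (hc1 : ∀ j l, |c j l| ≤ 1)
    (hc : ∀ j l : Fin N, (K : ℤ) < |(j : ℤ) - l| → c j l = 0) {T : Finset ℝ} (hT : 1 ∈ T)
    {g : ℤ → ℝ → ℝ} {Bg η : ℝ} (hη : 0 ≤ η) (hgm : ∀ b, AEStronglyMeasurable (g b) unitMeasure)
    (hg : ∀ b ∈ Finset.Icc (-(K : ℤ)) K, ∀ φ ∈ Set.Ico (0 : ℝ) 1, |g b φ| ≤ Bg)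
    (hcg : ∀ b ∈ Finset.Icc (-(K : ℤ)) K, ∀ φ ∈ Set.Ico (0 : ℝ) 1, (∀ e ∈ T, 3 * r < |φ - e|) →
      ∀ j l : Fin N, (l : ℤ) - j = b → |pos j - φ| ≤ r → |pos l - φ| ≤ r → |c j l - g b φ| ≤ η) :
    ‖(1 / (N : ℂ)) * ∑ j, ∑ l, (c j l : ℂ) * blockAvg N q f j l
      - ∑ b ∈ Finset.Icc (-(K : ℤ)) K, ∫ φ, (g b φ : ℂ) * f φ b ∂unitMeasure‖
      ≤ (2 * K + 1) * (B * (η + Bg * r + (1 + Bg) * (T.card * (6 * r)))) := by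
  have hr := hs.r_pos
  have hB := hf.nonneg
  have hBg : 0 ≤ Bg :=
    (abs_nonneg _).trans (hg 0 (by simp) 0 ⟨le_rfl, one_pos⟩)
  have hpt : ∀ b ∈ Finset.Icc (-(K : ℤ)) K, ∀ φ ∈ Set.Ico (0 : ℝ) 1,
      |blockKernel q c b φ - g b φ| ≤ η + Bg * r
        + (1 + Bg) * ∑ e ∈ T, (Set.Icc (e - 3 * r) (e + 3 * r)).indicator (fun _ => (1 : ℝ)) φ := by
    intro b hb φ hφ
    have hnn : ∀ e ∈ T, 0 ≤ (Set.Icc (e - 3 * r) (e + 3 * r)).indicator (fun _ => (1 : ℝ)) φ :=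
      fun e _ => Set.indicator_nonneg (fun _ _ => zero_le_one) _
    by_cases hfar : ∀ e ∈ T, 3 * r < |φ - e|
    -- Distance `3 r` from `1 ∈ T` makes the block of `φ` complete.
    · have hblock : (⌊(N : ℝ) * φ⌋₊ / q + 1) * q ≤ N := by
        refine floor_div_add_one_mul_le (r := r) hφ.1 (by
          have h2 : (0 : ℝ) ≤ K := by positivity
          linarith [hs.add_le]) ?_
        have := hfar 1 hT
        rw [abs_sub_comm, abs_of_pos (by linarith [hφ.2])] at this
        linarith
      have h1 := abs_blockKernel_sub_le (c := c) (K := K) (b := b) (g := g b φ) hs.pos (by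
        rw [Finset.mem_Icc] at hb
        omega) hη hblock fun s hs' => by
          simp only [blockPairs, Finset.mem_filter, Finset.mem_univ, true_and] at hs'
          have h2 : (0 : ℝ) ≤ K := by positivity
          refine hcg b hb φ hφ hfar _ _ hs'.2.2 ?_ ?_
          · refine abs_pos_sub_le (q := q) hs.pos (by linarith [hs.add_le]) hφ.1 ?_
            rw [blockInd, if_pos hs'.1]
            exact one_ne_zero
          · refine abs_pos_sub_le (q := q) hs.pos (by linarith [hs.add_le]) hφ.1 ?_
            rw [blockInd, if_pos hs'.2.1]
            exact one_ne_zero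
      have hKq : (K : ℝ) / q ≤ r := by
        rw [div_le_iff₀ (by exact_mod_cast hs.pos)]
        exact hs.le
      have h3 : |g b φ| * (K / q) ≤ Bg * r := mul_le_mul (hg b hb φ hφ) hKq (by positivity) hBg
      have h4 := mul_nonneg (by linarith : 0 ≤ 1 + Bg) (Finset.sum_nonneg hnn)
      linarith
    · push Not at hfar
      obtain ⟨e, he, hef⟩ := hfar
      have h1 : 1 ≤ ∑ e ∈ T, (Set.Icc (e - 3 * r) (e + 3 * r)).indicator (fun _ => (1 : ℝ)) φ := by
        refine le_trans (le_of_eq ?_) (Finset.single_le_sum hnn he)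
        rw [abs_le] at hef
        rw [Set.indicator_of_mem]
        exact ⟨by linarith [hef.1], by linarith [hef.2]⟩
      have h2 := abs_sub (blockKernel q c b φ) (g b φ)
      have h3 := abs_blockKernel_le hs.pos hc1 b φ
      have h4 := hg b hb φ hφ
      have h5 : 0 ≤ Bg * r := by positivity
      nlinarith
  rw [sum_mul_blockAvg_eq hf hs.N_pos hs.pos hc1 hc, ← Finset.sum_sub_distrib]
  refine (norm_sum_le_of_le (f := fun b => _) _ (n := fun _ => B * (η + Bg * r
    + (1 + Bg) * (T.card * (6 * r)))) fun b hb => ?_).trans (le_of_eq ?_)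
  · have hgi : Integrable (fun φ => (g b φ : ℂ) * f φ b) unitMeasure :=
      hf.integrable_mul b (hgm b) (hg b hb)
    have hki : Integrable (fun φ => (blockKernel q c b φ : ℂ) * f φ b) unitMeasure :=
      hf.integrable_mul b (b := 1) (measurable_blockKernel c b).aestronglyMeasurable
        fun φ _ => abs_blockKernel_le hs.pos hc1 b φ
    have hii : ∀ e, Integrable (fun φ =>
        (Set.Icc (e - 3 * r) (e + 3 * r)).indicator (fun _ => (1 : ℝ)) φ) unitMeasure :=
      fun e => (integrable_const 1).indicator measurableSet_Icc
    have hi := ((integrable_const (η + Bg * r)).add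
      ((integrable_finsetSum T fun e _ => hii e).const_mul (1 + Bg))).const_mul (μ := unitMeasure) B
    rw [← integral_sub hki hgi]
    refine (norm_integral_le_of_norm_le hi ?_).trans ?_
    · filter_upwards [ae_mem_Ico, hf.bound] with φ hφ hfφ
      rw [← sub_mul, norm_mul, ← Complex.ofReal_sub, Complex.norm_real, mul_comm]
      exact mul_le_mul (hfφ b) (hpt b hb φ hφ) (norm_nonneg _) hB
    · rw [integral_const_mul, integral_add' (integrable_const _)
        ((integrable_finsetSum T fun e _ => hii e).const_mul (1 + Bg)), integral_const_mul,
        integral_finsetSum _ fun e _ => hii e, integral_const, probReal_univ, one_smul]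
      gcongr
      refine (Finset.sum_le_card_nsmul _ _ (6 * r) fun e _ => ?_).trans (le_of_eq (nsmul_eq_mul _ _))
      refine (integral_indicator_near_le e (by positivity)).trans (le_of_eq (by ring))
  · rw [Finset.sum_const, Int.card_Icc, nsmul_eq_mul]
    congr 1
    have : ((K : ℤ) + 1 - -(K : ℤ)).toNat = 2 * K + 1 := by omega
    rw [this]
    push_cast
    ring

end Blocks

/-! ### Comparison of `Ξ` and `Ψ`. -/

section Limit
open Matrix
open scoped ComplexConjugate

/-- The tensor `ξ` discretizes the profile `ψ` with error `C / N`. -/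
def HasProfile (K : ℕ) (C : ℝ) (ψ : ℝ → ℝ → ℤ → ℤ → ℝ) {N : ℕ}
    (ξ : Fin N → Fin N → Fin N → Fin N → ℝ) : Prop :=
  ∀ i j k l : Fin N, i ≤ j → k ≤ l → IsRegularSite K ψ i j ((k : ℤ) - (i : ℤ)) ((l : ℤ) - (j : ℤ)) →
    |ξ i j k l - ψ (pos i) (pos j) ((k : ℤ) - (i : ℤ)) ((l : ℤ) - (j : ℤ))| ≤ C / N

theorem IsModel.hasProfile {K : ℕ} {τ : ℝ} {μ : ℕ → ℝ} {ψ : ℝ → ℝ → ℤ → ℤ → ℝ} {C : ℝ}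
    {Ω : ℕ → Type*} [∀ N, MeasurableSpace (Ω N)] {P : ∀ N, Measure (Ω N)}
    {x : ∀ N, Fin N → Fin N → Ω N → ℝ} (h : IsModel K τ μ ψ C P x) (N : ℕ) :
    HasProfile K C ψ (tensor (P N) (x N)) :=
  fun _ _ _ _ hij hkl hr => h.abs_tensor_sub_le hij hkl hr

/-- Away from the grid and the diagonal, `ψ(·,·,k,l)` vanishes if `|k| > K` or `|l| > K`. -/
def HasRange (K : ℕ) (ψ : ℝ → ℝ → ℤ → ℤ → ℝ) (S : Finset ℝ) : Prop :=
  ∀ θ ∈ Set.Ico (0 : ℝ) 1, ∀ φ ∈ Set.Ico (0 : ℝ) 1, θ ∉ S → φ ∉ S → θ ≠ φ →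
    ∀ a b : ℤ, (K : ℤ) < |a| ∨ (K : ℤ) < |b| → ψ θ φ a b = 0

variable {K N q : ℕ} {C c₀ B L₀ r : ℝ} {ψ : ℝ → ℝ → ℤ → ℤ → ℝ} {S : Finset ℝ} {L : ℤ → ℤ → ℝ}
  {f : ℝ → ℤ → ℂ} {ξ : Fin N → Fin N → Fin N → Fin N → ℝ}

theorem exists_index {θ : ℝ} (hθ : θ ∈ Set.Ico (0 : ℝ) 1) (hN : 0 < N) :
    ∃ i : Fin N, |pos i - θ| ≤ 1 / N := by
  have hN' : (0 : ℝ) < N := by exact_mod_cast hN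
  have h1 := Nat.floor_le (mul_nonneg hN'.le hθ.1)
  have h2 := Nat.lt_floor_add_one ((N : ℝ) * θ)
  have h3 : ⌊(N : ℝ) * θ⌋₊ < N := by
    rw [Nat.floor_lt (mul_nonneg hN'.le hθ.1)]
    nlinarith [hθ.2]
  refine ⟨⟨_, h3⟩, ?_⟩
  have e : pos (⟨_, h3⟩ : Fin N) - θ = ((⌊(N : ℝ) * θ⌋₊ + 1 : ℝ) - N * θ) / N := by
    rw [pos]
    field_simp
  rw [e, abs_div, abs_of_pos hN']
  gcongr
  rw [abs_le]
  constructor <;> linarith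

theorem pos_sub_pos (i j : Fin N) : pos j - pos i = (((j : ℤ) - (i : ℤ) : ℤ) : ℝ) / N := by
  rw [pos, pos]
  push_cast
  ring

theorem exists_shift {i : Fin N} {a : ℤ} (h1 : |(a : ℝ)| / N < |pos i - 0|)
    (h2 : |(a : ℝ)| / N < |pos i - 1|) : ∃ k : Fin N, (k : ℤ) - (i : ℤ) = a := by
  have hN' : (0 : ℝ) < N := by exact_mod_cast i.pos
  rw [sub_zero, abs_of_pos (pos_pos i), div_lt_iff₀ hN', pos, div_mul_cancel₀ _ hN'.ne'] at h1
  rw [abs_sub_comm, abs_of_nonneg (sub_nonneg.2 (pos_le_one i)), div_lt_iff₀ hN', sub_mul, pos,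
    div_mul_cancel₀ _ hN'.ne'] at h2
  have h1' : |a| < (i : ℤ) + 1 := by exact_mod_cast h1
  have h2' : |a| < 1 * (N : ℤ) - ((i : ℤ) + 1) := by exact_mod_cast h2
  have h3 := neg_abs_le a
  have h4 := le_abs_self a
  refine ⟨⟨((i : ℤ) + a).toNat, by omega⟩, ?_⟩
  simp only
  omega

/-- At index differences outside the band the tensors vanish, yet they approximate `ψ` with error `C
/ N` plus a Lipschitz error; let `N → ∞`. The two sides of the diagonal are exchanged by
`symm_swap`. -/
theorem hasRange_of_tensors (hψ : IsProfile ψ) (hS : IsGrid ψ S L)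
    (h : ∀ N : ℕ, ∃ ξ : Fin N → Fin N → Fin N → Fin N → ℝ,
      IsCovTensor K c₀ ξ ∧ HasProfile K C ψ ξ) : HasRange K ψ S := by
  have main : ∀ θ ∈ Set.Ico (0 : ℝ) 1, ∀ φ ∈ Set.Ico (0 : ℝ) 1, θ ∉ S → φ ∉ S → θ < φ →
      ∀ a b : ℤ, (K : ℤ) < |a| ∨ (K : ℤ) < |b| → ψ θ φ a b = 0 := by
    intro θ hθ φ hφ hθS hφS hlt a b hab
    obtain ⟨d1, hd1, hd1'⟩ := exists_dist_grid hθS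
    obtain ⟨d2, hd2, hd2'⟩ := exists_dist_grid hφS
    -- The third entry keeps both index pairs in the upper triangle, where the discretization is
    -- available.
    set d := min (min d1 d2) (φ - θ) with hd
    have hd0 : 0 < d := lt_min (lt_min hd1 hd2) (sub_pos.2 hlt)
    have hdθ : ∀ e ∈ S, d < |θ - e| := fun e he =>
      ((min_le_left _ _).trans (min_le_left _ _)).trans_lt (hd1' e he)
    have hdφ : ∀ e ∈ S, d < |φ - e| := fun e he =>
      ((min_le_left _ _).trans (min_le_right _ _)).trans_lt (hd2' e he)
    have hdd : d ≤ φ - θ := min_le_right _ _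
    obtain ⟨N₀, hN₀⟩ := exists_nat_gt (4 * (K + |(a : ℝ)| + |(b : ℝ)| + 1) / d)
    rw [div_lt_iff₀ hd0] at hN₀
    have hbound : ∀ n : ℕ, |ψ θ φ a b| ≤ (C + L a b) / ((N₀ + 1 + n : ℕ) : ℝ) := by
      intro n
      set M := N₀ + 1 + n with hM
      have hM0 : 0 < M := by omega
      have hM' : (0 : ℝ) < M := by exact_mod_cast hM0
      have hbig : 4 * (K + |(a : ℝ)| + |(b : ℝ)| + 1) < d * M := by
        have : (N₀ : ℝ) ≤ M := by exact_mod_cast (show N₀ ≤ M by omega)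
        nlinarith
      have hsmall : ∀ t : ℝ, t ≤ K + |(a : ℝ)| + |(b : ℝ)| + 1 → t / M < d / 4 := by
        intro t ht
        rw [div_lt_iff₀ hM']
        linarith
      have hK0 : (0 : ℝ) ≤ K := by positivity
      have ha0 := abs_nonneg (a : ℝ)
      have hb0 := abs_nonneg (b : ℝ)
      obtain ⟨ξ, hξ, hp⟩ := h M
      obtain ⟨i, hi⟩ := exists_index hθ hM0
      obtain ⟨j, hj⟩ := exists_index hφ hM0
      have h1M := hsmall 1 (by linarith)
      have hKM := hsmall K (by linarith)
      have haM := hsmall |(a : ℝ)| (by linarith)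
      have hbM := hsmall |(b : ℝ)| (by linarith)
      have hii : ∀ e ∈ S, d / 2 < |pos i - e| := by
        intro e he
        have h1 := hdθ e he
        have h2 := abs_sub_le θ (pos i) e
        rw [abs_sub_comm θ (pos i)] at h2
        linarith
      have hjj : ∀ e ∈ S, d / 2 < |pos j - e| := by
        intro e he
        have h1 := hdφ e he
        have h2 := abs_sub_le φ (pos j) e
        rw [abs_sub_comm φ (pos j)] at h2
        linarith
      obtain ⟨k, hk⟩ := exists_shift (i := i) (a := a)
        (by linarith [hii 0 hS.zero_mem]) (by linarith [hii 1 hS.one_mem])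
      obtain ⟨l, hl⟩ := exists_shift (i := j) (a := b)
        (by linarith [hjj 0 hS.zero_mem]) (by linarith [hjj 1 hS.one_mem])
      have hle : ∀ s t : Fin M, pos s ≤ pos t → s ≤ t := by
        intro s t hst
        rw [pos, pos, div_le_div_iff_of_pos_right hM'] at hst
        have : (s : ℕ) ≤ (t : ℕ) := by exact_mod_cast (by linarith : ((s : ℕ) : ℝ) ≤ (t : ℕ))
        exact this
      have hi' := abs_le.1 hi
      have hj' := abs_le.1 hj
      have hij : i ≤ j := hle _ _ (by linarith [hi'.1, hi'.2, hj'.1, hj'.2])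
      have hpk := pos_sub_pos i k
      have hpl := pos_sub_pos j l
      rw [hk] at hpk
      rw [hl] at hpl
      have hkl : k ≤ l := by
        refine hle _ _ ?_
        have h1 : (a : ℝ) / M ≤ |(a : ℝ)| / M := by gcongr; exact le_abs_self _
        have h2 : -(|(b : ℝ)| / M) ≤ (b : ℝ) / M := by
          rw [← neg_div]; gcongr; exact neg_abs_le _
        linarith [hi'.1, hi'.2, hj'.1, hj'.2]
      have hreg := hS.isRegularSite (K := K) (i := i) (j := j)
        (fun e he => by linarith [hii e he]) (fun e he => by linarith [hjj e he]) a b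
      have h1 := hp i j k l hij hkl (by rw [hk, hl]; exact hreg)
      rw [hk, hl, hξ.band i j k l (by
        rw [abs_sub_comm, hk, abs_sub_comm (j : ℤ), hl]; exact hab), zero_sub, abs_neg] at h1
      have hl1 := hS.lipschitz θ hθ φ hφ _ hreg.1.1 _ hreg.1.2
        (fun e he => by rw [abs_sub_comm]; linarith [hdθ e he])
        (fun e he => by rw [abs_sub_comm]; linarith [hdφ e he]) a b
      rw [abs_sub_comm θ, abs_sub_comm φ] at hl1
      have hl2 : L a b * max |pos i - θ| |pos j - φ| ≤ L a b * (1 / M) :=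
        mul_le_mul_of_nonneg_left (max_le hi hj) (hS.nonneg a b)
      have h2 := abs_sub_abs_le_abs_sub (ψ θ φ a b) (ψ (pos i) (pos j) a b)
      have e : (C + L a b) / (M : ℝ) = C / M + L a b * (1 / M) := by ring
      rw [e]
      linarith
    have hlim : Filter.Tendsto (fun n : ℕ => (C + L a b) / ((N₀ + 1 + n : ℕ) : ℝ)) Filter.atTop
        (nhds 0) := by
      refine Filter.Tendsto.div_atTop tendsto_const_nhds ?_
      refine tendsto_natCast_atTop_atTop.comp ?_
      exact Filter.tendsto_atTop_mono (fun n => Nat.le_add_left n _) Filter.tendsto_id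
    have := ge_of_tendsto' hlim hbound
    exact abs_nonpos_iff.1 this
  intro θ hθ φ hφ hθS hφS hne a b hab
  rcases lt_or_gt_of_ne hne with hlt | hlt
  · exact main θ hθ φ hφ hθS hφS hlt a b hab
  · rw [hψ.symm_swap θ hθ φ hφ]
    exact main φ hφ θ hθ hφS hθS hlt b a hab.symm

/-- The part of `Ψ(f)(θ,k)` with `|l| ≤ K`. -/
noncomputable def PsiBand (K : ℕ) (ψ : ℝ → ℝ → ℤ → ℤ → ℝ) (f : ℝ → ℤ → ℂ) (θ : ℝ) (k : ℤ) : ℂ :=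
  ∑ b ∈ Finset.Icc (-(K : ℤ)) K, ∫ φ, (ψ θ φ k b : ℂ) * f φ b ∂unitMeasure

theorem ae_notMem_finset (S : Finset ℝ) : ∀ᵐ φ ∂unitMeasure, φ ∉ S :=
  ae_restrict_of_ae (S.finite_toSet.countable.ae_notMem _)

theorem HasRange.integral_eq_zero (hR : HasRange K ψ S) {θ : ℝ} (hθ : θ ∈ Set.Ico (0 : ℝ) 1)
    (hθS : θ ∉ S) {a b : ℤ} (hab : (K : ℤ) < |a| ∨ (K : ℤ) < |b|) :
    ∫ φ, (ψ θ φ a b : ℂ) * f φ b ∂unitMeasure = 0 := by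
  refine integral_eq_zero_of_ae ?_
  filter_upwards [ae_mem_Ico, ae_notMem_finset S, ae_notMem_finset {θ}] with φ h1 h2 h3
  rw [hR θ hθ φ h1 hθS h2 (fun h => h3 (by simp [h])) a b hab]
  simp

theorem HasRange.Psi_eq (hR : HasRange K ψ S) {θ : ℝ} (hθ : θ ∈ Set.Ico (0 : ℝ) 1)
    (hθS : θ ∉ S) (k : ℤ) : Psi ψ f θ k = PsiBand K ψ f θ k := by
  rw [Psi, PsiBand, tsum_eq_sum]
  intro b hb
  refine hR.integral_eq_zero hθ hθS (Or.inr ?_)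
  by_contra hle
  exact hb (Finset.mem_Icc.2 (abs_le.1 (not_lt.1 hle)))

theorem HasRange.PsiBand_eq_zero (hR : HasRange K ψ S) {θ : ℝ} (hθ : θ ∈ Set.Ico (0 : ℝ) 1)
    (hθS : θ ∉ S) {k : ℤ} (hk : (K : ℤ) < |k|) : PsiBand K ψ f θ k = 0 :=
  Finset.sum_eq_zero fun _ _ => hR.integral_eq_zero hθ hθS (Or.inl hk)

/-- The numerical constant in the comparison of `Ξ` and `Ψ`. -/
noncomputable def xiConst (K : ℕ) (C L₀ : ℝ) (n : ℕ) : ℝ :=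
  (2 * K + 1) * (|C| + 2 * L₀ + (1 + L₀) * ((n + 1) * 6))

/-- Quadrature with `c j l = ξ i j k l` and `g b φ = ψ θ φ (k - i) b`: the discretization error and
the Lipschitz error between `(pos i, pos j)` and `(θ, φ)` are both `O(r)`. -/
theorem norm_Xi_blockAvg_sub_le (hψ : IsProfile ψ) (hS : IsGrid ψ S L) (hξ : IsCovTensor K c₀ ξ)
    (hp : HasProfile K C ψ ξ) (hf : IsPosField B f) (hs : IsBlockScale K r N q)
    (hL : ∀ k ∈ Finset.Icc (-(K : ℤ)) K, ∀ l ∈ Finset.Icc (-(K : ℤ)) K, L k l ≤ L₀)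
    {i k : Fin N} (hi : ∀ e ∈ S, 3 * r < |pos i - e|) {θ : ℝ} (hθ : θ ∈ Set.Ico (0 : ℝ) 1)
    (hiθ : |pos i - θ| ≤ r) (hik : |(i : ℤ) - k| ≤ K) :
    ‖Xi ξ (blockAvg N q f) i k - PsiBand K ψ f θ ((k : ℤ) - i)‖
      ≤ xiConst K C L₀ S.card * B * r := by
  classical
  have hr := hs.r_pos
  have hB := hf.nonneg
  have hN' : (0 : ℝ) < N := by exact_mod_cast hs.N_pos
  have hKm : ((k : ℤ) - (i : ℤ)) ∈ Finset.Icc (-(K : ℤ)) K := by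
    rw [abs_sub_comm] at hik
    exact Finset.mem_Icc.2 (abs_le.1 hik)
  have h0m : (0 : ℤ) ∈ Finset.Icc (-(K : ℤ)) K := by simp
  have hL₀ : 0 ≤ L₀ := (hS.nonneg 0 0).trans (hL 0 h0m 0 h0m)
  have h1N : 1 / (N : ℝ) ≤ r := by
    rw [div_le_iff₀ hN']
    have : (0 : ℝ) ≤ q := by positivity
    have : (0 : ℝ) ≤ K := by positivity
    linarith [hs.add_le]
  have hKN : (K : ℝ) / N ≤ r := by
    rw [div_le_iff₀ hN']
    have : (0 : ℝ) ≤ q := by positivity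
    linarith [hs.add_le]
  have hlt : ∀ s t : Fin N, pos s < pos t → s < t := by
    intro s t hst
    rw [pos, pos, div_lt_div_iff_of_pos_right hN'] at hst
    have : (s : ℕ) < (t : ℕ) := by exact_mod_cast (by linarith : ((s : ℕ) : ℝ) < (t : ℕ))
    exact this
  have hpk : |pos k - pos i| ≤ r := by
    rw [pos_sub_pos, abs_div, abs_of_pos hN']
    refine le_trans ?_ hKN
    gcongr
    rw [abs_sub_comm] at hik
    exact_mod_cast hik
  have hpi : pos i ∈ Set.Ico (0 : ℝ) 1 := hS.pos_mem fun hmem => by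
    have := hi _ hmem
    rw [sub_self, abs_zero] at this
    linarith
  -- Inserting `θ` discards a strip around the diagonal, so that `(i, j)` and `(k, l)` lie on the
  -- same side of it.
  have key := norm_sum_blockAvg_sub_le hf hs (c := fun j l => ξ i j k l) (T := insert θ S)
    (g := fun b φ => ψ θ φ ((k : ℤ) - i) b) (Bg := L₀) (η := |C| * r + L₀ * r)
    (fun j l => hξ.bound i j k l) (fun j l hjl => hξ.band i j k l (Or.inr hjl))
    (Finset.mem_insert_of_mem hS.one_mem) (by positivity) (fun b => hS.measurable θ hθ _ b)
    (fun b hb φ hφ => (hS.bound θ hθ φ hφ _ _).trans (hL _ hKm b hb)) ?_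
  · rw [Xi_apply, PsiBand]
    refine key.trans ?_
    have hcard : ((insert θ S).card : ℝ) ≤ S.card + 1 := by exact_mod_cast Finset.card_insert_le θ S
    calc (2 * K + 1) * (B * (|C| * r + L₀ * r + L₀ * r + (1 + L₀) * ((insert θ S).card * (6 * r))))
        ≤ (2 * K + 1) * (B * (|C| * r + L₀ * r + L₀ * r + (1 + L₀) * ((S.card + 1) * (6 * r)))) := by
          gcongr
      _ = _ := by rw [xiConst]; ring
  · intro b hb φ hφ hfar j l hjl hj hl
    have hθφ := hfar θ (Finset.mem_insert_self _ _)
    have hjS : ∀ e ∈ S, 2 * r < |pos j - e| := by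
      intro e he
      have h1 := hfar e (Finset.mem_insert_of_mem he)
      have h2 := abs_sub_le φ (pos j) e
      rw [abs_sub_comm φ (pos j)] at h2
      linarith
    have hpj : pos j ∈ Set.Ico (0 : ℝ) 1 := hS.pos_mem fun hmem => by
      have := hjS _ hmem
      rw [sub_self, abs_zero] at this
      linarith
    have hψ1 : |ψ (pos i) (pos j) ((k : ℤ) - i) b - ψ θ φ ((k : ℤ) - i) b| ≤ L₀ * r := by
      refine (hS.lipschitz _ hpi _ hpj _ hθ _ hφ (fun e he => by linarith [hi e he])
        (fun e he => by linarith [hjS e he]) _ _).trans ?_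
      exact mul_le_mul (hL _ hKm b hb) (max_le hiθ hj) (le_max_of_le_left (abs_nonneg _)) hL₀
    have hCr : C / N ≤ |C| * r := by
      have : C / N ≤ |C| * (1 / N) := by
        rw [mul_one_div]
        gcongr
        exact le_abs_self C
      exact this.trans (by gcongr)
    have hiθ' := abs_le.1 hiθ
    have hj' := abs_le.1 hj
    have hl' := abs_le.1 hl
    have hpk' := abs_le.1 hpk
    have hξψ : |ξ i j k l - ψ (pos i) (pos j) ((k : ℤ) - i) b| ≤ |C| * r := by
      rw [← hjl]
      rcases lt_or_ge θ φ with hlt1 | hge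
      · rw [abs_of_pos (by linarith)] at hθφ
        refine (hp i j k l (hlt _ _ (by linarith [hiθ'.1, hj'.1, hiθ'.2])).le
          (hlt _ _ (by linarith [hiθ'.1, hl'.1, hiθ'.2, hpk'.2])).le
          (hS.isRegularSite (fun e he => by linarith [hi e he])
            (fun e he => by linarith [hjS e he]) _ _)).trans hCr
      -- Below the diagonal the discretization is applied after reflecting both the tensor and the
      -- profile.
      · rw [abs_of_nonpos (by linarith)] at hθφ
        have h1 : j < i := hlt _ _ (by linarith [hiθ'.1, hj'.1, hiθ'.2, hj'.2])
        have h2 : l < k := hlt _ _ (by linarith [hiθ'.1, hl'.1, hiθ'.2, hpk'.2, hl'.2, hpk'.1])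
        rw [hξ.swap i j k l h1.ne' h2.ne', hψ.symm_swap _ hpi _ hpj]
        exact (hp j i l k h1.le h2.le (hS.isRegularSite (fun e he => by linarith [hjS e he])
            (fun e he => by linarith [hi e he]) _ _)).trans hCr
    exact (abs_sub_le _ _ _).trans (add_le_add hξψ hψ1)

/-- Quadrature with the coefficients of the identity matrix. Only the incomplete last block needs
excluding, so `T = {1}`; the constant is `13 = 1 + (1 + 1) * 6`. -/
theorem norm_trace_blockAvg_sub_le (hf : IsPosField B f) (hs : IsBlockScale K r N q) :
    ‖(1 / (N : ℂ)) * (blockAvg N q f).trace - ∫ φ, f φ 0 ∂unitMeasure‖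
      ≤ (2 * K + 1) * 13 * B * r := by
  have hr := hs.r_pos
  have key := norm_sum_blockAvg_sub_le hf hs (c := fun j l => if j = l then 1 else 0) (T := {1})
    (g := fun b _ => if b = 0 then 1 else 0) (Bg := 1) (η := 0)
    (fun j l => by split_ifs <;> simp) (fun j l hjl => by
      rw [if_neg]
      rintro rfl
      rw [sub_self, abs_zero] at hjl
      omega) (Finset.mem_singleton_self _) le_rfl (fun b => aestronglyMeasurable_const)
    (fun b hb φ hφ => by split_ifs <;> simp) (fun b hb φ hφ _ j l hjl _ _ => by
      have : (j = l) ↔ b = 0 := by rw [← hjl, Fin.ext_iff]; omega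
      simp [this])
  have e1 : ∑ j : Fin N, ∑ l : Fin N, (((if j = l then 1 else 0 : ℝ)) : ℂ) * blockAvg N q f j l
      = (blockAvg N q f).trace := by
    rw [trace]
    refine Finset.sum_congr rfl fun j _ => ?_
    rw [Finset.sum_eq_single j (fun l _ hl => by simp [hl.symm]) (by simp)]
    simp
  have e2 : ∑ b ∈ Finset.Icc (-(K : ℤ)) K, ∫ φ, (((if b = 0 then 1 else 0 : ℝ)) : ℂ) * f φ b
      ∂unitMeasure = ∫ φ, f φ 0 ∂unitMeasure := by
    rw [Finset.sum_eq_single 0 (fun b _ hb => by simp [hb]) (by simp)]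
    simp
  rw [e1, e2] at key
  refine key.trans (le_of_eq ?_)
  rw [Finset.card_singleton]
  push_cast
  ring

theorem trace_blockAvg_ge {ω : ℝ} (hf : IsPosField B f) (hs : IsBlockScale K r N q)
    (htr : ω ≤ (∫ φ, f φ 0 ∂unitMeasure).im) :
    (ω - (2 * K + 1) * 13 * B * r) * N ≤ (blockAvg N q f).trace.im := by
  have hN' : (0 : ℝ) < N := by exact_mod_cast hs.N_pos
  have h1 := (Complex.abs_im_le_norm _).trans (norm_trace_blockAvg_sub_le hf hs)
  rw [Complex.sub_im] at h1
  have e1 : (1 / (N : ℂ) * (blockAvg N q f).trace).im = (blockAvg N q f).trace.im / N := by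
    have : (1 / (N : ℂ)) = ((1 / N : ℝ) : ℂ) := by push_cast; rfl
    rw [this, Complex.im_ofReal_mul]
    ring
  rw [e1] at h1
  have h2 := (abs_le.1 h1).1
  rw [← le_div_iff₀ hN']
  linarith

end Limit

/-! ### Coercivity in the limit and the `ℓ²` bound. -/

section Coercivity
open Matrix
open scoped ComplexConjugate Matrix.Norms.L2Operator

variable {K : ℕ} {C c₀ B L₀ : ℝ} {ψ : ℝ → ℝ → ℤ → ℤ → ℝ} {S : Finset ℝ} {L : ℤ → ℤ → ℝ}
  {f : ℝ → ℤ → ℂ}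

theorem le_of_forall_small {a b c r₀ : ℝ} (hr₀ : 0 < r₀)
    (h : ∀ r, 0 < r → r < r₀ → a ≤ b + c * r) : a ≤ b := by
  have h1 : Filter.Tendsto (fun r : ℝ => b + c * r) (nhdsWithin 0 (Set.Ioi 0)) (nhds b) := by
    have : Filter.Tendsto (fun r : ℝ => b + c * r) (nhds 0) (nhds (b + c * 0)) :=
      Continuous.tendsto (by fun_prop) 0
    rw [mul_zero, add_zero] at this
    exact this.mono_left nhdsWithin_le_nhds
  refine ge_of_tendsto h1 ?_
  filter_upwards [Ioo_mem_nhdsGT hr₀] with r hr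
  exact h r hr.1 hr.2

theorem IsCovTensor.im_qf_Xi_ge {N : ℕ} {ξ : Fin N → Fin N → Fin N → Fin N → ℝ}
    (hξ : IsCovTensor K c₀ ξ) (hc₀ : 0 ≤ c₀) {A : Matrix (Fin N) (Fin N) ℂ} {ω : ℝ}
    (hA : ∀ x, 0 ≤ (qf A x x).im) (htr : ω * N ≤ A.trace.im) (x : Fin N → ℂ) :
    c₀ * ω * vecNorm x ^ 2 ≤ (qf (Xi ξ A) x x).im := by
  have hΦ := hξ.isSelfEnergy hc₀
  have h1 := flat_lower hc₀ hΦ.twoPos' hA (by rwa [Fintype.card_fin]) x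
  rw [hΦ.map_imPart, qf_imPart, Complex.ofReal_re] at h1
  exact h1

theorem qf_extend {ι : Type*} [Fintype ι] {N : ℕ} {e : ι → Fin N} (he : Function.Injective e)
    (u : ι → ℂ) (A : Matrix (Fin N) (Fin N) ℂ) :
    qf A (Function.extend e u 0) (Function.extend e u 0)
      = ∑ a, ∑ b, conj (u a) * A (e a) (e b) * u b := by
  rw [qf, dotProduct]
  symm
  refine Fintype.sum_of_injective e he _ _ (fun i hi => ?_) fun a => ?_
  · rw [Pi.star_apply, Function.extend_apply' _ _ _ hi]
    simp
  · rw [Pi.star_apply, he.extend_apply, mulVec, dotProduct, Finset.mul_sum]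
    refine Fintype.sum_of_injective e he _ _ (fun i hi => ?_) fun b => ?_
    · rw [Function.extend_apply' _ _ _ hi]
      simp
    · rw [he.extend_apply, RCLike.star_def]
      ring

theorem vecNorm_extend_sq {ι : Type*} [Fintype ι] {N : ℕ} {e : ι → Fin N}
    (he : Function.Injective e) (u : ι → ℂ) :
    vecNorm (Function.extend e u 0) ^ 2 = ∑ a, ‖u a‖ ^ 2 := by
  rw [vecNorm_sq]
  symm
  refine Fintype.sum_of_injective e he _ _ (fun i hi => ?_) fun a => ?_
  · rw [Function.extend_apply' _ _ _ hi]
    simp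
  · rw [he.extend_apply]

/-- Flatness passes to the limit. The bound `Im Ξ(A) ≥ c₀ ⟨Im A⟩` for the block average `A` is
tested on `u` transplanted to the indices near `N θ`; there `Ξ(A)` is close to the Toeplitz matrix
of `PsiBand` at `θ`, and all errors are linear in `r → 0`. -/
theorem PsiBand_coercive (hψ : IsProfile ψ) (hS : IsGrid ψ S L) (hc₀ : 0 ≤ c₀)
    (h : ∀ N : ℕ, ∃ ξ : Fin N → Fin N → Fin N → Fin N → ℝ,
      IsCovTensor K c₀ ξ ∧ HasProfile K C ψ ξ) (hR : HasRange K ψ S)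
    (hL : ∀ k ∈ Finset.Icc (-(K : ℤ)) K, ∀ l ∈ Finset.Icc (-(K : ℤ)) K, L k l ≤ L₀)
    (hf : IsPosField B f) {θ : ℝ} (hθ : θ ∈ Set.Ico (0 : ℝ) 1) (hθS : θ ∉ S)
    (s : Finset ℤ) (u : ℤ → ℂ) :
    c₀ * (∫ φ, f φ 0 ∂unitMeasure).im * ∑ a ∈ s, ‖u a‖ ^ 2
      ≤ (∑ a ∈ s, ∑ b ∈ s, conj (u a) * PsiBand K ψ f θ (b - a) * u b).im := by
  obtain ⟨d, hd, hdS⟩ := exists_dist_grid hθS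
  set T := (∫ φ, f φ 0 ∂unitMeasure).im with hT
  set U := ∑ a ∈ s, ‖u a‖ ^ 2 with hU
  set V := ∑ a ∈ s, ∑ b ∈ s, ‖u a‖ * ‖u b‖ with hV
  set c1 := (2 * K + 1) * 13 * B with hc1
  set c2 := xiConst K C L₀ S.card * B with hc2
  have hU0 : 0 ≤ U := Finset.sum_nonneg fun _ _ => by positivity
  refine le_of_forall_small (c := c2 * V + c₀ * c1 * U) (r₀ := d / 4) (by positivity)
    fun r hr hrd => ?_
  -- Treating `K + A` as the range keeps all transplanted indices `i + a`, `a ∈ s`, within `r` of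
  -- `θ`.
  set A := s.sup Int.natAbs with hA
  obtain ⟨N, hN⟩ := exists_isBlockScale (K + A) hr
  obtain ⟨q, hq⟩ := hN N le_rfl
  have hs : IsBlockScale K r N q := by
    refine ⟨hq.pos, ?_, ?_⟩
    · have := hq.le
      push_cast at this
      linarith [(Nat.cast_nonneg A : (0 : ℝ) ≤ A)]
    · have := hq.add_le
      push_cast at this
      linarith [(Nat.cast_nonneg A : (0 : ℝ) ≤ A)]
  have hN' : (0 : ℝ) < N := by exact_mod_cast hs.N_pos
  obtain ⟨ξ, hξ, hp⟩ := h N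
  obtain ⟨i, hi⟩ := exists_index hθ hs.N_pos
  have hAN : ((A : ℝ) + 1) / N ≤ r := by
    rw [div_le_iff₀ hN']
    have := hq.add_le
    push_cast at this
    linarith [(Nat.cast_nonneg K : (0 : ℝ) ≤ K), (Nat.cast_nonneg q : (0 : ℝ) ≤ q)]
  have hAN' : (A : ℝ) / N + 1 / N ≤ r := by rwa [← add_div]
  have h1N : 0 < 1 / (N : ℝ) := by positivity
  have hsA : ∀ a ∈ s, |(a : ℝ)| / N ≤ A / N := by
    intro a ha
    have h1 : a.natAbs ≤ A := Finset.le_sup (f := Int.natAbs) ha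
    have h2 : |(a : ℝ)| = (a.natAbs : ℝ) := by
      rw [← Int.cast_abs, Int.abs_eq_natAbs]
      simp
    rw [h2]
    gcongr
  have hifar : ∀ e ∈ S, r < |pos i - e| := by
    intro e he
    have h1 := hdS e he
    have h2 := abs_sub_le θ (pos i) e
    rw [abs_sub_comm θ (pos i)] at h2
    have h3 : 0 ≤ (A : ℝ) / N := by positivity
    linarith
  have hsh : ∀ a : s, ∃ k : Fin N, (k : ℤ) - (i : ℤ) = a := fun a =>
    exists_shift (by linarith [hsA a a.2, hifar 0 hS.zero_mem])
      (by linarith [hsA a a.2, hifar 1 hS.one_mem])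
  choose e he using hsh
  have hinj : Function.Injective e := by
    intro a b hab
    have h1 := he a
    rw [hab, he b] at h1
    exact Subtype.ext h1.symm
  have hclose : ∀ a : s, |pos (e a) - θ| ≤ r := by
    intro a
    have h1 : |pos (e a) - pos i| ≤ A / N := by
      rw [pos_sub_pos, he, abs_div, abs_of_pos hN']
      exact hsA a a.2
    have := abs_sub_le (pos (e a)) (pos i) θ
    linarith
  have hfar : ∀ a : s, ∀ t ∈ S, 3 * r < |pos (e a) - t| := by
    intro a t ht
    have h1 := hdS t ht
    have h2 := abs_sub_le θ (pos (e a)) t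
    rw [abs_sub_comm θ (pos (e a))] at h2
    linarith [hclose a]
  have htr : (T - c1 * r) * N ≤ (blockAvg N q f).trace.im := trace_blockAvg_ge hf hs le_rfl
  have hmain := hξ.im_qf_Xi_ge hc₀ (im_qf_blockAvg_nonneg hf) htr
    (Function.extend e (fun a : s => u a) 0)
  rw [qf_extend hinj, vecNorm_extend_sq hinj] at hmain
  have hU' : ∑ a : s, ‖u a‖ ^ 2 = U := Finset.sum_coe_sort s fun a => ‖u a‖ ^ 2
  rw [hU'] at hmain
  have hdiff : (∑ a : s, ∑ b : s, conj (u a) * Xi ξ (blockAvg N q f) (e a) (e b) * u b).im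
      ≤ (∑ a ∈ s, ∑ b ∈ s, conj (u a) * PsiBand K ψ f θ (b - a) * u b).im + c2 * V * r := by
    rw [← sub_le_iff_le_add', ← Complex.sub_im]
    refine (Complex.im_le_norm _).trans ?_
    have e1 : ∑ a ∈ s, ∑ b ∈ s, conj (u a) * PsiBand K ψ f θ (b - a) * u b
        = ∑ a : s, ∑ b : s, conj (u a) * PsiBand K ψ f θ (b - a) * u b := by
      rw [← Finset.sum_coe_sort]
      exact Finset.sum_congr rfl fun a _ => (Finset.sum_coe_sort s _).symm
    have e2 : V = ∑ a : s, ∑ b : s, ‖u a‖ * ‖u b‖ := by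
      rw [hV, ← Finset.sum_coe_sort]
      exact Finset.sum_congr rfl fun a _ => (Finset.sum_coe_sort s _).symm
    rw [e1, e2, ← Finset.sum_sub_distrib, Finset.mul_sum, Finset.sum_mul]
    refine norm_sum_le_of_le _ fun a _ => ?_
    rw [← Finset.sum_sub_distrib, Finset.mul_sum, Finset.sum_mul]
    refine norm_sum_le_of_le _ fun b _ => ?_
    rw [← sub_mul, ← mul_sub, norm_mul, norm_mul, RCLike.norm_conj]
    have hab : (b : ℤ) - a = (e b : ℤ) - e a := by linarith [he a, he b]
    have : ‖Xi ξ (blockAvg N q f) (e a) (e b) - PsiBand K ψ f θ (b - a)‖ ≤ c2 * r := by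
      rw [hab]
      by_cases hK : |((e a : ℕ) : ℤ) - ((e b : ℕ) : ℤ)| ≤ K
      · exact norm_Xi_blockAvg_sub_le hψ hS hξ hp hf hs hL (hfar a) hθ (hclose a) hK
      · have hK' := not_le.1 hK
        have h0m : (0 : ℤ) ∈ Finset.Icc (-(K : ℤ)) K := by simp
        have hL₀ : 0 ≤ L₀ := (hS.nonneg 0 0).trans (hL 0 h0m 0 h0m)
        have hB := hf.nonneg
        rw [Xi_band hξ _ _ _ hK', hR.PsiBand_eq_zero hθ hθS (by rwa [abs_sub_comm]), sub_zero,
          norm_zero, hc2, xiConst]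
        positivity
    calc ‖u a‖ * ‖Xi ξ (blockAvg N q f) (e a) (e b) - PsiBand K ψ f θ (b - a)‖ * ‖u b‖
        ≤ ‖u a‖ * (c2 * r) * ‖u b‖ := by gcongr
      _ = _ := by ring
  have : c₀ * (T - c1 * r) * U = c₀ * T * U - c₀ * c1 * U * r := by ring
  rw [this] at hmain
  linarith

/-- Pairing the equation with `m` and taking imaginary parts gives `γ ‖m‖² ≤ -Im z ‖m‖² + Im m(0) ≤
‖m‖` in the `ℓ²` norm, hence `‖m‖ ≤ 1 / γ`. -/
theorem tsum_norm_sq_le_of_coercive {p m : ℤ → ℂ} {z : ℂ} {γ : ℝ} (hγ : 0 < γ) (hz : 0 ≤ z.im)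
    (hm : Summable fun k => ‖m k‖ ^ 2) (hp : ∀ k, (K : ℤ) < |k| → p k = 0)
    (hcoer : ∀ (s : Finset ℤ) (u : ℤ → ℂ), γ * ∑ a ∈ s, ‖u a‖ ^ 2
      ≤ (∑ a ∈ s, ∑ b ∈ s, conj (u a) * p (b - a) * u b).im)
    (heq : ∀ n, -(z * m n) - ∑ b ∈ Finset.Icc (-(K : ℤ)) K, p b * m (n - b) = delta n) :
    ∑' k, ‖m k‖ ^ 2 ≤ (1 / γ) ^ 2 := by
  classical
  -- The reflection matches the Toeplitz index `b - a` with the convolution in `heq`.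
  set u : ℤ → ℂ := fun a => m (-a) with hu
  set W := ∑' k, ‖m k‖ ^ 2 with hW
  have hu2 : HasSum (fun a => ‖u a‖ ^ 2) W :=
    (Equiv.hasSum_iff (f := fun k => ‖m k‖ ^ 2) (Equiv.neg ℤ)).2 hm.hasSum
  have hg : ∀ c, Summable fun a => conj (u a) * u (a + c) := by
    intro c
    have h1 : Summable fun a => ‖u (a + c)‖ ^ 2 := 
      (Equiv.summable_iff (f := fun a => ‖u a‖ ^ 2) (Equiv.addRight c)).2 hu2.summable
    refine Summable.of_norm_bounded (hu2.summable.add h1) fun a => ?_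
    rw [norm_mul, RCLike.norm_conj]
    nlinarith [sq_nonneg (‖u a‖ - ‖u (a + c)‖), sq_nonneg ‖u a‖, sq_nonneg ‖u (a + c)‖]
  have hfin : ∀ s : Finset ℤ, ∑ a ∈ s, ∑ b ∈ s, conj (u a) * p (b - a) * u b
      = ∑ c ∈ Finset.Icc (-(K : ℤ)) K,
        p c * ∑ a ∈ s.filter (fun a => a + c ∈ s), conj (u a) * u (a + c) := by
    intro s
    simp only [Finset.sum_filter, Finset.mul_sum]
    rw [Finset.sum_comm (s := Finset.Icc (-(K : ℤ)) K)]
    refine Finset.sum_congr rfl fun a _ => ?_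
    have h1 : ∑ b ∈ s, conj (u a) * p (b - a) * u b
        = ∑ b ∈ s.filter (fun b => b - a ∈ Finset.Icc (-(K : ℤ)) K), conj (u a) * p (b - a) * u b := by
      rw [Finset.sum_filter]
      refine Finset.sum_congr rfl fun b _ => ?_
      split_ifs with hb
      · rfl
      · rw [hp _ (by
          by_contra hle
          exact hb (Finset.mem_Icc.2 (abs_le.1 (not_lt.1 hle))))]
        simp
    have h2 : ∑ c ∈ Finset.Icc (-(K : ℤ)) K, p c * (if a + c ∈ s then conj (u a) * u (a + c) else 0)
        = ∑ c ∈ (Finset.Icc (-(K : ℤ)) K).filter (fun c => a + c ∈ s),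
          p c * (conj (u a) * u (a + c)) := by
      rw [Finset.sum_filter]
      refine Finset.sum_congr rfl fun c _ => ?_
      split_ifs <;> simp
    rw [h1, h2]
    refine Finset.sum_bij' (fun b _ => b - a) (fun c _ => a + c) ?_ ?_ ?_ ?_ ?_
    · intro b hb
      simp only [Finset.mem_filter] at hb ⊢
      exact ⟨hb.2, by rw [add_sub_cancel]; exact hb.1⟩
    · intro c hc
      simp only [Finset.mem_filter] at hc ⊢
      exact ⟨hc.2, by rw [add_sub_cancel_left]; exact hc.1⟩
    · intro b _
      exact add_sub_cancel _ _
    · intro c _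
      exact add_sub_cancel_left _ _
    · intro b _
      rw [add_sub_cancel]
      ring
  -- Only the lags `|c| ≤ K` occur, and each truncated correlation is a sum over a filtered set that
  -- still exhausts `ℤ`.
  have hlim : Filter.Tendsto (fun s : Finset ℤ => ∑ a ∈ s, ∑ b ∈ s, conj (u a) * p (b - a) * u b)
      Filter.atTop (nhds (∑ c ∈ Finset.Icc (-(K : ℤ)) K, p c * ∑' a, conj (u a) * u (a + c))) := by
    simp only [hfin]
    refine tendsto_finsetSum _ fun c _ => Filter.Tendsto.const_mul _ ?_
    have hmono : Filter.Tendsto (fun s : Finset ℤ => s.filter fun a => a + c ∈ s) Filter.atTop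
        Filter.atTop := by
      refine Filter.tendsto_atTop_finset_of_monotone (fun s t hst a ha => ?_) fun a => ?_
      · simp only [Finset.mem_filter] at ha ⊢
        exact ⟨hst ha.1, hst ha.2⟩
      · exact ⟨{a, a + c}, by simp⟩
    exact (hg c).hasSum.comp hmono
  have hval : ∑ c ∈ Finset.Icc (-(K : ℤ)) K, p c * ∑' a, conj (u a) * u (a + c)
      = -(z * (W : ℂ)) - conj (m 0) := by
    have h1 : HasSum (fun a => ∑ c ∈ Finset.Icc (-(K : ℤ)) K, p c * (conj (u a) * u (a + c)))
        (∑ c ∈ Finset.Icc (-(K : ℤ)) K, p c * ∑' a, conj (u a) * u (a + c)) :=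
      hasSum_sum fun c _ => (hg c).hasSum.mul_left _
    have h2 : HasSum (fun a => -(z * ((‖u a‖ ^ 2 : ℝ) : ℂ)) - conj (u a) * delta (-a))
        (-(z * (W : ℂ)) - conj (m 0)) := by
      refine (((Complex.hasSum_ofReal.2 hu2).mul_left z).neg).sub ?_
      have h3 := hasSum_single (f := fun a => conj (u a) * delta (-a)) 0 fun a ha => by
        simp [delta, ha]
      simpa [delta, hu] using h3
    have h3 : (fun a => -(z * ((‖u a‖ ^ 2 : ℝ) : ℂ)) - conj (u a) * delta (-a))
        = fun a => ∑ c ∈ Finset.Icc (-(K : ℤ)) K, p c * (conj (u a) * u (a + c)) := by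
      funext a
      have h4 : ∑ c ∈ Finset.Icc (-(K : ℤ)) K, p c * u (a + c) = -(z * u a) - delta (-a) := by
        rw [← heq (-a), sub_sub_cancel]
        exact Finset.sum_congr rfl fun c _ => by rw [hu]; simp only; rw [neg_add']
      have h5 : ((‖u a‖ ^ 2 : ℝ) : ℂ) = conj (u a) * u a := by
        rw [← Complex.normSq_eq_conj_mul_self, Complex.normSq_eq_norm_sq]
      calc _ = conj (u a) * (-(z * u a) - delta (-a)) := by rw [h5]; ring
        _ = _ := by
          rw [← h4, Finset.mul_sum]
          exact Finset.sum_congr rfl fun c _ => by ring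
    rw [h3] at h2
    exact h1.unique h2
  rw [hval] at hlim
  have hineq : γ * W ≤ (-(z * (W : ℂ)) - conj (m 0)).im :=
    le_of_tendsto_of_tendsto' (Filter.Tendsto.const_mul γ hu2)
      ((Complex.continuous_im.tendsto _).comp hlim) fun s => hcoer s u
  have hW0 : 0 ≤ W := tsum_nonneg fun _ => by positivity
  have him : (-(z * (W : ℂ)) - conj (m 0)).im = -(z.im * W) + (m 0).im := by
    rw [Complex.sub_im, Complex.neg_im, Complex.im_mul_ofReal, Complex.conj_im, sub_neg_eq_add]
  have hm0 : ‖m 0‖ ^ 2 ≤ W := hm.le_tsum 0 fun _ _ => by positivity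
  have h5 : (m 0).im ≤ ‖m 0‖ := Complex.im_le_norm _
  have h6 : γ * W ≤ ‖m 0‖ := by
    rw [him] at hineq
    nlinarith [mul_nonneg hz hW0]
  have h7 : ‖m 0‖ ≤ 1 / γ := by
    rw [le_div_iff₀ hγ]
    by_contra hlt
    push Not at hlt
    have h8 : 0 < ‖m 0‖ := pos_of_mul_pos_left (one_pos.trans hlt) hγ.le
    nlinarith
  have : W ≤ 1 / γ * (1 / γ) := by
    have h9 : W ≤ ‖m 0‖ * (1 / γ) := by
      rw [mul_one_div, le_div_iff₀ hγ]
      linarith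
    exact h9.trans (by gcongr)
  rwa [sq]

end Coercivity

/-! ### Quantitative bounds for the limiting solution. -/

section Bulk
open Matrix
open scoped ComplexConjugate Matrix.Norms.L2Operator

variable {K N q : ℕ} {C c₀ B L₀ β ω r : ℝ} {ψ : ℝ → ℝ → ℤ → ℤ → ℝ} {S : Finset ℝ} {L : ℤ → ℤ → ℝ}
  {f : ℝ → ℤ → ℂ} {z : ℂ}

/-- A solution of the limiting equation, together with the quantitative bounds which hold in the
bulk. -/
structure IsBulkField (K : ℕ) (ψ : ℝ → ℝ → ℤ → ℤ → ℝ) (β ω : ℝ) (z : ℂ) (f : ℝ → ℤ → ℂ) :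
    Prop where
  posField : IsPosField β f
  l2 : ∀ᵐ θ ∂unitMeasure, Summable (fun k => ‖f θ k‖ ^ 2) ∧ ∑' k, ‖f θ k‖ ^ 2 ≤ β ^ 2
  eqn : ∀ᵐ θ ∂unitMeasure, ∀ n, -(z * f θ n)
    - ∑ b ∈ Finset.Icc (-(K : ℤ)) K, PsiBand K ψ f θ b * f θ (n - b) = delta n
  trace : ω ≤ (∫ φ, f φ 0 ∂unitMeasure).im

/-- The bound `B` contained in the membership of `f` in `𝒯` may depend on `z`; it is used only to
obtain coercivity, which then replaces it by `1 / (c₀ ω)`. The finite range of `ψ` turns the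
convolution into a finite sum. -/
theorem IsLimitSolution.isBulkField (hψ : IsProfile ψ) (hS : IsGrid ψ S L) (hc₀ : 0 < c₀)
    (h : ∀ N : ℕ, ∃ ξ : Fin N → Fin N → Fin N → Fin N → ℝ,
      IsCovTensor K c₀ ξ ∧ HasProfile K C ψ ξ) (hR : HasRange K ψ S)
    (hL : ∀ k ∈ Finset.Icc (-(K : ℤ)) K, ∀ l ∈ Finset.Icc (-(K : ℤ)) K, L k l ≤ L₀)
    (hm : IsLimitSolution ψ z f) (hz : 0 ≤ z.im) (hω : 0 < ω) (htr : ω ≤ (trT f).im) :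
    IsBulkField K ψ (1 / (c₀ * ω)) ω z f := by
  obtain ⟨hT, hinv⟩ := hm
  obtain ⟨B, hB⟩ := hT.exists_isPosField
  have hγ : 0 < c₀ * ω := by positivity
  have heqn : ∀ᵐ θ ∂unitMeasure, ∀ n, -(z * f θ n)
      - ∑ b ∈ Finset.Icc (-(K : ℤ)) K, PsiBand K ψ f θ b * f θ (n - b) = delta n := by
    filter_upwards [hinv, ae_mem_Ico, ae_notMem_finset S] with θ hθ h1 h2 n
    rw [← hθ.2.2, conv, tsum_eq_sum (s := Finset.Icc (-(K : ℤ)) K)]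
    · simp only [hR.Psi_eq h1 h2, sub_mul, Finset.sum_sub_distrib]
      congr 1
      rw [Finset.sum_eq_single 0]
      · simp [delta]
      · intro b _ hb
        simp [delta, hb]
      · simp
    · intro b hb
      have hb' : (K : ℤ) < |b| := by
        by_contra hle
        exact hb (Finset.mem_Icc.2 (abs_le.1 (not_lt.1 hle)))
      have hb0 : b ≠ 0 := by
        rintro rfl
        rw [abs_zero] at hb'
        omega
      rw [hR.Psi_eq h1 h2, hR.PsiBand_eq_zero h1 h2 hb']
      simp [delta, hb0]
  have hl2 : ∀ᵐ θ ∂unitMeasure,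
      Summable (fun k => ‖f θ k‖ ^ 2) ∧ ∑' k, ‖f θ k‖ ^ 2 ≤ (1 / (c₀ * ω)) ^ 2 := by
    filter_upwards [hinv, heqn, ae_mem_Ico, ae_notMem_finset S] with θ hθ he h1 h2
    have hsum : Summable fun k => ‖f θ k‖ ^ 2 := by
      have := (memℓp_gen_iff (p := 2) (by norm_num)).1 hθ.2.1.memlp
      simpa using this
    refine ⟨hsum, tsum_norm_sq_le_of_coercive (K := K) hγ hz hsum
      (fun k hk => hR.PsiBand_eq_zero h1 h2 hk) (fun s u => ?_) he⟩
    refine le_trans ?_ (PsiBand_coercive hψ hS hc₀.le h hR hL hB h1 h2 s u)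
    have : 0 ≤ ∑ a ∈ s, ‖u a‖ ^ 2 := Finset.sum_nonneg fun _ _ => by positivity
    gcongr
    exact htr
  refine ⟨⟨hB.measurable, ?_, hB.im_nonneg⟩, hl2, heqn, htr⟩
  filter_upwards [hl2] with θ hθ k
  exact abs_le_of_sq_le_sq' ((hθ.1.le_tsum k fun _ _ => by positivity).trans hθ.2)
    (by positivity) |>.2

theorem norm_PsiBand_le (hS : IsGrid ψ S L)
    (hL : ∀ k ∈ Finset.Icc (-(K : ℤ)) K, ∀ l ∈ Finset.Icc (-(K : ℤ)) K, L k l ≤ L₀)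
    (hf : IsPosField B f) {θ : ℝ} (hθ : θ ∈ Set.Ico (0 : ℝ) 1) {k : ℤ}
    (hk : k ∈ Finset.Icc (-(K : ℤ)) K) : ‖PsiBand K ψ f θ k‖ ≤ (2 * K + 1) * (L₀ * B) := by
  have h0m : (0 : ℤ) ∈ Finset.Icc (-(K : ℤ)) K := by simp
  have hL₀ : 0 ≤ L₀ := (hS.nonneg 0 0).trans (hL 0 h0m 0 h0m)
  refine (norm_sum_le_of_le (f := fun b => _) _ (n := fun _ => L₀ * B) fun b hb => ?_).trans
    (le_of_eq ?_)
  · refine (norm_integral_le_of_norm_le_const (C := L₀ * B) ?_).trans (by simp)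
    filter_upwards [ae_mem_Ico, hf.bound] with φ hφ hfφ
    rw [norm_mul, Complex.norm_real]
    exact mul_le_mul ((hS.bound θ hθ φ hφ k b).trans (hL k hk b hb)) (hfφ b) (norm_nonneg _) hL₀
  · rw [Finset.sum_const, Int.card_Icc, nsmul_eq_mul]
    congr 1
    have : ((K : ℤ) + 1 - -(K : ℤ)).toNat = 2 * K + 1 := by omega
    rw [this]
    push_cast
    ring

/-- The coefficient at `0` of the equation, integrated over `θ`, bounds `z` times the trace, and the
trace is at least `ω` in modulus. -/
theorem IsBulkField.norm_z_le (hS : IsGrid ψ S L)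
    (hL : ∀ k ∈ Finset.Icc (-(K : ℤ)) K, ∀ l ∈ Finset.Icc (-(K : ℤ)) K, L k l ≤ L₀)
    (hf : IsBulkField K ψ β ω z f) : ‖z‖ * ω ≤ 1 + (2 * K + 1) ^ 2 * (L₀ * β ^ 2) := by
  have hβ := hf.posField.nonneg
  have h1 : ω ≤ ‖∫ φ, f φ 0 ∂unitMeasure‖ := hf.trace.trans (Complex.im_le_norm _)
  have h2 : ‖z‖ * ‖∫ φ, f φ 0 ∂unitMeasure‖ ≤ 1 + (2 * K + 1) ^ 2 * (L₀ * β ^ 2) := by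
    rw [← norm_mul, ← integral_const_mul]
    refine (norm_integral_le_of_norm_le_const (C := 1 + (2 * K + 1) ^ 2 * (L₀ * β ^ 2)) ?_).trans
      (by simp)
    filter_upwards [hf.eqn, ae_mem_Ico, hf.posField.bound] with θ he hθ hb
    have h3 : z * f θ 0 = -(delta 0 + ∑ b ∈ Finset.Icc (-(K : ℤ)) K,
        PsiBand K ψ f θ b * f θ (0 - b)) := by
      rw [← he 0]
      ring
    rw [h3, norm_neg]
    refine (norm_add_le _ _).trans (add_le_add (by simp [delta]) ?_)
    refine (norm_sum_le_of_le (f := fun b => _) _ (n := fun _ => (2 * K + 1) * (L₀ * β) * β)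
      fun b hb' => ?_).trans (le_of_eq ?_)
    · rw [norm_mul]
      have h4 := norm_PsiBand_le hS hL hf.posField hθ hb'
      exact mul_le_mul h4 (hb _) (norm_nonneg _) ((norm_nonneg _).trans h4)
    · rw [Finset.sum_const, Int.card_Icc, nsmul_eq_mul]
      have : ((K : ℤ) + 1 - -(K : ℤ)).toNat = 2 * K + 1 := by omega
      rw [this]
      push_cast
      ring
  exact (mul_le_mul_of_nonneg_left h1 (norm_nonneg _)).trans h2

theorem blockInd_eq_indicator (hq : 0 < q) (j : Fin N) {φ : ℝ} (hφ : 0 ≤ φ) :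
    blockInd q j φ = (Set.Ico ((((j : ℕ) / q * q : ℕ) : ℝ) / N)
      ((((j : ℕ) / q * q + q : ℕ) : ℝ) / N)).indicator (fun _ => (1 : ℝ)) φ := by
  have hN' : (0 : ℝ) < N := by exact_mod_cast j.pos
  have hiff : ⌊(N : ℝ) * φ⌋₊ / q = (j : ℕ) / q ↔ φ ∈ Set.Ico ((((j : ℕ) / q * q : ℕ) : ℝ) / N)
      ((((j : ℕ) / q * q + q : ℕ) : ℝ) / N) := by
    set X := (j : ℕ) / q
    rw [Set.mem_Ico, div_le_iff₀ hN', lt_div_iff₀ hN', mul_comm φ,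
      ← Nat.le_floor_iff (by positivity), ← Nat.floor_lt (by positivity)]
    constructor
    · rintro h
      rw [← h]
      exact ⟨Nat.div_mul_le_self _ _, Nat.lt_div_mul_add hq⟩
    · rintro ⟨h1, h2⟩
      exact Nat.div_eq_of_lt_le h1 (by rwa [Nat.succ_mul])
  unfold blockInd
  by_cases h : ⌊(N : ℝ) * φ⌋₊ / q = (j : ℕ) / q
  · rw [if_pos h, Set.indicator_of_mem (hiff.1 h)]
  · rw [if_neg h, Set.indicator_of_notMem fun hm => h (hiff.2 hm)]

theorem integral_blockInd (hq : 0 < q) (j : Fin N) :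
    ∫ φ, blockInd q j φ ∂unitMeasure = unitMeasure.real (Set.Ico ((((j : ℕ) / q * q : ℕ) : ℝ) / N)
      ((((j : ℕ) / q * q + q : ℕ) : ℝ) / N)) := by
  rw [integral_congr_ae (g := (Set.Ico ((((j : ℕ) / q * q : ℕ) : ℝ) / N)
      ((((j : ℕ) / q * q + q : ℕ) : ℝ) / N)).indicator fun _ => (1 : ℝ)),
    integral_indicator_const _ measurableSet_Ico, smul_eq_mul, mul_one]
  filter_upwards [ae_mem_Ico] with φ hφ
  exact blockInd_eq_indicator hq j hφ.1

theorem integral_blockInd_le (hq : 0 < q) (j : Fin N) :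
    (N / q : ℝ) * ∫ φ, blockInd q j φ ∂unitMeasure ≤ 1 := by
  have hN' : (0 : ℝ) < N := by exact_mod_cast j.pos
  have hq' : (0 : ℝ) < q := by exact_mod_cast hq
  have h1 : ∫ φ, blockInd q j φ ∂unitMeasure ≤ q / N := by
    rw [integral_blockInd hq]
    refine (ENNReal.toReal_mono measure_Ico_lt_top.ne (Measure.restrict_apply_le _ _)).trans ?_
    change volume.real _ ≤ _
    rw [Real.volume_real_Ico]
    refine max_le (le_of_eq ?_) (by positivity)
    push_cast
    ring
  calc (N / q : ℝ) * ∫ φ, blockInd q j φ ∂unitMeasure ≤ N / q * (q / N) := by gcongr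
    _ = 1 := by field_simp

theorem integral_blockInd_eq (hq : 0 < q) (j : Fin N) (hj : (j : ℕ) / q * q + q ≤ N) :
    (N / q : ℝ) * ∫ φ, blockInd q j φ ∂unitMeasure = 1 := by
  have hN' : (0 : ℝ) < N := by exact_mod_cast j.pos
  have hq' : (0 : ℝ) < q := by exact_mod_cast hq
  have hj' : (((j : ℕ) / q * q + q : ℕ) : ℝ) ≤ N := by exact_mod_cast hj
  have h1 : ∫ φ, blockInd q j φ ∂unitMeasure = q / N := by
    rw [integral_blockInd hq, Measure.real, unitMeasure, Measure.restrict_apply measurableSet_Ico,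
      Set.inter_eq_self_of_subset_left]
    · change volume.real _ = _
      rw [Real.volume_real_Ico_of_le (by gcongr; omega)]
      push_cast
      ring
    · refine Set.Ico_subset_Ico (by positivity) ?_
      rw [div_le_one hN']
      exact hj'
  rw [h1]
  field_simp

/-- Minkowski's inequality for an average over one block, obtained by pairing the averaged vector
with itself; the weight `N / q` times the length of the block is at most `1`. -/
theorem vecNorm_blockInd_average_le (hq : 0 < q) (j : Fin N) {G : ℝ → Fin N → ℂ} {A : ℝ}
    (hA : 0 ≤ A)
    (hG : ∀ k, Integrable (fun φ => ((blockInd q j φ : ℝ) : ℂ) * G φ k) unitMeasure)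
    (hb : ∀ᵐ φ ∂unitMeasure, blockInd q j φ ≠ 0 → vecNorm (G φ) ≤ A) :
    vecNorm (fun k => ((N / q : ℝ) : ℂ) *
      ∫ φ, ((blockInd q j φ : ℝ) : ℂ) * G φ k ∂unitMeasure) ≤ A := by
  set v : Fin N → ℂ := fun k => ((N / q : ℝ) : ℂ) *
      ∫ φ, ((blockInd q j φ : ℝ) : ℂ) * G φ k ∂unitMeasure with hv
  have hv0 := vecNorm_nonneg v
  have hχ : Integrable (blockInd q j) unitMeasure :=
    Integrable.of_bound (measurable_blockInd j).aestronglyMeasurable 1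
      (Filter.Eventually.of_forall fun φ => by
        rw [Real.norm_of_nonneg (blockInd_nonneg _ _)]
        exact blockInd_le_one _ _)
  have h1 : ((vecNorm v ^ 2 : ℝ) : ℂ) = ((N / q : ℝ) : ℂ) *
      ∫ φ, ((blockInd q j φ : ℝ) : ℂ) * (star v ⬝ᵥ G φ) ∂unitMeasure := by
    have e : ∀ φ, ((blockInd q j φ : ℝ) : ℂ) * (star v ⬝ᵥ G φ)
        = ∑ k, star v k * (((blockInd q j φ : ℝ) : ℂ) * G φ k) := by
      intro φ
      rw [dotProduct, Finset.mul_sum]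
      exact Finset.sum_congr rfl fun k _ => by ring
    simp only [e]
    rw [← star_dotProduct_self, integral_finsetSum _ fun k _ => (hG k).const_mul _, dotProduct,
      Finset.mul_sum]
    refine Finset.sum_congr rfl fun k _ => ?_
    rw [integral_const_mul, hv]
    ring
  have h2 : vecNorm v ^ 2 ≤ vecNorm v * A := by
    have h3 : ‖∫ φ, ((blockInd q j φ : ℝ) : ℂ) * (star v ⬝ᵥ G φ) ∂unitMeasure‖
        ≤ ∫ φ, blockInd q j φ * (vecNorm v * A) ∂unitMeasure := by
      refine norm_integral_le_of_norm_le (hχ.mul_const _) ?_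
      filter_upwards [hb] with φ hφ
      rw [norm_mul, Complex.norm_real, Real.norm_of_nonneg (blockInd_nonneg _ _)]
      by_cases h0 : blockInd q j φ = 0
      · rw [h0, zero_mul, zero_mul]
      · refine mul_le_mul_of_nonneg_left ?_ (blockInd_nonneg _ _)
        exact (norm_star_dotProduct_le _ _).trans (mul_le_mul_of_nonneg_left (hφ h0) hv0)
    have h4 : vecNorm v ^ 2 = ‖((vecNorm v ^ 2 : ℝ) : ℂ)‖ := by
      rw [Complex.norm_real, Real.norm_of_nonneg (by positivity)]
    rw [h4, h1, norm_mul, Complex.norm_real, Real.norm_of_nonneg (by positivity)]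
    rw [integral_mul_const] at h3
    calc (N / q : ℝ) * ‖∫ φ, ((blockInd q j φ : ℝ) : ℂ) * (star v ⬝ᵥ G φ) ∂unitMeasure‖
        ≤ (N / q : ℝ) * ((∫ φ, blockInd q j φ ∂unitMeasure) * (vecNorm v * A)) := by gcongr
      _ = ((N / q : ℝ) * ∫ φ, blockInd q j φ ∂unitMeasure) * (vecNorm v * A) := by ring
      _ ≤ 1 * (vecNorm v * A) := by
          gcongr
          exact integral_blockInd_le hq j
      _ = _ := one_mul _
  rcases hv0.eq_or_lt with h0 | h0
  · rw [← h0]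
    exact hA
  · rw [sq] at h2
    exact le_of_mul_le_mul_left h2 h0

theorem vecNorm_le_of_l2 {g : ℤ → ℂ} (hβ : 0 ≤ β) (hg : Summable fun k => ‖g k‖ ^ 2)
    (hgβ : ∑' k, ‖g k‖ ^ 2 ≤ β ^ 2) (a : ℤ) {y : Fin N → ℂ}
    (hy : ∀ k : Fin N, ‖y k‖ ≤ ‖g ((k : ℤ) - a)‖) : vecNorm y ≤ β := by
  refine abs_le_of_sq_le_sq' ?_ hβ |>.2
  rw [vecNorm_sq]
  refine le_trans ?_ hgβ
  have hinj : Function.Injective fun k : Fin N => (k : ℤ) - a := by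
    intro k l hkl
    simp only at hkl
    exact Fin.ext (by omega)
  calc ∑ k, ‖y k‖ ^ 2 ≤ ∑ k : Fin N, ‖g ((k : ℤ) - a)‖ ^ 2 := by
        gcongr with k
        exact hy k
    _ = ∑ t ∈ Finset.univ.image fun k : Fin N => (k : ℤ) - a, ‖g t‖ ^ 2 := by
        rw [Finset.sum_image hinj.injOn]
    _ ≤ _ := hg.sum_le_tsum _ fun _ _ => by positivity

theorem IsBulkField.vecNorm_row_le (hf : IsBulkField K ψ β ω z f) (hq : 0 < q) (j : Fin N) :
    vecNorm (fun l => blockAvg N q f j l) ≤ β := by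
  have e : (fun l => blockAvg N q f j l) = fun l => ((N / q : ℝ) : ℂ) * ∫ φ,
      ((blockInd q j φ : ℝ) : ℂ) * (((blockInd q l φ : ℝ) : ℂ) * f φ ((l : ℤ) - (j : ℤ)))
        ∂unitMeasure := by
    funext l
    rw [blockAvg, of_apply]
    congr 1
    refine integral_congr_ae (Filter.Eventually.of_forall fun φ => ?_)
    simp only
    push_cast
    ring
  rw [e]
  refine vecNorm_blockInd_average_le hq j hf.posField.nonneg (fun l => ?_) ?_
  · have := hf.posField.integrable_blockInd (q := q) j l ((l : ℤ) - (j : ℤ))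
    refine this.congr (Filter.Eventually.of_forall fun φ => ?_)
    simp only
    push_cast
    ring
  · filter_upwards [hf.l2] with φ hφ _
    refine vecNorm_le_of_l2 hf.posField.nonneg hφ.1 hφ.2 j fun l => ?_
    rw [norm_mul, Complex.norm_real, Real.norm_of_nonneg (blockInd_nonneg _ _)]
    exact mul_le_of_le_one_left (norm_nonneg _) (blockInd_le_one _ _)

end Bulk

/-! ### The residual of the block average in the matrix equation. -/

section Residual
open Matrix
open scoped ComplexConjugate Matrix.Norms.L2Operator

variable {K N q : ℕ} {C c₀ B L₀ β ω r : ℝ} {ψ : ℝ → ℝ → ℤ → ℤ → ℝ} {S : Finset ℝ} {L : ℤ → ℤ → ℝ}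
  {f : ℝ → ℤ → ℂ} {z : ℂ} {ξ : Fin N → Fin N → Fin N → Fin N → ℝ}

theorem vecNorm_sum_mul_le {n ι : Type*} [Fintype n] (s : Finset ι) (w : ι → ℂ)
    (y : ι → n → ℂ) : vecNorm (fun k => ∑ b ∈ s, w b * y b k) ≤ ∑ b ∈ s, ‖w b‖ * vecNorm (y b) := by
  have h1 : (fun k => ∑ b ∈ s, w b * y b k) = ∑ b ∈ s, w b • y b := by
    funext k
    simp
  rw [h1, vecNorm, WithLp.toLp_sum]
  refine (norm_sum_le _ _).trans (le_of_eq (Finset.sum_congr rfl fun b _ => ?_))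
  rw [WithLp.toLp_smul, norm_smul]
  rfl

theorem vecNorm_sub_le {n : Type*} [Fintype n] (x y : n → ℂ) :
    vecNorm (fun k => x k - y k) ≤ vecNorm x + vecNorm y :=
  norm_sub_le (WithLp.toLp 2 x : EuclideanSpace ℂ n) (WithLp.toLp 2 y)

theorem norm_apply_le_vecNorm {n : Type*} [Fintype n] (x : n → ℂ) (k : n) : ‖x k‖ ≤ vecNorm x :=
  PiLp.norm_apply_le (WithLp.toLp 2 x : EuclideanSpace ℂ n) k

theorem hsNorm_sq_row (A : Matrix (Fin N) (Fin N) ℂ) :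
    hsNorm A ^ 2 = ∑ i, vecNorm (fun k => A i k) ^ 2 := by
  simp only [hsNorm_sq, vecNorm_sq]

theorem sum_band_eq (A : Matrix (Fin N) (Fin N) ℂ) (i : Fin N)
    (hA : ∀ j : Fin N, (K : ℤ) < |(i : ℤ) - j| → A i j = 0) {sh : ℤ → Fin N}
    (hsh : ∀ b ∈ Finset.Icc (-(K : ℤ)) K, (sh b : ℤ) - i = b) (g : Fin N → ℂ) :
    ∑ j, A i j * g j = ∑ b ∈ Finset.Icc (-(K : ℤ)) K, A i (sh b) * g (sh b) := by
  classical
  have hinj : Set.InjOn sh (Finset.Icc (-(K : ℤ)) K : Finset ℤ) := by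
    intro a ha b hb hab
    rw [← hsh a ha, ← hsh b hb, hab]
  rw [← Finset.sum_image (f := fun j => A i j * g j) hinj]
  symm
  refine Finset.sum_subset (Finset.subset_univ _) fun j _ hj => ?_
  rw [hA j, zero_mul]
  by_contra hle
  have hmem : (j : ℤ) - i ∈ Finset.Icc (-(K : ℤ)) K := by
    rw [abs_sub_comm] at hle
    exact Finset.mem_Icc.2 (abs_le.1 (not_lt.1 hle))
  refine hj (Finset.mem_image.2 ⟨_, hmem, ?_⟩)
  have := hsh _ hmem
  exact Fin.ext (by omega)

theorem resolventDenom_band (hξ : IsCovTensor K c₀ ξ) (X : Matrix (Fin N) (Fin N) ℂ) {i j : Fin N}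
    (hij : (K : ℤ) < |(i : ℤ) - j|) : resolventDenom ξ z X i j = 0 := by
  have hne : i ≠ j := by
    rintro rfl
    rw [sub_self, abs_zero] at hij
    omega
  rw [resolventDenom, Matrix.sub_apply, Xi_band hξ X i j hij, Matrix.neg_apply, Matrix.smul_apply,
    Matrix.one_apply_ne hne]
  simp

/-- If row `i` is far from the grid and its band neighbours share its block, row `i` of the residual
is an average over `φ` in that block of `∑_b (Ψ(f)(φ, b) - Ξ(M)_{i, i+b}) f φ (· - i - b)`, by the
limiting equation at `φ`. The coefficients are `O(r)` and the rows of `f φ` have `ℓ²` norm at most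
`β`. -/
theorem vecNorm_residual_good (hψ : IsProfile ψ) (hS : IsGrid ψ S L) (hξ : IsCovTensor K c₀ ξ)
    (hp : HasProfile K C ψ ξ) (hf : IsBulkField K ψ β ω z f) (hs : IsBlockScale K r N q)
    (hL : ∀ k ∈ Finset.Icc (-(K : ℤ)) K, ∀ l ∈ Finset.Icc (-(K : ℤ)) K, L k l ≤ L₀)
    {i : Fin N} (hi : ∀ e ∈ S, 3 * r < |pos i - e|)
    (hedge : ∀ j : Fin N, |(i : ℤ) - j| ≤ K → (j : ℕ) / q = (i : ℕ) / q) :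
    vecNorm (fun k => (resolventDenom ξ z (blockAvg N q f) * blockAvg N q f - 1) i k)
      ≤ (2 * K + 1) * (xiConst K C L₀ S.card * β * r * β) := by
  have hr := hs.r_pos
  have hβ := hf.posField.nonneg
  have hN' : (0 : ℝ) < N := by exact_mod_cast hs.N_pos
  have h0m : (0 : ℤ) ∈ Finset.Icc (-(K : ℤ)) K := by simp
  have hL₀ : 0 ≤ L₀ := (hS.nonneg 0 0).trans (hL 0 h0m 0 h0m)
  have hX0 : 0 ≤ xiConst K C L₀ S.card := by
    rw [xiConst]
    positivity
  set M := blockAvg N q f with hM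
  set T := resolventDenom ξ z M with hT
  have hKN : (K : ℝ) / N ≤ r := by
    rw [div_le_iff₀ hN']
    linarith [hs.add_le, (Nat.cast_nonneg q : (0 : ℝ) ≤ q)]
  have hex : ∀ b : ℤ, ∃ k : Fin N, b ∈ Finset.Icc (-(K : ℤ)) K → (k : ℤ) - (i : ℤ) = b := by
    intro b
    by_cases hb : b ∈ Finset.Icc (-(K : ℤ)) K
    · have h1 : |(b : ℝ)| / N ≤ K / N := by
        have : |b| ≤ (K : ℤ) := abs_le.2 (Finset.mem_Icc.1 hb)
        gcongr
        exact_mod_cast this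
      obtain ⟨k, hk⟩ := exists_shift (i := i) (a := b) (by linarith [hi 0 hS.zero_mem])
        (by linarith [hi 1 hS.one_mem])
      exact ⟨k, fun _ => hk⟩
    · exact ⟨i, fun h => absurd h hb⟩
  choose sh hsh using hex
  have hband : ∀ b ∈ Finset.Icc (-(K : ℤ)) K, |(i : ℤ) - sh b| ≤ K := by
    intro b hb
    rw [abs_sub_comm, hsh b hb]
    exact abs_le.2 (Finset.mem_Icc.1 hb)
  have hblock : ∀ b ∈ Finset.Icc (-(K : ℤ)) K, ∀ φ, blockInd q (sh b) φ = blockInd q i φ := by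
    intro b hb φ
    rw [blockInd, blockInd, hedge _ (hband b hb)]
  -- Only on a complete block is the average normalized exactly, so that it reproduces the identity
  -- matrix.
  have hcomplete : (i : ℕ) / q * q + q ≤ N := by
    have h1 := hi 1 hS.one_mem
    rw [abs_sub_comm, abs_of_nonneg (sub_nonneg.2 (pos_le_one i))] at h1
    have h2 : pos i * N = i + 1 := by
      rw [pos, div_mul_cancel₀ _ hN'.ne']
    have h3 : ((i : ℕ) : ℝ) + q ≤ N := by
      nlinarith [hs.add_le, (Nat.cast_nonneg K : (0 : ℝ) ≤ K)]
    have h4 : (i : ℕ) + q ≤ N := by exact_mod_cast h3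
    exact (Nat.add_le_add_right (Nat.div_mul_le_self _ _) _).trans h4
  set G : ℝ → Fin N → ℂ := fun φ k =>
    ∑ b ∈ Finset.Icc (-(K : ℤ)) K, T i (sh b) * (((blockInd q k φ : ℝ) : ℂ) * f φ ((k : ℤ) - i - b))
      - ((blockInd q k φ : ℝ) : ℂ) * delta ((k : ℤ) - i) with hG
  have hint1 : ∀ (b : ℤ) (k : Fin N), Integrable (fun φ => T i (sh b) *
      (((blockInd q i φ * blockInd q k φ : ℝ) : ℂ) * f φ ((k : ℤ) - i - b))) unitMeasure :=
    fun b k => (hf.posField.integrable_blockInd i k _).const_mul _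
  have hint2 : ∀ k : Fin N, Integrable (fun φ =>
      ((blockInd q i φ * blockInd q k φ : ℝ) : ℂ) * delta ((k : ℤ) - i)) unitMeasure := by
    intro k
    refine Integrable.mul_const (Integrable.ofReal ?_) _
    refine Integrable.of_bound ((measurable_blockInd i).mul
      (measurable_blockInd k)).aestronglyMeasurable 1 (Filter.Eventually.of_forall fun φ => ?_)
    change ‖blockInd q i φ * blockInd q k φ‖ ≤ 1
    rw [Real.norm_of_nonneg (mul_nonneg (blockInd_nonneg _ _) (blockInd_nonneg _ _))]
    exact mul_le_one₀ (blockInd_le_one _ _) (blockInd_nonneg _ _) (blockInd_le_one _ _)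
  have hGexp : ∀ k φ, ((blockInd q i φ : ℝ) : ℂ) * G φ k
      = ∑ b ∈ Finset.Icc (-(K : ℤ)) K, T i (sh b) *
          (((blockInd q i φ * blockInd q k φ : ℝ) : ℂ) * f φ ((k : ℤ) - i - b))
        - ((blockInd q i φ * blockInd q k φ : ℝ) : ℂ) * delta ((k : ℤ) - i) := by
    intro k φ
    rw [hG]
    simp only
    rw [mul_sub, Finset.mul_sum]
    push_cast
    congr 1
    · exact Finset.sum_congr rfl fun b _ => by ring
    · ring
  have hrow : (fun k => (T * M - 1) i k) = fun k => ((N / q : ℝ) : ℂ) *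
      ∫ φ, ((blockInd q i φ : ℝ) : ℂ) * G φ k ∂unitMeasure := by
    funext k
    simp only [hGexp]
    rw [integral_sub (integrable_finsetSum _ fun b _ => hint1 b k) (hint2 k),
      integral_finsetSum _ fun b _ => hint1 b k, mul_sub, Finset.mul_sum, Matrix.sub_apply,
      Matrix.mul_apply, sum_band_eq T i (fun j hj => resolventDenom_band hξ M hj) hsh]
    congr 1
    · refine Finset.sum_congr rfl fun b hb => ?_
      have e1 : (k : ℤ) - i - b = (k : ℤ) - sh b := by
        have := hsh b hb
        linarith
      rw [integral_const_mul, hM, blockAvg, of_apply, e1]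
      simp only [hblock b hb]
      ring
    · rw [integral_mul_const, integral_complex_ofReal]
      by_cases hik : i = k
      · subst hik
        have e2 : ∀ φ, blockInd q i φ * blockInd q i φ = blockInd q i φ := by
          intro φ
          unfold blockInd
          split_ifs <;> simp
        simp only [e2]
        rw [← mul_assoc, ← Complex.ofReal_mul, integral_blockInd_eq hs.pos i hcomplete]
        simp [delta]
      · have : (k : ℤ) - (i : ℤ) ≠ 0 := fun h0 => hik (Fin.ext (by omega))
        rw [Matrix.one_apply_ne hik]
        simp [delta, this]
  rw [hrow]
  refine vecNorm_blockInd_average_le hs.pos i (by positivity) (fun k => ?_) ?_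
  · simp only [hGexp]
    exact (integrable_finsetSum _ fun b _ => hint1 b k).sub (hint2 k)
  · filter_upwards [ae_mem_Ico, hf.eqn, hf.l2] with φ hφ he hl2 hne
    have hiφ : |pos i - φ| ≤ r := abs_pos_sub_le hs.pos
      (by linarith [hs.add_le, (Nat.cast_nonneg K : (0 : ℝ) ≤ K)]) hφ.1 hne
    have hGk : G φ = fun k => ∑ b ∈ Finset.Icc (-(K : ℤ)) K,
        (PsiBand K ψ f φ b - Xi ξ M i (sh b)) *
          (((blockInd q k φ : ℝ) : ℂ) * f φ ((k : ℤ) - i - b)) := by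
      funext k
      have h1 : ∀ b ∈ Finset.Icc (-(K : ℤ)) K, T i (sh b) = -(z * delta b) - Xi ξ M i (sh b) := by
        intro b hb
        rw [hT, resolventDenom, Matrix.sub_apply, Matrix.neg_apply, Matrix.smul_apply, smul_eq_mul,
          Matrix.one_apply]
        have h2 := hsh b hb
        have h3 : (i = sh b) ↔ b = 0 := by
          constructor
          · intro h4
            rw [← h4] at h2
            omega
          · rintro rfl
            exact Fin.ext (by omega)
        simp [h3, delta, Pi.single_apply]
      have h4 : ∑ b ∈ Finset.Icc (-(K : ℤ)) K, (-(z * delta b)) * f φ ((k : ℤ) - i - b)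
          = -(z * f φ ((k : ℤ) - i)) := by
        rw [Finset.sum_eq_single 0]
        · simp [delta]
        · intro b _ hb
          simp [delta, hb]
        · simp
      rw [hG]
      simp only
      rw [← he ((k : ℤ) - i), ← h4, ← Finset.sum_sub_distrib, Finset.mul_sum,
        ← Finset.sum_sub_distrib]
      refine Finset.sum_congr rfl fun b hb => ?_
      rw [h1 b hb]
      ring
    rw [hGk]
    refine (vecNorm_sum_mul_le _ _ _).trans ?_
    refine (Finset.sum_le_card_nsmul _ _ (xiConst K C L₀ S.card * β * r * β) fun b hb => ?_).trans
      (le_of_eq ?_)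
    · refine mul_le_mul ?_ ?_ (vecNorm_nonneg _) (by positivity)
      · rw [norm_sub_rev]
        have := norm_Xi_blockAvg_sub_le hψ hS hξ hp hf.posField hs hL (k := sh b) hi hφ hiφ
          (hband b hb)
        rwa [hsh b hb] at this
      · refine vecNorm_le_of_l2 hβ hl2.1 hl2.2 ((i : ℤ) + b) fun k => ?_
        rw [norm_mul, Complex.norm_real, Real.norm_of_nonneg (blockInd_nonneg _ _), sub_sub]
        exact mul_le_of_le_one_left (norm_nonneg _) (blockInd_le_one _ _)
    · rw [Int.card_Icc, nsmul_eq_mul]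
      have : ((K : ℤ) + 1 - -(K : ℤ)).toNat = 2 * K + 1 := by omega
      rw [this]
      push_cast
      ring

/-- Crude bound for the remaining rows, which are few. -/
theorem vecNorm_residual_le (hξ : IsCovTensor K c₀ ξ) (hf : IsBulkField K ψ β ω z f)
    (hq : 0 < q) (i : Fin N) :
    vecNorm (fun k => (resolventDenom ξ z (blockAvg N q f) * blockAvg N q f - 1) i k)
      ≤ (2 * K + 1) * ((‖z‖ + (2 * K + 1) ^ 2 * β) * β) + 1 := by
  have hβ := hf.posField.nonneg
  set M := blockAvg N q f with hM
  set T := resolventDenom ξ z M with hT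
  have hMb : ∀ j k, ‖M j k‖ ≤ β := fun j k =>
    (norm_apply_le_vecNorm (fun k => M j k) k).trans (hf.vecNorm_row_le hq j)
  have hTb : ∀ j, ‖T i j‖ ≤ ‖z‖ + (2 * K + 1) ^ 2 * β := by
    intro j
    rw [hT, resolventDenom, Matrix.sub_apply, Matrix.neg_apply, Matrix.smul_apply, smul_eq_mul]
    refine (norm_sub_le _ _).trans (add_le_add ?_ ?_)
    · rw [norm_neg, norm_mul]
      refine mul_le_of_le_one_right (norm_nonneg _) ?_
      rw [Matrix.one_apply]
      split_ifs <;> simp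
    · exact (norm_entry_le_opNorm _ i j).trans (norm_Xi_le_max hξ M i.pos hMb)
  have h1 : (fun k => (T * M - 1) i k) = fun k =>
      (fun k => ∑ j ∈ Finset.univ.filter fun j : Fin N => |(i : ℤ) - j| ≤ K, T i j * M j k) k
        - (Pi.single i (1 : ℂ) : Fin N → ℂ) k := by
    funext k
    beta_reduce
    rw [Matrix.sub_apply, Matrix.mul_apply, Finset.sum_filter, Matrix.one_apply, Pi.single_apply]
    congr 1
    · refine Finset.sum_congr rfl fun j _ => ?_
      split_ifs with h
      · rfl
      · rw [hT, resolventDenom_band hξ M (not_le.1 h), zero_mul]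
    · simp only [eq_comm]
  rw [h1]
  refine (vecNorm_sub_le _ _).trans (add_le_add ?_ (vecNorm_single i).le)
  refine (vecNorm_sum_mul_le _ _ _).trans ?_
  refine (Finset.sum_le_card_nsmul _ _ ((‖z‖ + (2 * K + 1) ^ 2 * β) * β) fun j _ => ?_).trans ?_
  · exact mul_le_mul (hTb j) (hf.vecNorm_row_le hq j) (vecNorm_nonneg _) (by positivity)
  · rw [nsmul_eq_mul]
    gcongr
    exact card_band_le_real K i

theorem card_near_le (hs : IsBlockScale K r N q) (e : ℝ) :
    ((Finset.univ.filter fun i : Fin N => |pos i - e| ≤ 3 * r).card : ℝ) ≤ 7 * (r * N) := by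
  have hN' : (0 : ℝ) < N := by exact_mod_cast hs.N_pos
  have hr := hs.r_pos
  have h1 : ((Finset.univ.filter fun i : Fin N => |pos i - e| ≤ 3 * r).image
      fun i : Fin N => (i : ℤ)) ⊆ Finset.Icc ⌈N * (e - 3 * r) - 1⌉ ⌊N * (e + 3 * r) - 1⌋ := by
    intro t ht
    simp only [Finset.mem_image, Finset.mem_filter, Finset.mem_univ, true_and] at ht
    obtain ⟨i, hi, rfl⟩ := ht
    have h2 : pos i * N = i + 1 := by
      rw [pos, div_mul_cancel₀ _ hN'.ne']
    rw [abs_le] at hi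
    rw [Finset.mem_Icc, Int.ceil_le, Int.le_floor]
    push_cast
    constructor <;> nlinarith [hi.1, hi.2]
  have h2 := Finset.card_le_card h1
  rw [Finset.card_image_of_injective _ (fun a b hab => by
    simpa [Fin.ext_iff] using hab), Int.card_Icc] at h2
  have h3 : ((⌊N * (e + 3 * r) - 1⌋ + 1 - ⌈N * (e - 3 * r) - 1⌉).toNat : ℝ) ≤ 6 * (r * N) + 1 := by
    rcases le_total 0 (⌊N * (e + 3 * r) - 1⌋ + 1 - ⌈N * (e - 3 * r) - 1⌉) with h0 | h0
    · have h4 : ((⌊N * (e + 3 * r) - 1⌋ + 1 - ⌈N * (e - 3 * r) - 1⌉).toNat : ℝ)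
          = ((⌊N * (e + 3 * r) - 1⌋ + 1 - ⌈N * (e - 3 * r) - 1⌉ : ℤ) : ℝ) := by
        exact_mod_cast congrArg (fun t : ℤ => (t : ℝ)) (Int.toNat_of_nonneg h0)
      rw [h4]
      push_cast
      have h5 := Int.floor_le (N * (e + 3 * r) - 1)
      have h6 := Int.le_ceil (N * (e - 3 * r) - 1)
      linarith
    · rw [Int.toNat_of_nonpos h0]
      push_cast
      positivity
  have h4 : 1 ≤ r * N := by
    linarith [hs.add_le, (Nat.cast_nonneg K : (0 : ℝ) ≤ K), (Nat.cast_nonneg q : (0 : ℝ) ≤ q)]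
  have h5 := Nat.cast_le (α := ℝ).2 h2
  linarith

/-- Such an index is within `K` of an end of its block, so it has one of at most `2 K` residues
modulo `q` in each of at most `N / q + 1` blocks; then use `K ≤ r q`. -/
theorem card_edge_le (hs : IsBlockScale K r N q) :
    ((Finset.univ.filter fun i : Fin N =>
      ¬ ∀ j : Fin N, |(i : ℤ) - j| ≤ K → (j : ℕ) / q = (i : ℕ) / q).card : ℝ) ≤ 4 * (r * N) := by
  have hq := hs.pos
  have h1 : (Finset.univ.filter fun i : Fin N =>
      ¬ ∀ j : Fin N, |(i : ℤ) - j| ≤ K → (j : ℕ) / q = (i : ℕ) / q).card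
      ≤ (Finset.range (N / q + 1) ×ˢ (Finset.range K ∪ Finset.Ico (q - K) q)).card := by
    refine Finset.card_le_card_of_injOn (fun i => ((i : ℕ) / q, (i : ℕ) % q)) ?_ ?_
    · intro i hi
      simp only [Finset.coe_filter, Finset.mem_univ, true_and, Set.mem_ofPred_eq] at hi
      push Not at hi
      obtain ⟨j, hj, hne⟩ := hi
      simp only [Finset.coe_product, Set.mem_prod, Finset.mem_coe, Finset.mem_range,
        Finset.mem_union, Finset.mem_Ico]
      refine ⟨Nat.lt_succ_of_le (Nat.div_le_div_right i.isLt.le), ?_⟩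
      by_contra hcon
      push Not at hcon
      refine hne ?_
      have h2 := Nat.div_add_mod (i : ℕ) q
      have h3 := Nat.mod_lt (i : ℕ) hq
      rw [abs_le] at hj
      set X := (i : ℕ) / q
      have h4 : X * q = q * X := mul_comm _ _
      refine Nat.div_eq_of_lt_le ?_ ?_
      · omega
      · rw [Nat.succ_mul]
        by_contra hge
        have := hcon.2 (by omega)
        omega
    · intro a _ b _ hab
      simp only [Prod.mk.injEq] at hab
      refine Fin.ext ?_
      rw [← Nat.div_add_mod (a : ℕ) q, ← Nat.div_add_mod (b : ℕ) q, hab.1, hab.2]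
  have h2 : (Finset.range (N / q + 1) ×ˢ (Finset.range K ∪ Finset.Ico (q - K) q)).card
      ≤ (N / q + 1) * (K + K) := by
    rw [Finset.card_product, Finset.card_range]
    refine Nat.mul_le_mul_left _ ((Finset.card_union_le _ _).trans ?_)
    rw [Finset.card_range, Nat.card_Ico]
    omega
  have h3 := Nat.cast_le (α := ℝ).2 (h1.trans h2)
  refine h3.trans ?_
  push_cast
  have hq' : (0 : ℝ) < q := by exact_mod_cast hq
  have h4 : ((N / q : ℕ) : ℝ) ≤ N / q := Nat.cast_div_le
  have h5 : ((N / q : ℕ) : ℝ) * K ≤ r * N := by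
    calc ((N / q : ℕ) : ℝ) * K ≤ N / q * (r * q) := by
          gcongr
          exact hs.le
      _ = r * N := by field_simp
  linarith [hs.add_le]

/-- Good rows contribute `O(r²)` each. The `O(r N)` rows near the grid or a block edge contribute
`O(1)` each. This is why the residual is small only in the normalized Hilbert–Schmidt norm. -/
theorem hsNorm_residual_sq_le (hψ : IsProfile ψ) (hS : IsGrid ψ S L) (hξ : IsCovTensor K c₀ ξ)
    (hp : HasProfile K C ψ ξ) (hf : IsBulkField K ψ β ω z f) (hs : IsBlockScale K r N q)
    (hL : ∀ k ∈ Finset.Icc (-(K : ℤ)) K, ∀ l ∈ Finset.Icc (-(K : ℤ)) K, L k l ≤ L₀)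
    {Z : ℝ} (hz : ‖z‖ ≤ Z) :
    hsNorm (resolventDenom ξ z (blockAvg N q f) * blockAvg N q f - 1) ^ 2
      ≤ N * (((2 * K + 1) * (xiConst K C L₀ S.card * β * β)) ^ 2 * r ^ 2
        + (7 * S.card + 4) * ((2 * K + 1) * ((Z + (2 * K + 1) ^ 2 * β) * β) + 1) ^ 2 * r) := by
  have hr := hs.r_pos
  have hβ := hf.posField.nonneg
  have hN' : (0 : ℝ) < N := by exact_mod_cast hs.N_pos
  set R := resolventDenom ξ z (blockAvg N q f) * blockAvg N q f - 1 with hR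
  set a := (2 * K + 1) * (xiConst K C L₀ S.card * β * β) with ha
  set D := (2 * K + 1) * ((Z + (2 * K + 1) ^ 2 * β) * β) + 1 with hD
  set near : ℝ → Finset (Fin N) := fun e => Finset.univ.filter fun i : Fin N => |pos i - e| ≤ 3 * r
  set edge : Finset (Fin N) := Finset.univ.filter fun i : Fin N =>
      ¬ ∀ j : Fin N, |(i : ℤ) - j| ≤ K → (j : ℕ) / q = (i : ℕ) / q with hedge
  have hrow : ∀ i, vecNorm (fun k => R i k) ^ 2 ≤ (a * r) ^ 2 +
      ((∑ e ∈ S, if i ∈ near e then D ^ 2 else 0) + if i ∈ edge then D ^ 2 else 0) := by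
    intro i
    have hnn : ∀ e ∈ S, (0 : ℝ) ≤ if i ∈ near e then D ^ 2 else 0 := fun e _ => by
      split_ifs <;> positivity
    have hD2 : vecNorm (fun k => R i k) ^ 2 ≤ D ^ 2 := by
      refine pow_le_pow_left₀ (vecNorm_nonneg _) ?_ 2
      refine (vecNorm_residual_le hξ hf hs.pos i).trans ?_
      rw [hD]
      gcongr
    have ha2 : 0 ≤ (a * r) ^ 2 := by positivity
    have hs0 := Finset.sum_nonneg hnn
    by_cases h1 : ∃ e ∈ S, i ∈ near e
    · obtain ⟨e, he, hie⟩ := h1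
      have h2 := Finset.single_le_sum hnn he
      rw [if_pos hie] at h2
      have h3 : (0 : ℝ) ≤ if i ∈ edge then D ^ 2 else 0 := by split_ifs <;> positivity
      linarith
    by_cases h2 : i ∈ edge
    · rw [if_pos h2]
      linarith
    have h3 : vecNorm (fun k => R i k) ^ 2 ≤ (a * r) ^ 2 := by
      refine pow_le_pow_left₀ (vecNorm_nonneg _) ?_ 2
      refine (vecNorm_residual_good hψ hS hξ hp hf hs hL (fun e he => ?_) ?_).trans
        (le_of_eq (by rw [ha]; ring))
      · by_contra hle
        exact h1 ⟨e, he, Finset.mem_filter.2 ⟨Finset.mem_univ _, not_lt.1 hle⟩⟩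
      · by_contra hcon
        exact h2 (Finset.mem_filter.2 ⟨Finset.mem_univ _, hcon⟩)
    rw [if_neg h2]
    linarith
  rw [hsNorm_sq_row]
  refine (Finset.sum_le_sum fun i _ => hrow i).trans ?_
  rw [Finset.sum_add_distrib, Finset.sum_add_distrib, Finset.sum_comm, Finset.sum_const,
    Finset.card_univ, Fintype.card_fin, nsmul_eq_mul]
  have h1 : ∑ e ∈ S, ∑ i : Fin N, (if i ∈ near e then D ^ 2 else 0)
      ≤ S.card * (7 * (r * N) * D ^ 2) := by
    rw [← nsmul_eq_mul]
    refine Finset.sum_le_card_nsmul _ _ _ fun e _ => ?_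
    rw [Finset.sum_ite_mem, Finset.univ_inter, Finset.sum_const, nsmul_eq_mul]
    gcongr
    exact card_near_le hs e
  have h2 : ∑ i : Fin N, (if i ∈ edge then D ^ 2 else 0) ≤ 4 * (r * N) * D ^ 2 := by
    rw [Finset.sum_ite_mem, Finset.univ_inter, Finset.sum_const, nsmul_eq_mul]
    gcongr
    exact card_edge_le hs
  have e : N * (a ^ 2 * r ^ 2 + (7 * S.card + 4) * D ^ 2 * r)
      = N * (a * r) ^ 2 + (S.card * (7 * (r * N) * D ^ 2) + 4 * (r * N) * D ^ 2) := by ring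
  rw [e]
  gcongr

end Residual

/-! ### Assembly: from the limiting solution to stability of the matrix equation. -/

section Main
open Matrix
open scoped Matrix.Norms.L2Operator

variable {K N q : ℕ} {C c₀ L₀ β ω r : ℝ} {ψ : ℝ → ℝ → ℤ → ℤ → ℝ} {S : Finset ℝ} {L : ℤ → ℤ → ℝ}
  {f : ℝ → ℤ → ℂ} {z : ℂ} {ξ : Fin N → Fin N → Fin N → Fin N → ℝ}

/-- For the block average `M` take `G = T⁻¹` with `T = -z - Ξ(M)`. Then `M - G = G (T M - 1)` is
small in Hilbert–Schmidt norm, so `Ξ(M - G)` is small in operator norm. The trace loses `ω / 4` from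
quadrature and `ω / 4` from `M - G`. -/
theorem exists_isApproxSolution (hc₀ : 0 < c₀) (hω : 0 < ω) (hz : 0 ≤ z.im)
    (hξ : IsCovTensor K c₀ ξ) (hf : IsPosField β f) (hs : IsBlockScale K r N q)
    (htr : ω ≤ (∫ φ, f φ 0 ∂unitMeasure).im) (hr : (2 * K + 1) * 13 * β * r ≤ ω / 4)
    {δ ε : ℝ} (hδ : 0 ≤ δ) (hδω : δ ≤ c₀ * ω / 2 * (ω / 4))
    (hδε : (2 * K + 1) ^ 2 * δ ≤ c₀ * ω / 2 * ε)
    (hres : hsNorm (resolventDenom ξ z (blockAvg N q f) * blockAvg N q f - 1) ^ 2 ≤ N * δ ^ 2) :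
    ∃ G E, IsApproxSolution (XiLin ξ) z (ω / 2) ε G E := by
  have hN' : (0 : ℝ) < N := by exact_mod_cast hs.N_pos
  set M := blockAvg N q f with hM
  set T := resolventDenom ξ z M with hT
  set a := c₀ * ω / 2 with ha
  have ha0 : 0 < a := by positivity
  have htrM := trace_blockAvg_ge hf hs htr
  have htr2 : ω / 2 * N ≤ M.trace.im := by
    refine le_trans ?_ htrM
    gcongr
    linarith
  have hTim : ∀ x, a * vecNorm x ^ 2 ≤ -(qf T x x).im := by
    intro x
    have h1 := hξ.im_qf_Xi_ge hc₀.le (im_qf_blockAvg_nonneg hf) htr2 x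
    rw [hT, resolventDenom, qf_sub, qf_neg, qf_smul, qf_one, Complex.sub_im, Complex.neg_im,
      Complex.im_mul_ofReal]
    have h2 : 0 ≤ z.im * vecNorm x ^ 2 := by positivity
    have e : a * vecNorm x ^ 2 = c₀ * (ω / 2) * vecNorm x ^ 2 := by rw [ha]; ring
    rw [e]
    linarith
  have hlow : ∀ x, a * vecNorm x ≤ vecNorm (T *ᵥ x) := by
    intro x
    have h1 := hTim x
    have h2 := (neg_le_abs _).trans ((Complex.abs_im_le_norm (qf T x x)).trans
      (norm_star_dotProduct_le x (T *ᵥ x)))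
    rcases (vecNorm_nonneg x).eq_or_lt with h0 | h0
    · rw [← h0, mul_zero]
      exact vecNorm_nonneg _
    · refine le_of_mul_le_mul_left ?_ h0
      nlinarith
  have hunit : IsUnit T := by
    rw [← Matrix.mulVec_injective_iff_isUnit]
    intro x y hxy
    have h1 := hlow (x - y)
    have hxy : T *ᵥ x = T *ᵥ y := hxy
    rw [mulVec_sub, hxy, sub_self, vecNorm_eq_zero.2 rfl] at h1
    have h2 : vecNorm (x - y) = 0 := le_antisymm (by
      by_contra hlt
      push Not at hlt
      nlinarith) (vecNorm_nonneg _)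
    exact sub_eq_zero.1 (vecNorm_eq_zero.1 h2)
  have hdet : IsUnit T.det := (Matrix.isUnit_iff_isUnit_det T).1 hunit
  set G := T⁻¹ with hG
  have hTG : T * G = 1 := Matrix.mul_nonsing_inv T hdet
  have hGT : G * T = 1 := Matrix.nonsing_inv_mul T hdet
  have hGn : ‖G‖ ≤ 1 / a := opNorm_le_inv_of_le ha0 hTG hlow
  have hdiff : M - G = G * (T * M - 1) := by
    rw [mul_sub, ← mul_assoc, hGT, one_mul, mul_one]
  have hhs : hsNorm (M - G) ≤ 1 / a * (√N * δ) := by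
    rw [hdiff]
    refine (hsNorm_mul_le_left _ _).trans (mul_le_mul hGn ?_ (hsNorm_nonneg _) (by positivity))
    refine abs_le_of_sq_le_sq' ?_ (by positivity) |>.2
    rwa [mul_pow, Real.sq_sqrt hN'.le]
  -- This error makes `-z - Ξ(G) - E` exactly equal to `T`.
  refine ⟨G, XiLin ξ M - XiLin ξ G, ?_, ?_, ?_, ?_⟩
  · rw [sub_sub, add_sub_cancel]
    exact hGT
  · intro x
    have h1 := hTim (G *ᵥ x)
    have h2 : qf G x x = star (qf T (G *ᵥ x) (G *ᵥ x)) := by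
      rw [← qf_conjTranspose, ← qf_conj_mul, ← conjTranspose_mul, hTG, conjTranspose_one, one_mul]
    rw [h2, RCLike.star_def, Complex.conj_im]
    exact (by positivity : 0 ≤ a * vecNorm (G *ᵥ x) ^ 2).trans h1
  · rw [Fintype.card_fin]
    have h1 : ‖(M - G).trace‖ ≤ √N * hsNorm (M - G) := by
      have h2 := norm_trace_mul_le (1 : Matrix (Fin N) (Fin N) ℂ) (M - G)
      rw [conjTranspose_one, one_mul] at h2
      refine h2.trans (mul_le_mul_of_nonneg_right ?_ (hsNorm_nonneg _))
      refine abs_le_of_sq_le_sq' ?_ (by positivity) |>.2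
      rw [hsNorm_one_sq, Fintype.card_fin, Real.sq_sqrt hN'.le]
    have h3 : √N * hsNorm (M - G) ≤ N * (ω / 4) := by
      calc √N * hsNorm (M - G) ≤ √N * (1 / a * (√N * δ)) := by gcongr
        _ = √N * √N * (δ / a) := by ring
        _ ≤ N * (ω / 4) := by
          rw [Real.mul_self_sqrt hN'.le]
          refine mul_le_mul_of_nonneg_left ?_ hN'.le
          rw [div_le_iff₀ ha0]
          linarith
    have h4 := (Complex.im_le_norm _).trans (h1.trans h3)
    rw [Matrix.trace_sub, Complex.sub_im] at h4
    have h5 : (ω - (2 * K + 1) * 13 * β * r) * N ≥ 3 * ω / 4 * N := by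
      have : 3 * ω / 4 ≤ ω - (2 * K + 1) * 13 * β * r := by linarith
      gcongr
    linarith
  · rw [← map_sub]
    have h1 := norm_Xi_le_hs hξ (M - G)
    have hsN : 0 < √(N : ℝ) := Real.sqrt_pos.2 hN'
    refine le_of_mul_le_mul_left ?_ hsN
    refine h1.trans ?_
    calc (2 * K + 1) ^ 2 * hsNorm (M - G) ≤ (2 * K + 1) ^ 2 * (1 / a * (√N * δ)) := by gcongr
      _ = √N * ((2 * K + 1) ^ 2 * δ / a) := by ring
      _ ≤ √N * ε := by
        refine mul_le_mul_of_nonneg_left ?_ hsN.le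
        rw [div_le_iff₀ ha0]
        linarith

theorem exists_bulk_stability (hψ : IsProfile ψ) (hS : IsGrid ψ S L) (hc₀ : 0 < c₀)
    (hβ : 0 ≤ β) (hω : 0 < ω)
    (hL : ∀ k ∈ Finset.Icc (-(K : ℤ)) K, ∀ l ∈ Finset.Icc (-(K : ℤ)) K, L k l ≤ L₀) :
    ∃ (ε c : ℝ) (N₀ : ℕ), 0 < ε ∧ 0 < c ∧ 0 < N₀ ∧ ∀ N, N₀ ≤ N →
      ∀ (z : ℂ) (f : ℝ → ℤ → ℂ) (ξ : Fin N → Fin N → Fin N → Fin N → ℝ), 0 < z.im →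
      IsBulkField K ψ β ω z f → IsCovTensor K c₀ ξ → HasProfile K C ψ ξ →
      ∀ M M' R : Matrix (Fin N) (Fin N) ℂ, M * resolventDenom ξ z M = 1 →
        (∀ x, 0 ≤ (qf M x x).im) → M' = (resolventDenom ξ z M')⁻¹ + R →
        (∀ i j, ‖(M' - M) i j‖ ≤ ε) → ∀ ρ : ℝ, (∀ i j, ‖R i j‖ ≤ ρ) →
        ∀ i j, ‖(M' - M) i j‖ ≤ c * ρ := by
  have h0m : (0 : ℤ) ∈ Finset.Icc (-(K : ℤ)) K := by simp
  have hL₀ : 0 ≤ L₀ := (hS.nonneg 0 0).trans (hL 0 h0m 0 h0m)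
  have hκ : (0 : ℝ) < (2 * K + 1) ^ 2 := by positivity
  obtain ⟨ε₁, hε₁, H₁⟩ := exists_trace_lower_bound.{0} hc₀ hκ.le (half_pos hω)
  -- The trace bound is halved twice: for the approximate solution `G`, then for `M`.
  obtain ⟨θ, ε₂, c, hθ, hε₂, hc, H₂⟩ :=
    exists_max_stability.{0} hc₀ hκ.le hκ.le (half_pos (half_pos hω))
  set a := c₀ * ω / 2 with ha
  have ha0 : 0 < a := by positivity
  set δ := a * min (ω / 4) (ε₁ / (2 * K + 1) ^ 2) with hδ
  have hδ0 : 0 < δ := mul_pos ha0 (lt_min (by positivity) (by positivity))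
  have hδ1 : δ ≤ a * (ω / 4) := mul_le_mul_of_nonneg_left (min_le_left _ _) ha0.le
  have hδ2 : (2 * K + 1) ^ 2 * δ ≤ a * ε₁ := by
    calc (2 * K + 1) ^ 2 * δ ≤ (2 * K + 1) ^ 2 * (a * (ε₁ / (2 * K + 1) ^ 2)) := by
          gcongr
          exact mul_le_mul_of_nonneg_left (min_le_right _ _) ha0.le
      _ = a * ε₁ := by field_simp
  set Z := (1 + (2 * K + 1) ^ 2 * (L₀ * β ^ 2)) / ω with hZ
  set A₁ := ((2 * K + 1) * (xiConst K C L₀ S.card * β * β)) ^ 2 with hA₁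
  set A₂ := (7 * S.card + 4) * ((2 * K + 1) * ((Z + (2 * K + 1) ^ 2 * β) * β) + 1) ^ 2 with hA₂
  have hA₁0 : 0 ≤ A₁ := sq_nonneg _
  have hA₂0 : 0 ≤ A₂ := by positivity
  -- In this order: `r² ≤ r`, a quadrature error of the trace at most `ω / 4`, and a residual at
  -- most `δ`.
  set r := min 1 (min (ω / (4 * ((2 * K + 1) * 13 * β + 1))) (δ ^ 2 / (A₁ + A₂ + 1))) with hr
  have hr0 : 0 < r := lt_min one_pos (lt_min (by positivity) (by positivity))
  have hr1 : r ≤ 1 := min_le_left _ _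
  have hr2 : (2 * K + 1) * 13 * β * r ≤ ω / 4 := by
    have h1 : r ≤ ω / (4 * ((2 * K + 1) * 13 * β + 1)) := (min_le_right _ _).trans (min_le_left _ _)
    rw [le_div_iff₀ (by positivity)] at h1
    linarith
  have hr3 : A₁ * r ^ 2 + A₂ * r ≤ δ ^ 2 := by
    have h1 : r ≤ δ ^ 2 / (A₁ + A₂ + 1) := (min_le_right _ _).trans (min_le_right _ _)
    rw [le_div_iff₀ (by positivity)] at h1
    have h2 : A₁ * r ^ 2 ≤ A₁ * r := by
      gcongr
      nlinarith
    linarith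
  obtain ⟨N₁, hN₁⟩ := exists_isBlockScale K hr0
  obtain ⟨N₂, hN₂⟩ := exists_nat_gt (2 * (2 * K + 1) ^ 2 / min ε₁ θ)
  refine ⟨ε₂, c, max N₁ N₂ + 1, hε₂, hc, Nat.succ_pos _, ?_⟩
  intro N hN z f ξ hz hf hξ hp M M' R hM hMim hM' hε ρ hρ
  have hNN₁ : N₁ ≤ N := (le_max_left _ _).trans ((Nat.le_succ _).trans hN)
  have hNN₂ : (N₂ : ℝ) ≤ N := by
    exact_mod_cast (le_max_right N₁ N₂).trans ((Nat.le_succ _).trans hN)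
  obtain ⟨q, hs⟩ := hN₁ N hNN₁
  have hN' : (0 : ℝ) < N := by exact_mod_cast hs.N_pos
  have : Nonempty (Fin N) := ⟨⟨0, hs.N_pos⟩⟩
  have hsmall : 2 * (2 * K + 1) ^ 2 / N ≤ min ε₁ θ := by
    have hmin : 0 < min ε₁ θ := lt_min hε₁ hθ
    rw [div_lt_iff₀ hmin] at hN₂
    rw [div_le_iff₀ hN', mul_comm _ (N : ℝ)]
    exact hN₂.le.trans (mul_le_mul_of_nonneg_right hNN₂ hmin.le)
  have hΦ := hξ.isSelfEnergy hc₀.le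
  have hzZ : ‖z‖ ≤ Z := by
    rw [hZ, le_div_iff₀ hω]
    exact hf.norm_z_le hS hL
  have hres := (hsNorm_residual_sq_le hψ hS hξ hp hf hs hL hzZ).trans
    (mul_le_mul_of_nonneg_left hr3 hN'.le)
  obtain ⟨G, E, hGE⟩ := exists_isApproxSolution hc₀ hω hz.le hξ hf.posField hs hf.trace hr2 hδ0.le
    hδ1 hδ2 hres
  have htr := H₁ (Fin N) (XiLin ξ) z G E M hz (hΦ.mono (hsmall.trans (min_le_left _ _))) hGE hM hMim
  exact H₂ (Fin N) (XiLin ξ) z M M' R hz.le (hΦ.mono (hsmall.trans (min_le_right _ _)))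
    (fun X b hb => norm_Xi_le_max hξ X hs.N_pos hb) hM hMim htr hM' hε ρ hρ

theorem norm_apply_le_maxNorm (A : Matrix (Fin N) (Fin N) ℂ) (i j : Fin N) :
    ‖A i j‖ ≤ maxNorm A :=
  le_ciSup (f := fun s : Fin N × Fin N => ‖A s.1 s.2‖) (Set.finite_range _).bddAbove (i, j)

open scoped ComplexOrder in
theorem IsMatrixSolution.im_qf_nonneg {M : Matrix (Fin N) (Fin N) ℂ}
    (h : IsMatrixSolution ξ z M) (x : Fin N → ℂ) : 0 ≤ (qf M x x).im := by
  have h1 := h.1.posSemidef.dotProduct_mulVec_nonneg x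
  have h2 := qf_imPart M x
  rw [qf, imPart] at h2
  rw [h2] at h1
  exact_mod_cast h1

end Main
end CorrelatedMatrix

theorem mainTheorem5
    (K : ℕ) (hK : 0 < K) (τ : ℝ) (hτ : 0 < τ ∧ τ ≤ 1) (μ : ℕ → ℝ) (hμ : μ 2 = 1)
    (ψ : ℝ → ℝ → ℤ → ℤ → ℝ) (hψ : CorrelatedMatrix.IsProfile ψ)
    (C c₀ : ℝ) (hc₀ : 0 < c₀)
    (D : Set ℂ) (hDopen : IsOpen D) (hDconn : IsConnected D) (hDpos : ∀ z ∈ D, 0 < z.im)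
    (m : ℂ → ℝ → ℤ → ℂ) (hm : ∀ z ∈ D, CorrelatedMatrix.IsLimitSolution ψ z (m z))
    (ω : ℝ) (hω : 0 < ω) (hmω : ∀ z ∈ D, ω ≤ (CorrelatedMatrix.trT (m z)).im) :
    ∃ (ε c : ℝ) (N₀ : ℕ), 0 < ε ∧ 0 < c ∧
      ∀ (Ω : ℕ → Type*) [∀ N, MeasurableSpace (Ω N)]
        (P : ∀ N, MeasureTheory.Measure (Ω N)) [∀ N, MeasureTheory.IsProbabilityMeasure (P N)]
        (x : ∀ N, Fin N → Fin N → Ω N → ℝ),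
        CorrelatedMatrix.IsModel K τ μ ψ C P x →
        CorrelatedMatrix.IsPosDefTensor c₀ P x →
        ∀ N : ℕ, N₀ ≤ N → ∀ z ∈ D, ∀ M M' R : Matrix (Fin N) (Fin N) ℂ,
          CorrelatedMatrix.IsMatrixSolution (CorrelatedMatrix.tensor (P N) (x N)) z M →
          CorrelatedMatrix.IsPerturbedSolution (CorrelatedMatrix.tensor (P N) (x N)) z M' R →
          max (CorrelatedMatrix.maxNorm (M' - M)) (CorrelatedMatrix.maxNorm R) ≤ ε →
          CorrelatedMatrix.maxNorm (M' - M) ≤ c * (CorrelatedMatrix.maxNorm R + 1 / (N : ℝ)) := by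
  -- The constants must precede the model, but the finite range and the coercivity of `ψ` come from
  -- tensors of every size. If these do not exist, no model exists and the claim is vacuous.
  by_cases h : ∀ N : ℕ, ∃ ξ : Fin N → Fin N → Fin N → Fin N → ℝ,
      CorrelatedMatrix.IsCovTensor K c₀ ξ ∧ CorrelatedMatrix.HasProfile K C ψ ξ
  · obtain ⟨S, L, hS⟩ := hψ.exists_isGrid
    have hR := CorrelatedMatrix.hasRange_of_tensors hψ hS h
    have hL : ∀ k ∈ Finset.Icc (-(K : ℤ)) K, ∀ l ∈ Finset.Icc (-(K : ℤ)) K,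
        L k l ≤ ∑ k ∈ Finset.Icc (-(K : ℤ)) K, ∑ l ∈ Finset.Icc (-(K : ℤ)) K, L k l := by
      intro k hk l hl
      exact (Finset.single_le_sum (f := fun l => L k l) (fun l _ => hS.nonneg k l) hl).trans
        (Finset.single_le_sum (f := fun k => ∑ l ∈ Finset.Icc (-(K : ℤ)) K, L k l)
          (fun k _ => Finset.sum_nonneg fun l _ => hS.nonneg k l) hk)
    obtain ⟨ε, c, N₀, hε, hc, hN₀, H⟩ := CorrelatedMatrix.exists_bulk_stability (C := C) hψ hS hc₀
      (β := 1 / (c₀ * ω)) (by positivity) hω hL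
    refine ⟨ε, c, N₀, hε, hc, ?_⟩
    intro Ω _ P _ x hx hP N hN z hz M M' R hM hM' hle
    have hf := (hm z hz).isBulkField hψ hS hc₀ h hR hL (hDpos z hz).le hω (hmω z hz)
    have hmax := H N hN z (m z) _ (hDpos z hz) hf (hx.isCovTensor hμ hP N) (hx.hasProfile N)
      M M' R hM.2 hM.im_qf_nonneg hM'.2
      (fun i j => (CorrelatedMatrix.norm_apply_le_maxNorm _ i j).trans ((le_max_left _ _).trans hle))
      (CorrelatedMatrix.maxNorm R) (CorrelatedMatrix.norm_apply_le_maxNorm R)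
    have : Nonempty (Fin N) := ⟨⟨0, hN₀.trans_le hN⟩⟩
    -- The bound obtained is `c ‖R‖_∞`; the term `1 / N` is added only to match the claim.
    refine (ciSup_le fun s : Fin N × Fin N => hmax s.1 s.2).trans ?_
    gcongr
    exact le_add_of_nonneg_right (by positivity)
  · refine ⟨1, 1, 0, one_pos, one_pos, ?_⟩
    intro Ω _ P _ x hx hP
    exact absurd (fun N => ⟨_, hx.isCovTensor hμ hP N, hx.hasProfile N⟩) h
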